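/- All graphs are finite and may have loops and parallel edges. Consider the following search problem. \textsc{Maximum Weight Packing of Trees of Order Not Divisible by $k$} \textbf{Input:} an integer $k\ge 2$, a graph $G$, and a weight function $w:E(G)\to\mathbb{Q}$. \textbf{Problem:} find pairwise vertex-disjoint subgraphs $T_1,\dots,T_m$ of $G$, for some $m\ge 0$, each of which is a tree with $|V(T_i)|\not\equiv 0\pmod k$, such that $\sum_{i=1}^m\sum_{e\in E(T_i)}w(e)$ is maximum among all such families (of any size). Then this problem can be solved in polynomial time: there is a deterministic Turing machine which, on every input, outputs the vertex sets and the edge sets of the trees of one such maximum weight family, and whose number of steps is bounded by a polynomial in the length of the input. Here $G$ is given by the list of its vertices and the list of its edges with their ends, and $k$ and the numerators and denominators of the weights are written in binary ($k$ is part of the input). -/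

import Mathlib

/-! ### Trees in finite multigraphs (loops and parallel edges allowed) -/

namespace TreePacking

/-- A multigraph has a cycle if, for some `ℓ ≥ 1`, there are distinct vertices `v 0, …, v (ℓ - 1)`
and distinct edges `e 0, …, e (ℓ - 1)` such that `e i` joins `v i` to `v (i + 1)`, where `i + 1` is
taken modulo `ℓ`. A loop is a cycle with `ℓ = 1`; two parallel edges form a cycle with `ℓ = 2`. -/
def HasCycle {α β : Type*} (G : Graph α β) : Prop :=
  ∃ (ℓ : ℕ) (_ : NeZero ℓ) (v : Fin ℓ → α) (e : Fin ℓ → β),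
    Function.Injective v ∧ Function.Injective e ∧ ∀ i, G.IsLink (e i) (v i) (v (i + 1))

/-- A multigraph is connected if it has a vertex and any two of its vertices are joined by a
walk. -/
def IsConnected {α β : Type*} (G : Graph α β) : Prop :=
  G.vertexSet.Nonempty ∧
    ∀ x ∈ G.vertexSet, ∀ y ∈ G.vertexSet, Relation.ReflTransGen G.Adj x y

/-- A tree is a connected graph without cycles. -/
def IsTree {α β : Type*} (G : Graph α β) : Prop :=
  IsConnected G ∧ ¬ HasCycle G

/-! ### The problem -/

/-- An edge as it is listed in an input: its two ends and its rational weight. -/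
structure Edge where
  fst : ℕ
  snd : ℕ
  weight : ℚ

/-- An input: an integer `k ≥ 2` and a finite graph with a rational weight on every edge. The graph
is given by its number `n` of vertices, which are named `0, …, n - 1`, and by the list of its edges;
the edges are named by their positions `0, 1, 2, …` in this list. Loops and parallel edges are
allowed. -/
structure Instance where
  k : ℕ
  two_le_k : 2 ≤ k
  n : ℕ
  edges : List Edge
  ends_lt : ∀ e ∈ edges, e.fst < n ∧ e.snd < n

/-- The graph of an input. -/
def Instance.graph (I : Instance) : Graph ℕ ℕ where
  vertexSet := {v | v < I.n}
  IsLink i x y := ∃ e, I.edges[i]? = some e ∧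
    ((x = e.fst ∧ y = e.snd) ∨ (x = e.snd ∧ y = e.fst))
  isLink_symm := by
    rintro i -
    constructor
    rintro x y ⟨e, he, h⟩
    exact ⟨e, he, by tauto⟩
  eq_or_eq_of_isLink_of_isLink := by
    rintro i x y v w ⟨e, he, h⟩ ⟨e', he', h'⟩
    rw [he, Option.some.injEq] at he'
    subst he'
    rcases h with ⟨rfl, rfl⟩ | ⟨rfl, rfl⟩ <;> rcases h' with ⟨rfl, rfl⟩ | ⟨rfl, rfl⟩ <;> simp
  left_mem_of_isLink := by
    rintro i x y ⟨e, he, h⟩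
    have := I.ends_lt e (List.mem_of_getElem? he)
    rcases h with ⟨rfl, rfl⟩ | ⟨rfl, rfl⟩
    · exact this.1
    · exact this.2

/-- The weight `w(i)` of the edge named `i` (and `0` if there is no such edge). -/
def Instance.weight (I : Instance) (i : ℕ) : ℚ :=
  (I.edges[i]?.map Edge.weight).getD 0

/-- `T₁, …, Tₘ` are pairwise vertex-disjoint subgraphs of the graph of the input, each of which is a
tree whose number of vertices is not divisible by `k`. -/
def Instance.IsPacking (I : Instance) (T : List (Graph ℕ ℕ)) : Prop :=
  (∀ t ∈ T, t ≤ I.graph ∧ IsTree t ∧ ¬ t.vertexSet.ncard ≡ 0 [MOD I.k]) ∧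
    T.Pairwise fun s t => Disjoint s.vertexSet t.vertexSet

/-- The total weight `∑ i, ∑ e ∈ E(Tᵢ), w(e)`. -/
noncomputable def Instance.totalWeight (I : Instance) (T : List (Graph ℕ ℕ)) : ℚ :=
  (T.map fun t => ∑ᶠ e ∈ t.edgeSet, I.weight e).sum

/-- `T₁, …, Tₘ` is a packing of maximum total weight. -/
def Instance.IsMaximumPacking (I : Instance) (T : List (Graph ℕ ℕ)) : Prop :=
  I.IsPacking T ∧ ∀ T', I.IsPacking T' → I.totalWeight T' ≤ I.totalWeight T

/-- An output: a list of pairs, the `i`-th pair consisting of a list of the vertices and a list of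
the edges of the `i`-th tree. -/
abbrev Output : Type := List (List ℕ × List ℕ)

/-- The output lists the vertices and the edges of each member of a maximum weight packing. -/
def Instance.IsSolution (I : Instance) (o : Output) : Prop :=
  ∃ T : List (Graph ℕ ℕ), I.IsMaximumPacking T ∧
    List.Forall₂ (fun p t => t.vertexSet = {v | v ∈ p.1} ∧ t.edgeSet = {e | e ∈ p.2}) o T

/-! ### Inputs and outputs as strings over the alphabet `blank, 0, 1, bra, ket, comma` -/

open Computability (Γ')

/-- A natural number in binary. -/
def encodeNat (x : ℕ) : List Γ' := (Computability.encodeNat x).map Γ'.bit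

/-- An edge: `bra`, first end, `comma`, second end, `comma`, sign bit, absolute value of the
numerator and `comma`, denominator, `ket`, with all numbers in binary. -/
def encodeEdge (e : Edge) : List Γ' :=
  Γ'.bra :: (encodeNat e.fst ++ Γ'.comma :: (encodeNat e.snd ++ Γ'.comma ::
    Γ'.bit (decide (e.weight < 0)) :: (encodeNat e.weight.num.natAbs ++ Γ'.comma ::
      (encodeNat e.weight.den ++ [Γ'.ket]))))

/-- An input: `k` in binary, `comma`, the vertices as `n` symbols `1`, `comma`, the edges. So its
length is at least the number of vertices plus the number of edges. -/
def encodeInstance (I : Instance) : List Γ' :=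
  encodeNat I.k ++ Γ'.comma :: (List.replicate I.n (Γ'.bit true) ++ Γ'.comma ::
    I.edges.flatMap encodeEdge)

/-- A list of natural numbers: `bra`, the numbers in binary, each followed by `comma`, `ket`. -/
def encodeList (l : List ℕ) : List Γ' :=
  Γ'.bra :: (l.flatMap (fun x => encodeNat x ++ [Γ'.comma]) ++ [Γ'.ket])

/-- An output: for each tree, the list of its vertices and then the list of its edges. -/
def encodeOutput (o : Output) : List Γ' :=
  o.flatMap fun p => encodeList p.1 ++ encodeList p.2

/-! ### Polynomial time -/

/-- A search problem, given by the relation `R a b` that `b` is a correct answer to the input `a`,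
is solvable in polynomial time if a single Turing machine computes a correct answer to each input,
in a number of steps that is bounded by a polynomial in the length of the string that encodes the
input. -/
def SolvableInPolyTime {α β Γ₀ Γ₁ : Type} (encodeIn : α → List Γ₀) (encodeOut : β → List Γ₁)
    (R : α → β → Prop) : Prop :=
  ∃ f : α → β, (∀ a, R a (f a)) ∧
    Nonempty (Turing.TM2ComputableInPolyTime encodeIn encodeOut f)

end TreePacking

/-! A packing is determined, up to single-vertex trees, by its set of edges. Let `V` be the vertex
set of the graph. An isolated vertex has order 1, which `k ≥ 2` does not divide, so the edge sets of
packings are exactly the forests all of whose components on `V` have order not divisible by `k`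
(`Feasible`). One direction is `Instance.IsPacking.feasible`; in the other, the components of a
feasible set form a packing with these edges (`Instance.isPacking_subgraph`,
`Instance.edgesOf_subgraph`).

A maximum weight feasible set is found greedily. Edges are treated in the order of decreasing `|w
e|`, with a set `A` of chosen edges and a set `P` of edges not yet discarded, keeping the invariant
`HasOptimum`: some optimum lies between `A` and `P`. An edge of nonnegative weight is chosen, and
one of negative weight discarded, unless this fails a simple test: the chosen edges stay acyclic and
each component of `P` contains a component of `A` of order not divisible by `k` (`Extendable`). The
test is necessary for a feasible set between `A` and `P` to exist (`Good.extendable`), so its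
failure forces the opposite decision. If it succeeds, `e` is put into or taken out of the optimum,
and at most one further edge `f` of `P` outside `A` has to be changed to make the result feasible
again. As `|w f| ≤ |w e|`, no weight is lost (`HasOptimum.insert`, `HasOptimum.erase`). The core is
`exists_exchange`: a forest between `A` and `P` with exactly one bad component is repaired by one
edge, either joining that component to a good one or splitting it into two good parts.

For the running time, structured programs on four stacks are compiled into stack machines
(`code_correct`). All data are binary trees in prefix form on one stack, and `PolyFun` collects the
functions computed on them in polynomial time. This class is closed under composition, pairing, case
distinction and, under a growth condition, folding over lists (`PolyFun.foldl`). The algorithm is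
written with these operations, so `fun_prop` derives most of its polynomial bound from its text. -/

namespace TreePacking

open Computability (Γ')

/-! ### A structured language for stack machines -/

/-- The stacks of the machine: `x` holds the data, the others are auxiliary. -/
inductive Stk
  | x | y | z | w
  deriving DecidableEq

instance : Fintype Stk := ⟨{.x, .y, .z, .w}, fun k => by cases k <;> simp⟩

/-- Structured programs working on four stacks over the alphabet `Γ'`. -/
inductive Prog
  /-- Do nothing. -/
  | skip
  /-- Push a fixed symbol. -/
  | push (k : Stk) (a : Γ')
  /-- Pop a symbol, if there is one, and branch on it. -/
  | pop (k : Stk) (f : Option Γ' → Prog)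
  /-- Sequential composition. -/
  | seq (p q : Prog)
  /-- Pop a symbol. If there is none, or if it is an end symbol, exit; otherwise run the
  corresponding body and repeat. -/
  | loop (k : Stk) (isEnd : Γ' → Bool) (body : Γ' → Prog)

namespace Prog

open Turing Function

/-- `Exec p S t S'` means that `p` transforms the stacks `S` into `S'` in at most `t` steps. -/
inductive Exec : Prog → (Stk → List Γ') → ℕ → (Stk → List Γ') → Prop
  | skip {S t} (ht : 1 ≤ t) : Exec skip S t S
  | push {k a S t} (ht : 1 ≤ t) : Exec (push k a) S t (update S k (a :: S k))
  | pop {k f S t t' S'} (h : Exec (f (S k).head?) (update S k (S k).tail) t S') (ht : t + 1 ≤ t') :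
      Exec (pop k f) S t' S'
  | seq {p q S t S' t' S'' t''} (h : Exec p S t S') (h' : Exec q S' t' S'') (ht : t + t' ≤ t'') :
      Exec (seq p q) S t'' S''
  | loop_empty {k isEnd body S t} (h : S k = []) (ht : 1 ≤ t) : Exec (loop k isEnd body) S t S
  | loop_exit {k isEnd body S t a} (h : (S k).head? = some a) (ha : isEnd a = true) (ht : 1 ≤ t) :
      Exec (loop k isEnd body) S t (update S k (S k).tail)
  | loop_step {k isEnd body S a t S' t' S'' t''} (hk : (S k).head? = some a) (ha : isEnd a = false)
      (h : Exec (body a) (update S k (S k).tail) t S') (h' : Exec (loop k isEnd body) S' t' S'')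
      (ht : t + t' + 1 ≤ t'') : Exec (loop k isEnd body) S t'' S''

/-- The labels of the machine that is compiled from a program. -/
def Lab : Prog → Type
  | skip => Unit
  | push _ _ => Unit
  | pop _ f => Option (Σ a, Lab (f a))
  | seq p q => Lab p ⊕ Lab q
  | loop _ _ body => Option (Σ a, Lab (body a))

/-- There are finitely many labels. -/
@[reducible]
def labFintype : (p : Prog) → Fintype (Lab p)
  | skip => inferInstanceAs (Fintype Unit)
  | push _ _ => inferInstanceAs (Fintype Unit)
  | pop _ f =>
      have := fun a => labFintype (f a)
      inferInstanceAs (Fintype (Option (Σ a, Lab (f a))))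
  | seq p q =>
      have := labFintype p
      have := labFintype q
      inferInstanceAs (Fintype (Lab p ⊕ Lab q))
  | loop _ _ body =>
      have := fun a => labFintype (body a)
      inferInstanceAs (Fintype (Option (Σ a, Lab (body a))))

/-- The first label of a program. -/
def entry : (p : Prog) → Lab p
  | skip => ()
  | push _ _ => ()
  | pop _ _ => none
  | seq p _ => Sum.inl (entry p)
  | loop _ _ _ => none

/-- The statements of the machine that is compiled from a program, where `emb` embeds the labels of
the program into those of the machine, and `nxt` is the label where the machine continues. -/
def code {Λ : Type} : (p : Prog) → (Lab p → Λ) → Λ → Lab p → TM2.Stmt (fun _ : Stk => Γ') Λ (Option Γ')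
  | skip, _, nxt => fun _ => .goto fun _ => nxt
  | push k a, _, nxt => fun _ => .push k (fun _ => a) (.goto fun _ => nxt)
  | pop k f, emb, nxt => fun l => match l with
      | none => .pop k (fun _ a => a) (.goto fun v => emb (some ⟨v, entry (f v)⟩))
      | some ⟨a, l⟩ => code (f a) (fun l => emb (some ⟨a, l⟩)) nxt l
  | seq p q, emb, nxt => fun l => match l with
      | Sum.inl l => code p (fun l => emb (Sum.inl l)) (emb (Sum.inr (entry q))) l
      | Sum.inr l => code q (fun l => emb (Sum.inr l)) nxt l
  | loop k isEnd body, emb, nxt => fun l => match l with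
      | none => .pop k (fun _ a => a) (.goto fun v => match v with
          | none => nxt
          | some a => if isEnd a then nxt else emb (some ⟨a, entry (body a)⟩))
      | some ⟨a, l⟩ => code (body a) (fun l => emb (some ⟨a, l⟩)) (emb none) l

/-! ### Correctness of the compiled machines -/

/-- `c'` is reached from `c` in at most `t` steps. -/
def ReachesIn {σ : Type} (f : σ → Option σ) (t : ℕ) (c c' : σ) : Prop :=
  ∃ n ≤ t, (flip bind f)^[n] (some c) = some c'

theorem ReachesIn.trans {σ : Type} {f : σ → Option σ} {s t u : ℕ} {a b c : σ}
    (h : ReachesIn f s a b) (h' : ReachesIn f t b c) (hu : s + t ≤ u) : ReachesIn f u a c := by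
  obtain ⟨m, hm, e⟩ := h
  obtain ⟨n, hn, e'⟩ := h'
  exact ⟨n + m, by omega, by rw [iterate_add_apply, e, e']⟩

theorem ReachesIn.single {σ : Type} {f : σ → Option σ} {t : ℕ} {a b : σ} (h : f a = some b)
    (ht : 1 ≤ t) : ReachesIn f t a b :=
  ⟨1, ht, by simpa [flip] using h⟩

/-- Induction on the execution. The embedding `emb` and the exit label `nxt` are arbitrary because
the code of a subprogram sits inside that of a larger program. The content `v` of the internal
register is arbitrary too: it is read only directly after a pop has overwritten it. -/
theorem code_correct {p : Prog} {S S' : Stk → List Γ'} {t : ℕ} (h : Exec p S t S') {Λ : Type}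
    (M : Λ → TM2.Stmt (fun _ : Stk => Γ') Λ (Option Γ')) (emb : Lab p → Λ) (nxt : Λ)
    (hM : ∀ l, M (emb l) = code p emb nxt l) (v : Option Γ') :
    ∃ v', ReachesIn (TM2.step M) t ⟨some (emb (entry p)), v, S⟩ ⟨some nxt, v', S'⟩ := by
  induction h generalizing nxt v with
  | skip ht => exact ⟨v, .single (by rw [TM2.step, hM]; rfl) ht⟩
  | push ht => exact ⟨v, .single (by rw [TM2.step, hM]; rfl) ht⟩
  | @pop k f S t t' S' _ ht ih =>
    obtain ⟨v', h'⟩ := ih (fun l => emb (some ⟨_, l⟩)) nxt (fun l => (hM (some ⟨_, l⟩)).trans (by rw [code])) (S k).head?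
    exact ⟨v', .trans (.single (by rw [TM2.step, hM, code.eq_def]; rfl) le_rfl) h' (by omega : 1 + t ≤ t')⟩
  | seq _ _ ht ih ih' =>
    obtain ⟨v₁, h₁⟩ := ih (fun l => emb (Sum.inl l)) _ (fun l => hM (Sum.inl l)) v
    obtain ⟨v₂, h₂⟩ := ih' (fun l => emb (Sum.inr l)) _ (fun l => hM (Sum.inr l)) v₁
    exact ⟨v₂, h₁.trans h₂ ht⟩
  | loop_empty h ht =>
    refine ⟨none, .single ?_ ht⟩
    rw [TM2.step, hM]
    simp only [entry, code, TM2.stepAux, h, List.head?_nil, List.tail_nil]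
    -- Popping an empty stack leaves it unchanged.
    rw [← h, update_eq_self]
  | @loop_exit _ _ _ _ _ a h ha ht =>
    refine ⟨some a, .single ?_ ht⟩
    · rw [TM2.step, hM]
      simp only [entry, code, TM2.stepAux, h, ha, if_true]
  | @loop_step k isEnd body S a t S' t' S'' t'' hk ha _ _ ht ih ih' =>
    obtain ⟨v₁, h₁⟩ := ih (fun l => emb (some ⟨a, l⟩)) (emb none) (fun l => (hM (some ⟨a, l⟩)).trans (by rw [code])) (some a)
    obtain ⟨v₂, h₂⟩ := ih' emb nxt hM v₁
    refine ⟨v₂, .trans (.single ?_ le_rfl) (h₁.trans h₂ le_rfl) (by omega : 1 + (t + t') ≤ t'')⟩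
    rw [TM2.step, hM]
    simp [entry, code, TM2.stepAux, hk, ha]

/-- The machine that is compiled from a program. -/
def machine (p : Prog) : FinTM2 :=
  have := labFintype p
  { K := Stk
    k₀ := .x
    k₁ := .x
    Γ := fun _ => Γ'
    Λ := Option (Lab p)
    main := some (entry p)
    σ := Option Γ'
    initialState := none
    Γk₀Fin := inferInstanceAs (Fintype Γ')
    m := fun l => match l with
      | some l => code p some none l
      | none => .load (fun _ => none) .halt }

/-- The state of the four stacks. -/
def st (x y z w : List Γ') : Stk → List Γ'
  | .x => x
  | .y => y
  | .z => z
  | .w => w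

/-- The additional step belongs to the label `none`, which resets the register to the value required
in a halting configuration. -/
theorem machine_correct {p : Prog} {l l' : List Γ'} {t : ℕ}
    (h : Exec p (st l [] [] []) t (st l' [] [] [])) :
    ReachesIn (machine p).step (t + 1) (initList (machine p) l) (haltList (machine p) l') := by
  obtain ⟨v, h⟩ := code_correct h (machine p).m some none (fun l => rfl) none
  have e : ∀ l, (fun k => @dite (List Γ') (k = Stk.x) ((machine p).kDecidableEq k Stk.x)
      (fun h => l) fun _ => []) = st l [] [] [] := by
    intro l
    funext k
    cases k <;> rfl
  have e₁ : initList (machine p) l = ⟨some (some (entry p)), none, st l [] [] []⟩ := by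
    rw [← e]; rfl
  have e₂ : haltList (machine p) l' = ⟨none, none, st l' [] [] []⟩ := by
    rw [← e]; rfl
  rw [e₁, e₂]
  exact h.trans (.single rfl le_rfl) le_rfl

/-- A function that is computed by a program in polynomial time is computable by a Turing machine
in polynomial time. -/
theorem computableInPolyTime {α β : Type} {ea : α → List Γ'} {eb : β → List Γ'} {f : α → β}
    (p : Prog) (q : Polynomial ℕ)
    (h : ∀ a, Exec p (st (ea a) [] [] []) (q.eval (ea a).length) (st (eb (f a)) [] [] [])) :
    Nonempty (TM2ComputableInPolyTime ea eb f) := by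
  refine ⟨{ tm := machine p, inputAlphabet := Equiv.refl Γ', outputAlphabet := Equiv.refl Γ',
            time := q + 1, outputsFun := fun a => ?_ }⟩
  have h' := machine_correct (h a)
  refine ⟨⟨h'.choose, ?_⟩, ?_⟩
  · have := h'.choose_spec.2
    have e : ∀ l : List Γ', List.map (Equiv.refl Γ').invFun l = l := fun l => List.map_id l
    erw [e, e]
    exact this
  · simpa using h'.choose_spec.1

/-- A step pushes at most one symbol. Hence a bound on the time also bounds the size of the result.
-/
theorem Exec.length_le {p : Prog} {S S' : Stk → List Γ'} {t : ℕ} (h : Exec p S t S') (k : Stk) :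
    (S' k).length ≤ (S k).length + t := by
  have hpop : ∀ (S : Stk → List Γ') (j : Stk),
      (update S j (S j).tail k).length ≤ (S k).length := by
    intro S j
    by_cases hj : k = j
    · subst hj; simp
    · simp [hj]
  induction h with
  | skip => omega
  | @push j a S t ht =>
    by_cases hj : k = j
    · subst hj; simp; omega
    · simp [hj]
  | @pop j f S t t' S' _ ht ih => have := hpop S j; omega
  | seq _ _ ht ih ih' => omega
  | loop_empty => omega
  | @loop_exit j _ _ S => have := hpop S j; omega
  | @loop_step j _ _ S _ _ _ _ _ _ _ _ _ _ ht ih ih' => have := hpop S j; omega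

theorem Exec.mono {p : Prog} {S S' : Stk → List Γ'} {t t' : ℕ} (h : Exec p S t S') (ht : t ≤ t') :
    Exec p S t' S' := by
  cases h with
  | skip h => exact .skip (h.trans ht)
  | push h => exact .push (h.trans ht)
  | pop h h' => exact .pop h (h'.trans ht)
  | seq h h' h'' => exact .seq h h' (h''.trans ht)
  | loop_empty h h' => exact .loop_empty h (h'.trans ht)
  | loop_exit h h' h'' => exact .loop_exit h h' (h''.trans ht)
  | loop_step h₁ h₂ h₃ h₄ h₅ => exact .loop_step h₁ h₂ h₃ h₄ (h₅.trans ht)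

end Prog

end TreePacking

namespace TreePacking

open Computability (Γ')

/-! ### Trees as data -/

/-- The leaves of data trees. -/
inductive Leaf
  | bit (b : Bool)
  | bra
  | ket

/-- The symbol of a leaf. -/
def Leaf.tok : Leaf → Γ'
  | bit b => .bit b
  | bra => .bra
  | ket => .ket

/-- Binary trees, which serve as universal data. -/
inductive Data
  | leaf (l : Leaf)
  | cons (a b : Data)

namespace Data

/-- The prefix form of a tree. -/
def ser : Data → List Γ'
  | leaf l => [l.tok]
  | cons a b => .comma :: (ser a ++ ser b)

/-- The number of nodes of a tree. -/
def size : Data → ℕ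
  | leaf _ => 1
  | cons a b => size a + size b + 1

@[simp]
theorem length_ser (d : Data) : d.ser.length = d.size := by
  induction d with
  | leaf => rfl
  | cons a b iha ihb => simp [ser, size, iha, ihb]

/-- This leaves `blank` free to serve as an end marker on the auxiliary stacks. -/
theorem blank_notMem_ser (d : Data) : Γ'.blank ∉ d.ser := by
  induction d with
  | leaf l => cases l <;> simp [ser, Leaf.tok]
  | cons a b iha ihb => simp [ser, iha, ihb]

theorem one_le_size (d : Data) : 1 ≤ d.size := by
  cases d <;> simp [size]

end Data

/-! ### Moving, copying and exchanging trees on the stacks -/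

namespace Prog

open Function Data

@[simp] theorem st_x (x y z w : List Γ') : st x y z w .x = x := rfl
@[simp] theorem st_y (x y z w : List Γ') : st x y z w .y = y := rfl
@[simp] theorem st_z (x y z w : List Γ') : st x y z w .z = z := rfl
@[simp] theorem st_w (x y z w : List Γ') : st x y z w .w = w := rfl

@[simp] theorem update_st_x (x y z w l : List Γ') : update (st x y z w) .x l = st l y z w := by
  funext k; cases k <;> rfl
@[simp] theorem update_st_y (x y z w l : List Γ') : update (st x y z w) .y l = st x l z w := by
  funext k; cases k <;> rfl
@[simp] theorem update_st_z (x y z w l : List Γ') : update (st x y z w) .z l = st x y l w := by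
  funext k; cases k <;> rfl
@[simp] theorem update_st_w (x y z w l : List Γ') : update (st x y z w) .w l = st x y z l := by
  funext k; cases k <;> rfl

variable {x y z w : List Γ'} {S' : Stk → List Γ'} {t t' : ℕ}

theorem exec_push_x (a : Γ') : Exec (push .x a) (st x y z w) 1 (st (a :: x) y z w) := by
  simpa using Exec.push (k := .x) (a := a) (S := st x y z w) le_rfl
theorem exec_push_y (a : Γ') : Exec (push .y a) (st x y z w) 1 (st x (a :: y) z w) := by
  simpa using Exec.push (k := .y) (a := a) (S := st x y z w) le_rfl
theorem exec_push_z (a : Γ') : Exec (push .z a) (st x y z w) 1 (st x y (a :: z) w) := by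
  simpa using Exec.push (k := .z) (a := a) (S := st x y z w) le_rfl
theorem exec_push_w (a : Γ') : Exec (push .w a) (st x y z w) 1 (st x y z (a :: w)) := by
  simpa using Exec.push (k := .w) (a := a) (S := st x y z w) le_rfl

theorem exec_pop_x {f : Option Γ' → Prog} {a : Γ'} (h : Exec (f (some a)) (st x y z w) t S') :
    Exec (pop .x f) (st (a :: x) y z w) (t + 1) S' :=
  .pop (by simpa using h) le_rfl

theorem Exec.seq' {p q : Prog} {S S₁ : Stk → List Γ'} (h : Exec p S t S₁) (h' : Exec q S₁ t' S') :
    Exec (.seq p q) S (t + t') S' :=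
  .seq h h' le_rfl

section Loop

variable {isEnd : Γ' → Bool} {body : Γ' → Prog} {a : Γ'} {S₁ : Stk → List Γ'}

theorem exec_loop_x (ha : isEnd a = false) (h : Exec (body a) (st x y z w) t S₁)
    (h' : Exec (loop .x isEnd body) S₁ t' S') :
    Exec (loop .x isEnd body) (st (a :: x) y z w) (t + t' + 1) S' :=
  .loop_step (a := a) rfl ha (by simpa using h) h' le_rfl

theorem exec_loop_y (ha : isEnd a = false) (h : Exec (body a) (st x y z w) t S₁)
    (h' : Exec (loop .y isEnd body) S₁ t' S') :
    Exec (loop .y isEnd body) (st x (a :: y) z w) (t + t' + 1) S' :=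
  .loop_step (a := a) rfl ha (by simpa using h) h' le_rfl

theorem exec_loop_z (ha : isEnd a = false) (h : Exec (body a) (st x y z w) t S₁)
    (h' : Exec (loop .z isEnd body) S₁ t' S') :
    Exec (loop .z isEnd body) (st x y (a :: z) w) (t + t' + 1) S' :=
  .loop_step (a := a) rfl ha (by simpa using h) h' le_rfl

theorem exec_loop_w (ha : isEnd a = false) (h : Exec (body a) (st x y z w) t S₁)
    (h' : Exec (loop .w isEnd body) S₁ t' S') :
    Exec (loop .w isEnd body) (st x y z (a :: w)) (t + t' + 1) S' :=
  .loop_step (a := a) rfl ha (by simpa using h) h' le_rfl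

theorem exec_exit_x (ha : isEnd a = true) :
    Exec (loop .x isEnd body) (st (a :: x) y z w) 1 (st x y z w) := by
  simpa using Exec.loop_exit (k := .x) (S := st (a :: x) y z w) (body := body) rfl ha le_rfl

theorem exec_exit_y (ha : isEnd a = true) :
    Exec (loop .y isEnd body) (st x (a :: y) z w) 1 (st x y z w) := by
  simpa using Exec.loop_exit (k := .y) (S := st x (a :: y) z w) (body := body) rfl ha le_rfl

theorem exec_exit_z (ha : isEnd a = true) :
    Exec (loop .z isEnd body) (st x y (a :: z) w) 1 (st x y z w) := by
  simpa using Exec.loop_exit (k := .z) (S := st x y (a :: z) w) (body := body) rfl ha le_rfl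

theorem exec_exit_w (ha : isEnd a = true) :
    Exec (loop .w isEnd body) (st x y z (a :: w)) 1 (st x y z w) := by
  simpa using Exec.loop_exit (k := .w) (S := st x y z (a :: w)) (body := body) rfl ha le_rfl

end Loop

/-- Emit a symbol on a stack, or do nothing. -/
def emit (b : Bool) (k : Stk) (a : Γ') : Prog := if b then push k a else skip

/-- Put a list on top of a stack, or do nothing. -/
def put (b : Bool) (l s : List Γ') : List Γ' := if b then l ++ s else s

/-- The main loop of `move`: the number of trees that are still to be moved is counted on `w`. -/
def moveLoop (b c : Bool) : Prog :=
  loop .w (fun a => a == .blank) fun _ => pop .x fun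
    | some a => seq (emit b .y a) (seq (emit c .z a)
        (if a = .comma then seq (push .w .bra) (push .w .bra) else skip))
    | none => skip

/-- Remove a tree from the top of `x` and put it, reversed, on top of `y` if `b`, and on top of `z`
if `c`. -/
def move (b c : Bool) : Prog := seq (push .w .blank) (seq (push .w .bra) (moveLoop b c))

theorem exec_emit_y (b : Bool) (a : Γ') :
    Exec (emit b .y a) (st x y z w) 1 (st x (put b [a] y) z w) := by
  cases b
  · exact .skip le_rfl
  · exact exec_push_y a

theorem exec_emit_z (b : Bool) (a : Γ') :
    Exec (emit b .z a) (st x y z w) 1 (st x y (put b [a] z) w) := by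
  cases b
  · exact .skip le_rfl
  · exact exec_push_z a

theorem put_put (b : Bool) (l l' s : List Γ') : put b l (put b l' s) = put b (l ++ l') s := by
  cases b <;> simp [put]

theorem Leaf.tok_ne_comma (l : Leaf) : l.tok ≠ .comma := by
  cases l <;> simp [Leaf.tok]

/-- The prefix form delimits itself: each `bra` on `w` stands for a tree still to be read, a leaf
uses up one of them, and a `comma` replaces one by two. The rest of the run is the hypothesis `h`,
so that the induction can treat the two subtrees one after the other. -/
theorem exec_moveLoop (b c : Bool) (d : Data) (x y z w : List Γ') (t : ℕ)
    (h : Exec (moveLoop b c) (st x (put b d.ser.reverse y) (put c d.ser.reverse z) w) t S') :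
    Exec (moveLoop b c) (st (d.ser ++ x) y z (.bra :: w)) (t + 8 * d.size) S' := by
  induction d generalizing x y z w t with
  | leaf l =>
    refine (exec_loop_w rfl (exec_pop_x (t := 3) (.seq (exec_emit_y _ _)
      (.seq (t' := 1) (exec_emit_z _ _) ?_ le_rfl) le_rfl)) h).mono (by simp only [size]; omega)
    rw [if_neg (Leaf.tok_ne_comma l)]
    exact .skip le_rfl
  | cons a d iha ihd =>
    refine (exec_loop_w rfl (exec_pop_x (t := 4) (.seq (exec_emit_y _ _)
      (.seq (t' := 2) (exec_emit_z _ _) (.seq' (exec_push_w _) (exec_push_w _)) le_rfl) le_rfl))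
      (t' := t + 8 * d.size + 8 * a.size) ?_).mono (by simp only [size]; omega)
    rw [List.append_eq, List.append_assoc]
    refine iha _ _ _ _ _ (ihd _ _ _ _ _ ?_)
    simpa [put_put, ser] using h

theorem exec_move (b c : Bool) (d : Data) (x y z w : List Γ') :
    Exec (move b c) (st (d.ser ++ x) y z w) (8 * d.size + 3)
      (st x (put b d.ser.reverse y) (put c d.ser.reverse z) w) :=
  .seq (exec_push_w _) (.seq' (exec_push_w _) (exec_moveLoop b c d _ _ _ _ 1 (exec_exit_w rfl)))
    (by omega)

/-- Move the symbols of a stack above the topmost `blank` to `x`. -/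
def restore (k : Stk) : Prog := loop k (fun a => a == .blank) fun a => push .x a

theorem exec_restore_y (l : List Γ') (hl : Γ'.blank ∉ l) (x y z w : List Γ') :
    Exec (restore .y) (st x (l ++ .blank :: y) z w) (2 * l.length + 1)
      (st (l.reverse ++ x) y z w) := by
  induction l generalizing x with
  | nil => exact exec_exit_y rfl
  | cons a l ih =>
    simp only [List.mem_cons, not_or] at hl
    have h := exec_loop_y (isEnd := fun a => a == .blank) (body := fun a => push .x a)
      (by simpa using Ne.symm hl.1) (exec_push_x a) (ih hl.2 (a :: x))
    rw [List.reverse_cons, List.append_assoc]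
    exact h.mono (by simp; omega)

theorem exec_restore_z (l : List Γ') (hl : Γ'.blank ∉ l) (x y z w : List Γ') :
    Exec (restore .z) (st x y (l ++ .blank :: z) w) (2 * l.length + 1)
      (st (l.reverse ++ x) y z w) := by
  induction l generalizing x with
  | nil => exact exec_exit_z rfl
  | cons a l ih =>
    simp only [List.mem_cons, not_or] at hl
    have h := exec_loop_z (isEnd := fun a => a == .blank) (body := fun a => push .x a)
      (by simpa using Ne.symm hl.1) (exec_push_x a) (ih hl.2 (a :: x))
    rw [List.reverse_cons, List.append_assoc]
    exact h.mono (by simp; omega)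

theorem exec_restore_tree_y (d : Data) (x y z w : List Γ') :
    Exec (restore .y) (st x (d.ser.reverse ++ .blank :: y) z w) (2 * d.size + 1)
      (st (d.ser ++ x) y z w) := by
  simpa using exec_restore_y d.ser.reverse (by simpa using blank_notMem_ser d) x y z w

theorem exec_restore_tree_z (d : Data) (x y z w : List Γ') :
    Exec (restore .z) (st x y (d.ser.reverse ++ .blank :: z) w) (2 * d.size + 1)
      (st (d.ser ++ x) y z w) := by
  simpa using exec_restore_z d.ser.reverse (by simpa using blank_notMem_ser d) x y z w

/-- Remove the topmost tree. -/
def drop : Prog := move false false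

theorem exec_drop (d : Data) (x y z w : List Γ') :
    Exec drop (st (d.ser ++ x) y z w) (8 * d.size + 3) (st x y z w) :=
  exec_move false false d x y z w

/-- Duplicate the topmost tree. -/
def dup : Prog :=
  seq (push .y .blank) (seq (push .z .blank) (seq (move true true) (seq (restore .y) (restore .z))))

theorem exec_dup (d : Data) (x y z w : List Γ') :
    Exec dup (st (d.ser ++ x) y z w) (12 * d.size + 7) (st (d.ser ++ (d.ser ++ x)) y z w) :=
  .seq (exec_push_y _) (.seq' (exec_push_z _) (.seq' (exec_move true true d _ _ _ _)
    (.seq' (exec_restore_tree_y d _ _ _ _) (exec_restore_tree_z d _ _ _ _)))) (by omega)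

/-- Exchange the two topmost trees. -/
def swap : Prog :=
  seq (push .y .blank) (seq (move true false) (seq (push .z .blank) (seq (move false true)
    (seq (restore .y) (restore .z)))))

theorem exec_swap (d e : Data) (x y z w : List Γ') :
    Exec swap (st (d.ser ++ (e.ser ++ x)) y z w) (10 * d.size + 10 * e.size + 10)
      (st (e.ser ++ (d.ser ++ x)) y z w) :=
  .seq (exec_push_y _) (.seq' (exec_move true false d _ _ _ _) (.seq' (exec_push_z _)
    (.seq' (exec_move false true e _ _ _ _)
      (.seq' (exec_restore_tree_y d _ _ _ _) (exec_restore_tree_z e _ _ _ _))))) (by omega)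

/-- Exchange the second and the third tree. -/
def swap₂ : Prog := seq (push .y .blank) (seq (move true false) (seq swap (restore .y)))

theorem exec_swap₂ (c d e : Data) (x y z w : List Γ') :
    Exec swap₂ (st (c.ser ++ (d.ser ++ (e.ser ++ x))) y z w)
      (10 * c.size + 10 * d.size + 10 * e.size + 15)
      (st (c.ser ++ (e.ser ++ (d.ser ++ x))) y z w) :=
  .seq (exec_push_y _) (.seq' (exec_move true false c _ _ _ _) (.seq' (exec_swap d e _ _ _ _)
    (exec_restore_tree_y c _ _ _ _))) (by omega)

/-- Push a list of symbols, the last one first. -/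
def pushAll : List Γ' → Prog
  | [] => skip
  | a :: l => seq (pushAll l) (push .x a)

theorem exec_pushAll (l x y z w : List Γ') :
    Exec (pushAll l) (st x y z w) (l.length + 1) (st (l ++ x) y z w) := by
  induction l with
  | nil => exact .skip le_rfl
  | cons a l ih => exact .seq ih (exec_push_x a) le_rfl

end Prog
end TreePacking

namespace TreePacking

open Computability (Γ')

/-! ### Functions that are computed by programs in polynomial time -/

/-- Types whose elements are encoded by data trees. -/
class Enc (α : Type) where
  /-- The encoding. -/
  enc : α → Data

open Enc

instance : Enc Bool := ⟨fun b => .leaf (.bit b)⟩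
instance {α β : Type} [Enc α] [Enc β] : Enc (α × β) := ⟨fun p => .cons (enc p.1) (enc p.2)⟩
instance {α : Type} [Enc α] : Enc (List α) :=
  ⟨fun l => l.foldr (fun a d => .cons (enc a) d) (.leaf (.bit false))⟩
instance : Enc ℕ := ⟨fun n => enc (Computability.encodeNat n)⟩
instance : Enc Γ' := ⟨fun
  | .blank => .cons (.leaf .ket) (.leaf .ket)
  | .bit b => .leaf (.bit b)
  | .bra => .leaf .bra
  | .ket => .leaf .ket
  | .comma => .cons (.leaf .bra) (.leaf .bra)⟩

/-- The size of the encoding. -/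
def esize {α : Type} [Enc α] (a : α) : ℕ := (enc a).size

variable {α β γ δ σ : Type} [Enc α] [Enc β] [Enc γ] [Enc δ] [Enc σ]

theorem one_le_esize (a : α) : 1 ≤ esize a := Data.one_le_size _

@[simp] theorem esize_prod (p : α × β) : esize p = esize p.1 + esize p.2 + 1 := rfl
@[simp] theorem esize_bool (b : Bool) : esize b = 1 := rfl
@[simp] theorem esize_nil : esize ([] : List α) = 1 := rfl
@[simp] theorem esize_cons (a : α) (l : List α) : esize (a :: l) = esize a + esize l + 1 := rfl

theorem esize_append (l l' : List α) : esize (l ++ l') + 1 = esize l + esize l' := by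
  induction l with
  | nil => simp; omega
  | cons a l ih => simp; omega

theorem esize_reverse (l : List α) : esize l.reverse = esize l := by
  induction l with
  | nil => rfl
  | cons a l ih => have := esize_append l.reverse [a]; simp at *; omega

theorem length_le_esize (l : List α) : l.length ≤ esize l := by
  induction l with
  | nil => simp
  | cons a l ih => simp; omega

theorem esize_le_of_mem {a : α} {l : List α} (h : a ∈ l) : esize a ≤ esize l := by
  induction l with
  | nil => simp at h
  | cons b l ih =>
    rcases List.mem_cons.1 h with rfl | h
    · simp; omega
    · have := ih h; simp; omega

theorem esize_le_of_sublist {l l' : List α} (h : l.Sublist l') : esize l ≤ esize l' := by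
  induction h with
  | slnil => rfl
  | cons a _ ih => simp; omega
  | cons_cons a _ ih => simp; omega

/-- The coefficients are natural numbers, so there are no negative terms. -/
theorem eval_mono (q : Polynomial ℕ) {m n : ℕ} (h : m ≤ n) : q.eval m ≤ q.eval n := by
  rw [Polynomial.eval_eq_sum, Polynomial.eval_eq_sum]
  exact Finset.sum_le_sum fun i _ => Nat.mul_le_mul_left _ (Nat.pow_le_pow_left h i)

/-- On top of the stack `x`, the program `p` replaces `a` by `b` in at most `t` steps. -/
def Runs (p : Prog) (t : ℕ) (a : α) (b : β) : Prop :=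
  ∀ x y z w, Prog.Exec p (Prog.st ((enc a).ser ++ x) y z w) t (Prog.st ((enc b).ser ++ x) y z w)

/-- `f` is computed by a program in polynomial time. -/
@[fun_prop]
def PolyFun (f : α → β) : Prop :=
  ∃ (p : Prog) (q : Polynomial ℕ), ∀ a, Runs p (q.eval (esize a)) a (f a)

/-! ### Closure properties of polynomial time functions -/

namespace PolyFun

open Prog

/-- `Exec.length_le` with nothing below the argument. Composition needs this bound, as the second
program runs on the output of the first. -/
theorem esize_le {f : α → β} (h : PolyFun f) :
    ∃ q : Polynomial ℕ, ∀ a, esize (f a) ≤ q.eval (esize a) := by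
  obtain ⟨p, q, h⟩ := h
  refine ⟨.X + q, fun a => ?_⟩
  simpa [esize] using (h a [] [] [] []).length_le .x

/-- A program sees only encodings. So one program serves all functions that agree on encodings, even
between different types. -/
theorem congr_enc {f : α → β} (hf : PolyFun f) {α' β' : Type} [Enc α'] [Enc β'] {g : α' → β'}
    (i : α' → α) (hi : ∀ a, enc a = enc (i a)) (h : ∀ a, enc (f (i a)) = enc (g a)) :
    PolyFun g := by
  obtain ⟨p, q, hp⟩ := hf
  refine ⟨p, q, fun a x y z w => ?_⟩
  rw [esize, ← h, hi]
  exact hp _ x y z w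

@[fun_prop]
theorem id : PolyFun (fun a : α => a) :=
  ⟨.skip, 1, fun a x y z w => .skip (by simp)⟩

@[fun_prop]
theorem const (b : β) : PolyFun (fun _ : α => b) :=
  ⟨.seq drop (pushAll (enc b).ser), 8 * .X + 3 + ((enc b).size + 1 : ℕ), fun a x y z w =>
    .seq (exec_drop _ _ _ _ _) (exec_pushAll _ _ _ _ _) (by simp [esize])⟩

@[fun_prop]
theorem comp {g : β → γ} {f : α → β} (hg : PolyFun g) (hf : PolyFun f) :
    PolyFun (fun a => g (f a)) := by
  obtain ⟨r, hr⟩ := hf.esize_le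
  obtain ⟨p, q, hp⟩ := hf
  obtain ⟨p', q', hp'⟩ := hg
  refine ⟨.seq p p', q + q'.comp r, fun a x y z w => .seq (hp a x y z w) (hp' _ x y z w) ?_⟩
  simpa using eval_mono q' (hr a)

-- The argument is duplicated and `g` is applied to the upper copy; then the result is exchanged
-- with the lower copy and `f` is applied. A `comma` on top makes the two results a pair. This works
-- because `Runs` leaves untouched whatever lies below.
@[fun_prop]
theorem pair {f : α → β} {g : α → γ} (hf : PolyFun f) (hg : PolyFun g) :
    PolyFun (fun a => (f a, g a)) := by
  obtain ⟨r, hr⟩ := hg.esize_le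
  obtain ⟨p, q, hp⟩ := hf
  obtain ⟨p', q', hp'⟩ := hg
  refine ⟨.seq dup (.seq p' (.seq swap (.seq p (.push .x .comma)))),
    12 * .X + 7 + q' + (10 * r + 10 * .X + 10) + q + 1, fun a x y z w => ?_⟩
  have h₁ := hp' a ((enc a).ser ++ x) y z w
  have h₂ := exec_swap (enc (g a)) (enc a) x y z w
  have h₃ := hp a ((enc (g a)).ser ++ x) y z w
  have e : (enc (f a, g a)).ser ++ x = .comma :: ((enc (f a)).ser ++ ((enc (g a)).ser ++ x)) := by
    simp [enc, Data.ser]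
  rw [e]
  refine .seq (exec_dup _ _ _ _ _) (.seq' h₁ (.seq' h₂ (.seq' h₃ (exec_push_x _)))) ?_
  have := hr a
  simp only [esize] at this
  simp [esize]
  omega

@[fun_prop]
theorem fst : PolyFun (fun p : α × β => p.1) := by
  refine ⟨.pop .x fun _ => .seq swap drop, 20 * .X + 20, fun a x y z w => ?_⟩
  have e : (enc a).ser ++ x = .comma :: ((enc a.1).ser ++ ((enc a.2).ser ++ x)) := by
    simp [enc, Data.ser]
  rw [e]
  refine (exec_pop_x (.seq' (exec_swap _ _ _ _ _ _) (exec_drop _ _ _ _ _))).mono ?_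
  simp
  simp only [esize]
  omega

@[fun_prop]
theorem snd : PolyFun (fun p : α × β => p.2) := by
  refine ⟨.pop .x fun _ => drop, 20 * .X + 20, fun a x y z w => ?_⟩
  have e : (enc a).ser ++ x = .comma :: ((enc a.1).ser ++ ((enc a.2).ser ++ x)) := by
    simp [enc, Data.ser]
  rw [e]
  refine (exec_pop_x (exec_drop _ _ _ _ _)).mono ?_
  simp
  simp only [esize]
  omega

@[fun_prop]
theorem fst' {f : γ → α × β} (hf : PolyFun f) : PolyFun (fun c => (f c).1) := fst.comp hf

@[fun_prop]
theorem snd' {f : γ → α × β} (hf : PolyFun f) : PolyFun (fun c => (f c).2) := snd.comp hf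

@[fun_prop]
theorem cond {b : α → Bool} {f g : α → β} (hb : PolyFun b) (hf : PolyFun f) (hg : PolyFun g) :
    PolyFun (fun a => bif b a then f a else g a) := by
  have h : PolyFun (fun p : Bool × α => bif p.1 then f p.2 else g p.2) := by
    obtain ⟨p, q, hp⟩ := hf
    obtain ⟨p', q', hp'⟩ := hg
    -- Popping the `comma` of the pair and then the bit leaves the bare argument on top.
    refine ⟨.pop .x fun _ => .pop .x fun a => if a = some (.bit true) then p else p', q + q' + 2,
      fun a x y z w => ?_⟩
    obtain ⟨b, a⟩ := a
    have e : (enc (b, a)).ser ++ x = .comma :: .bit b :: ((enc a).ser ++ x) := by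
      simp [enc, Data.ser, Leaf.tok]
    rw [e]
    have h₁ := eval_mono q (m := esize a) (n := esize (b, a)) (by simp; omega)
    have h₂ := eval_mono q' (m := esize a) (n := esize (b, a)) (by simp; omega)
    cases b
    · refine (exec_pop_x (exec_pop_x (t := q'.eval (esize a)) ?_)).mono ?_
      · rw [if_neg (by simp)]
        exact hp' a x y z w
      · simp only [Polynomial.eval_add, Polynomial.eval_ofNat]; omega
    · refine (exec_pop_x (exec_pop_x (t := q.eval (esize a)) ?_)).mono ?_
      · rw [if_pos rfl]
        exact hp a x y z w
      · simp only [Polynomial.eval_add, Polynomial.eval_ofNat]; omega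
  exact h.comp (hb.pair id)

@[fun_prop]
theorem cons {f : α → β} {g : α → List β} (hf : PolyFun f) (hg : PolyFun g) :
    PolyFun (fun a => f a :: g a) :=
  (hf.pair hg).congr_enc (fun a => a) (fun _ => rfl) fun _ => rfl

end PolyFun

/-- Case distinction on a list. -/
def listCase (l : List α) (n : β) (k : α → List α → β) : β :=
  match l with
  | [] => n
  | a :: l => k a l

/-! ### Case distinction and folds over lists -/

namespace PolyFun

open Prog

@[fun_prop]
theorem listCase {l : γ → List α} {n : γ → β} {k : γ → α → List α → β} (hl : PolyFun l)
    (hn : PolyFun n) (hk : PolyFun fun p : γ × α × List α => k p.1 p.2.1 p.2.2) :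
    PolyFun (fun c => TreePacking.listCase (l c) (n c) (k c)) := by
  replace hk : PolyFun fun p : (α × List α) × γ => k p.2 p.1.1 p.1.2 :=
    comp (g := fun p : γ × α × List α => k p.1 p.2.1 p.2.2)
      (f := fun p : (α × List α) × γ => (p.2, p.1)) hk (by fun_prop)
  have h : PolyFun (fun p : List α × γ => TreePacking.listCase p.1 (n p.2) (k p.2)) := by
    obtain ⟨p, q, hp⟩ := hn
    obtain ⟨p', q', hp'⟩ := hk
    -- The pairs of `a :: l` with `c` and of `(a, l)` with `c` are the same string, so for a
    -- nonempty list the two popped `comma`s are just pushed back. For the empty list the second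
    -- symbol is the leaf `bit false`, whose removal leaves `c`.
    refine ⟨.pop .x fun _ => .pop .x fun a => if a = some .comma then
      .seq (.push .x .comma) (.seq (.push .x .comma) p') else p, q + q' + 4, fun a x y z w => ?_⟩
    obtain ⟨l, c⟩ := a
    cases l with
    | nil =>
      have e : (enc (([] : List α), c)).ser ++ x = .comma :: .bit false :: ((enc c).ser ++ x) := by
        simp [enc, Data.ser, Leaf.tok]
      rw [e]
      refine (exec_pop_x (exec_pop_x (t := q.eval (esize c)) ?_)).mono ?_
      · rw [if_neg (by simp)]
        exact hp c x y z w
      · have h₁ := eval_mono q (m := esize c) (n := esize (([] : List α), c)) (by simp; omega)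
        simp only [Polynomial.eval_add, Polynomial.eval_ofNat]; omega
    | cons a l =>
      have e : (enc (a :: l, c)).ser ++ x =
          .comma :: .comma :: ((enc a).ser ++ ((enc l).ser ++ ((enc c).ser ++ x))) := by
        simp [enc, Data.ser]
      have e' : (enc ((a, l), c)).ser ++ x =
          .comma :: .comma :: ((enc a).ser ++ ((enc l).ser ++ ((enc c).ser ++ x))) := by
        simp [enc, Data.ser]
      rw [e]
      have h := hp' ((a, l), c) x y z w
      rw [e'] at h
      refine (exec_pop_x (exec_pop_x (t := q'.eval (esize ((a, l), c)) + 2) ?_)).mono ?_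
      · rw [if_pos rfl]
        exact .seq (exec_push_x _) (.seq' (exec_push_x _) h) (by omega)
      · have h₁ : esize ((a, l), c) = esize (a :: l, c) := by simp
        rw [h₁]
        simp only [Polynomial.eval_add, Polynomial.eval_ofNat]; omega
  exact h.comp (hl.pair id)

/-- The loop for `List.foldl`. -/
def foldLoop (p : Prog) : Prog :=
  .loop .x (fun a => a != .comma) fun _ =>
    .seq swap₂ (.seq (.push .x .comma) (.seq p swap))

/-- The list lies above the state. Popping a `comma` uncovers an entry; `swap₂` brings the state
next to it, a `comma` makes them a pair, `p` computes the new state, and `swap` puts the rest of the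
list back on top. The leaf that ends the list stops the loop. The bounds `B` and `M` concern only
the states after prefixes of `l`, which are those that occur. -/
theorem exec_foldLoop {step : σ → α → σ} (p : Prog) (B M : ℕ) (l : List α) (s : σ)
    (h : ∀ l₁ a l₂, l = l₁ ++ a :: l₂ → Runs p B (a, l₁.foldl step s) ((l₁ ++ [a]).foldl step s))
    (hM : ∀ l₁, l₁ <+: l → esize (l₁.foldl step s) ≤ M) (hl : esize l ≤ M) (x y z w : List Γ') :
    Exec (foldLoop p) (st ((enc l).ser ++ ((enc s).ser ++ x)) y z w)
      (l.length * (B + 50 * M + 50) + 1) (st ((enc (l.foldl step s)).ser ++ x) y z w) := by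
  induction l generalizing s with
  | nil => exact (exec_exit_x rfl).mono (by omega)
  | cons a l ih =>
    have ih := ih (step s a) (fun l₁ b l₂ e => h (a :: l₁) b l₂ (by rw [e]; rfl))
      (fun l₁ h₁ => hM (a :: l₁) (by simpa using h₁)) (by simp at hl; omega)
    have e : (enc (a :: l)).ser ++ ((enc s).ser ++ x) =
        .comma :: ((enc a).ser ++ ((enc l).ser ++ ((enc s).ser ++ x))) := by
      simp [enc, Data.ser]
    have hr := h [] a l rfl ((enc l).ser ++ x) y z w
    have e' : (enc (a, List.foldl step s [])).ser ++ ((enc l).ser ++ x) =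
        .comma :: ((enc a).ser ++ ((enc s).ser ++ ((enc l).ser ++ x))) := by
      simp [enc, Data.ser]
    rw [e'] at hr
    rw [e]
    refine (exec_loop_x rfl (.seq' (exec_swap₂ _ _ _ _ _ _ _) (.seq' (exec_push_x _)
      (.seq' hr (exec_swap _ _ _ _ _ _)))) ih).mono ?_
    have h₁ := hM [] (by simp)
    have h₂ := hM [a] (by simp)
    simp only [esize_cons] at hl
    simp only [esize, List.nil_append, List.foldl_nil, List.foldl_cons] at hl h₁ h₂ ⊢
    rw [List.length_cons, add_mul]
    omega

/-- Iterating a polynomial time step can produce states of exponential size, for instance if each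
step doubles the state. Hence a polynomial bound on all intermediate states is part of the
hypotheses. -/
theorem foldl_of_le {l : γ → List α} {s : γ → σ} {step : γ → σ → α → σ} (hl : PolyFun l)
    (hs : PolyFun s) (hstep : PolyFun fun p : γ × σ × α => step p.1 p.2.1 p.2.2)
    (r : Polynomial ℕ)
    (hr : ∀ c l₁, l₁ <+: l c → esize (l₁.foldl (step c) (s c)) ≤ r.eval (esize c)) :
    PolyFun fun c => (l c).foldl (step c) (s c) := by
  have h₁ : PolyFun fun c => (l c, c, s c) := by fun_prop
  have h₂ : PolyFun fun p : α × γ × σ => (p.2.1, step p.2.1 p.2.2 p.1) :=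
    pair (by fun_prop) (hstep.comp (f := fun p : α × γ × σ => (p.2.1, p.2.2, p.1)) (by fun_prop))
  obtain ⟨r₁, hr₁⟩ := hl.esize_le
  obtain ⟨p₁, q₁, hp₁⟩ := h₁
  obtain ⟨p₂, q₂, hp₂⟩ := h₂
  -- The loop passes only the entry and the state to the step, so the parameter `c` travels with the
  -- state.
  have h : PolyFun fun c => (l c).foldl (fun (t : γ × σ) a => (t.1, step t.1 t.2 a)) (c, s c) := by
    -- The `pop` removes the `comma` that pairs the list with the state, as the loop expects them
    -- separately.
    refine ⟨.seq p₁ (.seq (.pop .x fun _ => foldLoop p₂) .skip),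
      q₁ + (r₁ * (q₂.comp (r₁ + .X + r + 2) + 50 * (r₁ + .X + r + 2) + 50) + 3), fun c x y z w => ?_⟩
    have e : (enc (l c, c, s c)).ser ++ x =
        .comma :: ((enc (l c)).ser ++ ((enc (c, s c)).ser ++ x)) := by
      simp [enc, Data.ser]
    have hrun := hp₁ c x y z w
    rw [e] at hrun
    have hf : ∀ l₁ : List α, l₁.foldl (fun (t : γ × σ) a => (t.1, step t.1 t.2 a)) (c, s c) =
        (c, l₁.foldl (step c) (s c)) := by
      intro l₁
      induction l₁ using List.reverseRecOn with
      | nil => rfl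
      | append_singleton l₁ a ih => simp [ih]
    have hsz : esize (l c) ≤ r₁.eval (esize c) := hr₁ c
    have hloop := exec_foldLoop (step := fun (t : γ × σ) a => (t.1, step t.1 t.2 a)) p₂
      (q₂.eval (r₁.eval (esize c) + esize c + r.eval (esize c) + 2))
      (r₁.eval (esize c) + esize c + r.eval (esize c) + 2) (l c) (c, s c) (fun l₁ a l₂ e x y z w => by
        rw [List.foldl_append, hf]
        refine (hp₂ (a, (c, l₁.foldl (step c) (s c))) x y z w).mono (eval_mono _ ?_)
        have h₁ := hr c l₁ (e ▸ List.prefix_append _ _)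
        have h₂ := esize_le_of_mem (a := a) (l := l c) (by simp [e])
        simp
        omega) (fun l₁ h => by
        rw [hf]
        have := hr c l₁ h
        simp
        omega) (by omega) x y z w
    refine .seq hrun (.seq' (exec_pop_x hloop) (.skip le_rfl)) ?_
    simp only [Polynomial.eval_add, Polynomial.eval_mul, Polynomial.eval_comp, Polynomial.eval_X,
      Polynomial.eval_ofNat]
    have := Nat.mul_le_mul_right (q₂.eval (r₁.eval (esize c) + esize c + r.eval (esize c) + 2) +
      50 * (r₁.eval (esize c) + esize c + r.eval (esize c) + 2) + 50)
      ((length_le_esize (l c)).trans hsz)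
    omega
  refine (snd.comp h).congr_enc (fun c => c) (fun _ => rfl) fun c => ?_
  congr 1
  generalize s c = s
  induction l c generalizing s with
  | nil => rfl
  | cons a l ih => exact ih _

/-- If a step adds to the size an amount that depends on the parameter and the entry but not on the
state, then the total growth is at most the length of the list times a polynomial. -/
theorem foldl {l : γ → List α} {s : γ → σ} {step : γ → σ → α → σ} (hl : PolyFun l)
    (hs : PolyFun s) (hstep : PolyFun fun p : γ × σ × α => step p.1 p.2.1 p.2.2)
    (hr : ∃ r : Polynomial ℕ, ∀ c s a, esize (step c s a) ≤ esize s + r.eval (esize (c, a))) :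
    PolyFun fun c => (l c).foldl (step c) (s c) := by
  obtain ⟨r, hr⟩ := hr
  obtain ⟨r₁, hr₁⟩ := hl.esize_le
  obtain ⟨r₂, hr₂⟩ := hs.esize_le
  refine foldl_of_le hl hs hstep (r₂ + r₁ * r.comp (r₁ + .X + 1)) fun c l₁ h => ?_
  have key : ∀ l₁ : List α, l₁ <+: l c → esize (l₁.foldl (step c) (s c)) ≤
      esize (s c) + l₁.length * r.eval (r₁.eval (esize c) + esize c + 1) := by
    intro l₁ h
    induction l₁ using List.reverseRecOn with
    | nil => simp
    | append_singleton l₁ a ih =>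
      have h₁ := ih ((List.prefix_append _ _).trans h)
      have h₂ := hr c (l₁.foldl (step c) (s c)) a
      have h₃ := esize_le_of_mem (a := a) (h.subset (by simp))
      have h₄ := eval_mono r (m := esize (c, a)) (n := r₁.eval (esize c) + esize c + 1) (by
        have := hr₁ c; simp; omega)
      simp only [List.foldl_append, List.foldl_cons, List.foldl_nil, List.length_append,
        List.length_singleton, add_mul, one_mul]
      omega
  have h₁ := key l₁ h
  have h₂ := hr₂ c
  have h₃ := h.length_le.trans ((length_le_esize _).trans (hr₁ c))
  have h₄ := Nat.mul_le_mul_right (r.eval (r₁.eval (esize c) + esize c + 1)) h₃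
  simp only [Polynomial.eval_add, Polynomial.eval_mul, Polynomial.eval_comp, Polynomial.eval_X,
    Polynomial.eval_one]
  omega

end PolyFun

end TreePacking

namespace TreePacking

open Computability (Γ')

variable {α β γ δ σ : Type} [Enc α] [Enc β] [Enc γ] [Enc δ] [Enc σ]

/-! ### Operations on lists and truth values -/

namespace PolyFun

@[fun_prop]
theorem reverse {l : γ → List α} (hl : PolyFun l) : PolyFun fun c => (l c).reverse := by
  have h : PolyFun fun c => (l c).foldl (fun s a => a :: s) [] :=
    foldl hl (by fun_prop) (by fun_prop) ⟨.X + 1, fun c s a => by simp; omega⟩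
  simpa using h

theorem foldr {l : γ → List α} {s : γ → σ} {step : γ → α → σ → σ} (hl : PolyFun l)
    (hs : PolyFun s) (hstep : PolyFun fun p : γ × α × σ => step p.1 p.2.1 p.2.2)
    (hr : ∃ r : Polynomial ℕ, ∀ c s a, esize (step c a s) ≤ esize s + r.eval (esize (c, a))) :
    PolyFun fun c => (l c).foldr (step c) (s c) := by
  have h : PolyFun fun c => (l c).reverse.foldl (fun s a => step c a s) (s c) :=
    foldl (step := fun c s a => step c a s) (by fun_prop) hs
      (hstep.comp (f := fun p : γ × σ × α => (p.1, p.2.2, p.2.1)) (by fun_prop)) hr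
  simpa using h

@[fun_prop]
theorem append {l l' : γ → List α} (hl : PolyFun l) (hl' : PolyFun l') :
    PolyFun fun c => l c ++ l' c := by
  have h : PolyFun fun c => (l c).foldr (fun a s => a :: s) (l' c) :=
    foldr (step := fun _ a s => a :: s) hl hl' (by fun_prop) ⟨.X + 1, fun c s a => by simp; omega⟩
  simpa using h

@[fun_prop]
theorem flatMap {l : γ → List α} {f : γ → α → List β} (hl : PolyFun l)
    (hf : PolyFun fun p : γ × α => f p.1 p.2) : PolyFun fun c => (l c).flatMap (f c) := by
  obtain ⟨q, hq⟩ := hf.esize_le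
  have h : PolyFun fun c => (l c).foldr (fun a s => f c a ++ s) [] :=
    foldr (step := fun c a s => f c a ++ s) hl (by fun_prop)
      (append (hf.comp (f := fun p : γ × α × List β => (p.1, p.2.1)) (by fun_prop)) (by fun_prop))
      ⟨q, fun c s a => by
        have := esize_append (f c a) s
        have := hq (c, a)
        simp only at this
        omega⟩
  refine h.congr_enc (fun c => c) (fun _ => rfl) fun c => ?_
  congr 1
  induction l c with
  | nil => rfl
  | cons a l ih => rw [List.foldr_cons, ih, List.flatMap_cons]

@[fun_prop]
theorem map {l : γ → List α} {f : γ → α → β} (hl : PolyFun l)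
    (hf : PolyFun fun p : γ × α => f p.1 p.2) : PolyFun fun c => (l c).map (f c) := by
  have h : PolyFun fun c => (l c).flatMap fun a => [f c a] :=
    flatMap (f := fun c a => [f c a]) hl (cons hf (by fun_prop))
  refine h.congr_enc (fun c => c) (fun _ => rfl) fun c => ?_
  congr 1
  induction l c with
  | nil => rfl
  | cons a l ih => simpa using ih

@[fun_prop]
theorem flatten {l : γ → List (List α)} (hl : PolyFun l) : PolyFun fun c => (l c).flatten := by
  have h : PolyFun fun c => (l c).flatMap fun a => a := by fun_prop
  simpa using h

@[fun_prop]
theorem filter {l : γ → List α} {f : γ → α → Bool} (hl : PolyFun l)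
    (hf : PolyFun fun p : γ × α => f p.1 p.2) : PolyFun fun c => (l c).filter (f c) := by
  have h : PolyFun fun c => (l c).flatMap fun a => bif f c a then [a] else [] :=
    flatMap (f := fun c a => bif f c a then [a] else []) hl (by fun_prop)
  refine h.congr_enc (fun c => c) (fun _ => rfl) fun c => ?_
  congr 1
  induction l c with
  | nil => rfl
  | cons a l ih => cases h : f c a <;> simp [h] at ih ⊢ <;> exact ih

@[fun_prop]
theorem not {b : γ → Bool} (hb : PolyFun b) : PolyFun fun c => !(b c) := by
  have h : PolyFun fun c => bif b c then false else true := by fun_prop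
  refine h.congr_enc (fun c => c) (fun _ => rfl) fun c => ?_
  cases b c <;> rfl

@[fun_prop]
theorem and {b b' : γ → Bool} (hb : PolyFun b) (hb' : PolyFun b') :
    PolyFun fun c => b c && b' c := by
  have h : PolyFun fun c => bif b c then b' c else false := by fun_prop
  refine h.congr_enc (fun c => c) (fun _ => rfl) fun c => ?_
  cases b c <;> rfl

@[fun_prop]
theorem or {b b' : γ → Bool} (hb : PolyFun b) (hb' : PolyFun b') :
    PolyFun fun c => b c || b' c := by
  have h : PolyFun fun c => bif b c then true else b' c := by fun_prop
  refine h.congr_enc (fun c => c) (fun _ => rfl) fun c => ?_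
  cases b c <;> rfl

@[fun_prop]
theorem xor {b b' : γ → Bool} (hb : PolyFun b) (hb' : PolyFun b') :
    PolyFun fun c => Bool.xor (b c) (b' c) := by
  have h : PolyFun fun c => bif b c then !(b' c) else b' c := by fun_prop
  refine h.congr_enc (fun c => c) (fun _ => rfl) fun c => ?_
  cases b c <;> cases b' c <;> rfl

@[fun_prop]
theorem any {l : γ → List α} {f : γ → α → Bool} (hl : PolyFun l)
    (hf : PolyFun fun p : γ × α => f p.1 p.2) : PolyFun fun c => (l c).any (f c) := by
  have h : PolyFun fun c => (l c).foldr (fun a s => f c a || s) false :=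
    foldr (step := fun c a s => f c a || s) hl (by fun_prop)
      (or (hf.comp (f := fun p : γ × α × Bool => (p.1, p.2.1)) (by fun_prop)) (by fun_prop))
      ⟨0, fun c s a => by simp⟩
  refine h.congr_enc (fun c => c) (fun _ => rfl) fun c => ?_
  congr 1
  induction l c with
  | nil => rfl
  | cons a l ih => simp only [List.foldr_cons, ih, List.any_cons]

@[fun_prop]
theorem all {l : γ → List α} {f : γ → α → Bool} (hl : PolyFun l)
    (hf : PolyFun fun p : γ × α => f p.1 p.2) : PolyFun fun c => (l c).all (f c) := by
  have h : PolyFun fun c => !((l c).any fun a => !(f c a)) :=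
    not (any (f := fun c a => !(f c a)) hl (not hf))
  refine h.congr_enc (fun c => c) (fun _ => rfl) fun c => ?_
  rw [List.all_eq_not_any_not]

@[fun_prop]
theorem isEmpty {l : γ → List α} (hl : PolyFun l) : PolyFun fun c => (l c).isEmpty := by
  have h : PolyFun fun c => TreePacking.listCase (l c) true fun _ _ => false := by fun_prop
  refine h.congr_enc (fun c => c) (fun _ => rfl) fun c => ?_
  cases l c <;> rfl

@[fun_prop]
theorem tail {l : γ → List α} (hl : PolyFun l) : PolyFun fun c => (l c).tail := by
  have h : PolyFun fun c => TreePacking.listCase (l c) [] fun _ t => t := by fun_prop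
  refine h.congr_enc (fun c => c) (fun _ => rfl) fun c => ?_
  cases l c <;> rfl

@[fun_prop]
theorem headD {l : γ → List α} {d : γ → α} (hl : PolyFun l) (hd : PolyFun d) :
    PolyFun fun c => (l c).headD (d c) := by
  have h : PolyFun fun c => TreePacking.listCase (l c) (d c) fun a _ => a := by fun_prop
  refine h.congr_enc (fun c => c) (fun _ => rfl) fun c => ?_
  cases l c <;> rfl

end PolyFun

/-! ### Arithmetic on binary numbers -/

/-- The equality test for lists of bits. -/
def eqBits (l l' : List Bool) : Bool :=
  let s := l.foldl (fun (s : Bool × List Bool) a =>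
    (s.1 && !s.2.isEmpty && !(Bool.xor a (s.2.headD false)), s.2.tail)) (true, l')
  s.1 && s.2.isEmpty

theorem eqBits_eq (l l' : List Bool) : eqBits l l' = decide (l = l') := by
  have key : ∀ (l l' : List Bool) (b : Bool), (let s := l.foldl (fun (s : Bool × List Bool) a =>
      (s.1 && !s.2.isEmpty && !(Bool.xor a (s.2.headD false)), s.2.tail)) (b, l')
      s.1 && s.2.isEmpty) = (b && decide (l = l')) := by
    intro l
    induction l with
    | nil => intro l' b; cases l' <;> simp
    | cons a l ih =>
      intro l' b
      rw [List.foldl_cons, ih]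
      cases l' with
      | nil => simp
      | cons a' l' => cases a <;> cases a' <;> rw [Bool.eq_iff_iff] <;> simp <;>
          exact fun _ => decide_eq_true_iff
  exact (key l l' true).trans (by simp)

theorem esize_tail_le (l : List α) : esize l.tail ≤ esize l :=
  esize_le_of_sublist l.tail_sublist

namespace PolyFun

@[fun_prop]
theorem eqBits {l l' : γ → List Bool} (hl : PolyFun l) (hl' : PolyFun l') :
    PolyFun fun c => TreePacking.eqBits (l c) (l' c) := by
  have h : PolyFun fun c => (l c).foldl (fun (s : Bool × List Bool) a =>
      (s.1 && !s.2.isEmpty && !(Bool.xor a (s.2.headD false)), s.2.tail)) (true, l' c) :=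
    foldl (step := fun _ (s : Bool × List Bool) a =>
      (s.1 && !s.2.isEmpty && !(Bool.xor a (s.2.headD false)), s.2.tail)) hl (by fun_prop)
      (by fun_prop) ⟨0, fun c s a => by have := esize_tail_le s.2; simp; omega⟩
  unfold TreePacking.eqBits
  fun_prop

/-- The binary representation of a number. -/
@[fun_prop]
theorem encodeNat {f : γ → ℕ} (hf : PolyFun f) :
    PolyFun fun c => Computability.encodeNat (f c) :=
  hf.congr_enc (fun c => c) (fun _ => rfl) fun _ => rfl

theorem of_encodeNat {f : γ → ℕ} (hf : PolyFun fun c => Computability.encodeNat (f c)) :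
    PolyFun f :=
  hf.congr_enc (fun c => c) (fun _ => rfl) fun _ => rfl

@[fun_prop]
theorem natEq {f g : γ → ℕ} (hf : PolyFun f) (hg : PolyFun g) :
    PolyFun fun c => decide (f c = g c) := by
  have h : PolyFun fun c => TreePacking.eqBits (Computability.encodeNat (f c))
    (Computability.encodeNat (g c)) := by fun_prop
  refine h.congr_enc (fun c => c) (fun _ => rfl) fun c => ?_
  congr 1
  rw [eqBits_eq]
  exact decide_eq_decide.2 (Computability.encodingNatBool.encode_injective.eq_iff)

@[fun_prop]
theorem contains {l : γ → List ℕ} {f : γ → ℕ} (hl : PolyFun l) (hf : PolyFun f) :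
    PolyFun fun c => (l c).contains (f c) := by
  have h : PolyFun fun c => (l c).any fun a => decide (f c = a) := by fun_prop
  refine h.congr_enc (fun c => c) (fun _ => rfl) fun c => ?_
  congr 1
  rw [Bool.eq_iff_iff]
  simp

end PolyFun

end TreePacking

namespace TreePacking

open Computability (Γ')

/-! ### Transducers and binary arithmetic -/

variable {α β γ δ σ : Type} [Enc α] [Enc β] [Enc γ] [Enc δ] [Enc σ]

/-- The output of a transducer with states `σ` that outputs one bit for each symbol that it reads,
and a final list of bits. -/
def transduce (f : σ → α → σ × Bool) (e : σ → List Bool) : σ → List α → List Bool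
  | s, [] => e s
  | s, a :: l => (f s a).2 :: transduce f e (f s a).1 l

/-- A fold that collects the output in reverse. A state that grows by at most a constant per symbol
meets the condition of additive growth in `foldl`. -/
theorem PolyFun.transduce {l : γ → List α} {s : γ → σ} {f : σ → α → σ × Bool}
    {e : σ → List Bool} (hl : PolyFun l) (hs : PolyFun s)
    (hf : PolyFun fun p : σ × α => f p.1 p.2) (he : PolyFun e)
    (hr : ∃ r : ℕ, ∀ s a, esize (f s a).1 ≤ esize s + r) :
    PolyFun fun c => TreePacking.transduce f e (s c) (l c) := by
  obtain ⟨r, hr⟩ := hr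
  have h : PolyFun fun c => (l c).foldl (fun (t : σ × List Bool) a =>
      ((f t.1 a).1, (f t.1 a).2 :: t.2)) (s c, []) := by
    have hf' : PolyFun fun p : γ × (σ × List Bool) × α => f p.2.1.1 p.2.2 :=
      hf.comp (f := fun p : γ × (σ × List Bool) × α => (p.2.1.1, p.2.2)) (by fun_prop)
    refine foldl (step := fun c (t : σ × List Bool) a => ((f t.1 a).1, (f t.1 a).2 :: t.2)) hl
      (by fun_prop) (by fun_prop) ⟨(r + 2 : ℕ), fun c s a => ?_⟩
    have := hr s.1 a
    simp only [esize_prod, esize_cons, esize_bool, Polynomial.eval_natCast, Nat.cast_id]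
    omega
  have h' : PolyFun fun c => ((l c).foldl (fun (t : σ × List Bool) a =>
      ((f t.1 a).1, (f t.1 a).2 :: t.2)) (s c, [])).2.reverse ++ e ((l c).foldl
      (fun (t : σ × List Bool) a => ((f t.1 a).1, (f t.1 a).2 :: t.2)) (s c, [])).1 := by
    fun_prop
  refine h'.congr_enc (fun c => c) (fun _ => rfl) fun c => ?_
  congr 1
  have key : ∀ (l : List α) (s : σ) (o : List Bool), (l.foldl (fun (t : σ × List Bool) a =>
      ((f t.1 a).1, (f t.1 a).2 :: t.2)) (s, o)).2.reverse ++ e (l.foldl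
      (fun (t : σ × List Bool) a => ((f t.1 a).1, (f t.1 a).2 :: t.2)) (s, o)).1 =
      o.reverse ++ TreePacking.transduce f e s l := by
    intro l
    induction l with
    | nil => intro s o; rfl
    | cons a l ih => intro s o; simp [ih, TreePacking.transduce]
  exact key _ _ _

/-- Add a carry to a binary number. -/
def addCarry : Bool → List Bool → List Bool :=
  transduce (fun c a => (c && a, Bool.xor c a)) fun c => bif c then [true] else []

theorem addCarry_false (l : List Bool) : addCarry false l = l := by
  induction l with
  | nil => rfl
  | cons a l ih => simp [addCarry, transduce] at ih ⊢; exact ih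

/-- The least significant bit comes first, so the carry runs along the list. The result is the
canonical representation itself, not merely a list of the right value, as the encoding of a number
demands. -/
theorem encodeNat_succ (n : ℕ) :
    Computability.encodeNat (n + 1) = addCarry true (Computability.encodeNat n) := by
  have h : ∀ p : PosNum, Computability.encodePosNum p.succ =
      addCarry true (Computability.encodePosNum p) := by
    intro p
    induction p with
    | one => rfl
    | bit0 p => 
      have := addCarry_false (Computability.encodePosNum p)
      simp only [addCarry] at this
      simp [PosNum.succ, Computability.encodePosNum, addCarry, transduce, this]
    | bit1 p ih => simpa [PosNum.succ, Computability.encodePosNum, addCarry, transduce] using ih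
  unfold Computability.encodeNat
  rw [Nat.cast_succ, Num.add_one]
  generalize (n : Num) = m
  cases m with
  | zero => rfl
  | pos p => exact h p

namespace PolyFun

@[fun_prop]
theorem succ {f : γ → ℕ} (hf : PolyFun f) : PolyFun fun c => f c + 1 := by
  refine of_encodeNat ?_
  simp only [encodeNat_succ, addCarry]
  exact transduce (by fun_prop) (by fun_prop) (by fun_prop) (by fun_prop) ⟨0, fun s a => by simp⟩

end PolyFun

/-- The value of a binary number that may have leading zeros. -/
def val : List Bool → ℕ
  | [] => 0
  | a :: l => a.toNat + 2 * val l

theorem val_encodeNat (n : ℕ) : val (Computability.encodeNat n) = n := by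
  have h : ∀ p : PosNum, val (Computability.encodePosNum p) = (p : ℕ) := by
    intro p
    induction p with
    | one => rfl
    | bit0 p ih => simp [Computability.encodePosNum, val, ih, PosNum.cast_bit0]; omega
    | bit1 p ih => simp [Computability.encodePosNum, val, ih, PosNum.cast_bit1]; omega
  have h' : ∀ m : Num, val (Computability.encodeNum m) = (m : ℕ) := by
    intro m
    cases m with
    | zero => rfl
    | pos p => simpa [Computability.encodeNum] using h p
  rw [Computability.encodeNat, h', Num.to_of_nat]

theorem val_append_false {α : Type} (l : List Bool) (l' : List α) : val (l ++ l'.map fun _ => false) = val l := by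
  induction l with
  | nil =>
    induction l' with
    | nil => rfl
    | cons a l' ih => simpa [val] using ih
  | cons a l ih => rw [List.cons_append, val, ih, val]

/-- Binary addition. -/
def addBits (l l' : List Bool) : List Bool :=
  transduce (fun (s : Bool × List Bool) a => ((bif s.1 then a || s.2.headD false
    else a && s.2.headD false, s.2.tail), Bool.xor s.1 (Bool.xor a (s.2.headD false))))
    (fun s => [s.1]) (false, l') (l ++ l'.map fun _ => false)

theorem val_addBits (l l' : List Bool) : val (addBits l l') = val l + val l' := by
  -- The transducer reads `l` only, so bits of `r` beyond the length of `l` would be lost. The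
  -- padding with zeros in `addBits` guarantees the inequality.
  have key : ∀ (l : List Bool) (c : Bool) (r : List Bool), r.length ≤ l.length →
      val (transduce (fun (s : Bool × List Bool) a => ((bif s.1 then a || s.2.headD false
    else a && s.2.headD false, s.2.tail), Bool.xor s.1 (Bool.xor a (s.2.headD false))))
    (fun s => [s.1]) (c, r) l) = val l + val r + c.toNat := by
    intro l
    induction l with
    | nil =>
      intro c r h
      obtain rfl : r = [] := by simpa using h
      simp [transduce, val]
    | cons a l ih =>
      intro c r h
      have h' := ih (bif c then a || r.headD false else a && r.headD false) r.tail (by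
        simp at h ⊢; omega)
      have hr : val r = (r.headD false).toNat + 2 * val r.tail := by cases r <;> simp [val]
      rw [transduce, val, h', hr, val]
      generalize r.headD false = b
      cases a <;> cases b <;> cases c <;> simp <;> omega
  rw [addBits, key _ _ _ (by simp), val_append_false]
  simp

theorem length_transduce {α σ : Type} (f : σ → α → σ × Bool) (e : σ → List Bool) (k : ℕ)
    (he : ∀ s, (e s).length ≤ k) (s : σ) (l : List α) :
    (transduce f e s l).length ≤ l.length + k := by
  induction l generalizing s with
  | nil => simpa [transduce] using he s
  | cons a l ih => have := ih (f s a).1; simp [transduce]; omega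

theorem esize_bits (l : List Bool) : esize l = 2 * l.length + 1 := by
  induction l with
  | nil => rfl
  | cons a l ih => simp; omega

theorem esize_addBits (l l' : List Bool) : esize (addBits l l') ≤ esize l + esize l' + 1 := by
  have := length_transduce (fun (s : Bool × List Bool) a => ((bif s.1 then a || s.2.headD false
    else a && s.2.headD false, s.2.tail), Bool.xor s.1 (Bool.xor a (s.2.headD false))))
    (fun s => [s.1]) 1 (by simp) (false, l') (l ++ l'.map fun _ => false)
  rw [esize_bits, esize_bits, esize_bits, addBits]
  simp only [List.length_append, List.length_map] at this
  omega

@[fun_prop]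
theorem PolyFun.addBits {l l' : γ → List Bool} (hl : PolyFun l) (hl' : PolyFun l') :
    PolyFun fun c => TreePacking.addBits (l c) (l' c) := by
  unfold TreePacking.addBits
  exact PolyFun.transduce (by fun_prop) (by fun_prop) (by fun_prop) (by fun_prop)
    ⟨0, fun s a => by have := esize_tail_le s.2; simp; omega⟩

/-- Binary multiplication. -/
def mulBits (l l' : List Bool) : List Bool :=
  l'.foldr (fun a s => addBits (bif a then l else []) (false :: s)) []

/-- Horner's scheme; putting `false` in front doubles a number. -/
theorem val_mulBits (l l' : List Bool) : val (mulBits l l') = val l * val l' := by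
  induction l' with
  | nil => simp [mulBits, val]
  | cons a l' ih =>
    rw [mulBits] at ih ⊢
    rw [List.foldr_cons, val_addBits, val, val, ih]
    cases a
    · simp [val]; ring
    · simp; ring

@[fun_prop]
theorem PolyFun.mulBits {l l' : γ → List Bool} (hl : PolyFun l) (hl' : PolyFun l') :
    PolyFun fun c => TreePacking.mulBits (l c) (l' c) := by
  have h : PolyFun fun p : List Bool × List Bool => TreePacking.mulBits p.1 p.2 := by
    unfold TreePacking.mulBits
    refine foldr (step := fun (p : List Bool × List Bool) a s => TreePacking.addBits (bif a then p.1 else []) (false :: s))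
      (by fun_prop) (by fun_prop) (by fun_prop) ⟨.X + 3, fun c s a => ?_⟩
    have h₁ := esize_addBits (bif a then c.1 else []) (false :: s)
    have h₂ : esize (bif a then c.1 else []) ≤ esize c.1 := by
      cases a
      · exact one_le_esize _
      · exact le_rfl
    simp at h₁ ⊢
    omega
  exact h.comp (hl.pair hl')

/-- Comparison of binary numbers. -/
def leBits (l l' : List Bool) : Bool :=
  ((l ++ l'.map fun _ => false).foldl (fun (s : Bool × List Bool) a =>
    (bif Bool.xor a (s.2.headD false) then s.2.headD false else s.1, s.2.tail)) (true, l')).1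

/-- As the bits are read from the least significant one on, the last position in which the numbers
differ decides. The initial value of the flag matters only if they are equal. -/
theorem leBits_eq (l l' : List Bool) : leBits l l' = decide (val l ≤ val l') := by
  have key : ∀ (l : List Bool) (c : Bool) (r : List Bool), r.length ≤ l.length →
      (l.foldl (fun (s : Bool × List Bool) a => (bif Bool.xor a (s.2.headD false) then
        s.2.headD false else s.1, s.2.tail)) (c, r)).1 =
        decide (val l < val r ∨ val l = val r ∧ c = true) := by
    intro l
    induction l with
    | nil =>
      intro c r h
      obtain rfl : r = [] := by simpa using h
      simp [val]
    | cons a l ih =>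
      intro c r h
      rw [List.foldl_cons, ih _ _ (by simp at h ⊢; omega)]
      have hr : val r = (r.headD false).toNat + 2 * val r.tail := by cases r <;> simp [val]
      rw [hr, val, decide_eq_decide]
      simp only
      generalize r.headD false = b
      generalize val r.tail = m
      cases a <;> cases b <;> cases c <;> simp <;> omega
  rw [leBits, key _ _ _ (by simp), val_append_false, decide_eq_decide]
  simp
  omega

@[fun_prop]
theorem PolyFun.leBits {l l' : γ → List Bool} (hl : PolyFun l) (hl' : PolyFun l') :
    PolyFun fun c => TreePacking.leBits (l c) (l' c) := by
  have h : PolyFun fun c => (l c ++ (l' c).map fun _ => false).foldl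
      (fun (s : Bool × List Bool) a => (bif Bool.xor a (s.2.headD false) then s.2.headD false
        else s.1, s.2.tail)) (true, l' c) :=
    foldl (step := fun _ (s : Bool × List Bool) a => (bif Bool.xor a (s.2.headD false) then
      s.2.headD false else s.1, s.2.tail)) (by fun_prop) (by fun_prop) (by fun_prop)
      ⟨0, fun c s a => by have := esize_tail_le s.2; simp; omega⟩
  unfold TreePacking.leBits
  fun_prop

-- This is the form that the comparison of two fractions takes after multiplying by the
-- denominators.
@[fun_prop]
theorem PolyFun.mul_le_mul {a b c d : γ → ℕ} (ha : PolyFun a) (hb : PolyFun b) (hc : PolyFun c)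
    (hd : PolyFun d) : PolyFun fun t => decide (a t * b t ≤ c t * d t) := by
  have h : PolyFun fun t => TreePacking.leBits
    (TreePacking.mulBits (Computability.encodeNat (a t)) (Computability.encodeNat (b t)))
    (TreePacking.mulBits (Computability.encodeNat (c t)) (Computability.encodeNat (d t))) := by
    fun_prop
  refine h.congr_enc (fun c => c) (fun _ => rfl) fun c => ?_
  simp only [leBits_eq, val_mulBits, val_encodeNat]

theorem length_encodeNat_le (n : ℕ) : (Computability.encodeNat n).length ≤ n := by
  induction n with
  | zero => simp [Computability.encodeNat, Computability.encodeNum]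
  | succ n ih =>
    rw [encodeNat_succ]
    have := length_transduce (fun c a => (c && a, Bool.xor c a))
      (fun c => bif c then [true] else []) 1 (by decide) true (Computability.encodeNat n)
    unfold addCarry
    omega

/-- A bound linear in the value suffices, since it is applied to positions in lists. -/
theorem esize_nat_le (n : ℕ) : esize n ≤ 2 * n + 1 := by
  have h : esize n = esize (Computability.encodeNat n) := rfl
  have := length_encodeNat_le n
  rw [h, esize_bits]
  omega

theorem esize_succ_le (n : ℕ) : esize (n + 1) ≤ esize n + 2 := by
  have h : ∀ n : ℕ, esize n = esize (Computability.encodeNat n) := fun _ => rfl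
  have := length_transduce (fun c a => (c && a, Bool.xor c a))
    (fun c => bif c then [true] else []) 1 (by decide) true (Computability.encodeNat n)
  rw [h, h, esize_bits, esize_bits, encodeNat_succ, addCarry]
  omega

-- Growth is not independent of the state here, because the counter is copied into each entry. But
-- it never exceeds the length of the list, and so `foldl_of_le` applies.
@[fun_prop]
theorem PolyFun.zipIdx {l : γ → List α} (hl : PolyFun l) : PolyFun fun c => (l c).zipIdx := by
  have key : ∀ (l : List α) (o : List (α × ℕ)) (n : ℕ),
      l.foldl (fun (s : ℕ × List (α × ℕ)) a => (s.1 + 1, (a, s.1) :: s.2)) (n, o) =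
        (n + l.length, (l.zipIdx n).reverse ++ o) := by
    intro l
    induction l with
    | nil => intro o n; rfl
    | cons a l ih =>
      intro o n
      rw [List.foldl_cons, ih]
      simp [List.zipIdx_cons]
      omega
  have hsz : ∀ (l : List α) (n : ℕ), esize (l.zipIdx n) ≤
      esize l + l.length * (2 * (n + l.length) + 2) := by
    intro l
    induction l with
    | nil => intro n; simp
    | cons a l ih =>
      intro n
      have h₁ := ih (n + 1)
      have h₂ := esize_nat_le n
      simp only [List.zipIdx_cons, esize_cons, esize_prod, List.length_cons] at h₁ ⊢
      nlinarith
  obtain ⟨r, hr⟩ := hl.esize_le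
  have h : PolyFun fun c => (l c).foldl
      (fun (s : ℕ × List (α × ℕ)) a => (s.1 + 1, (a, s.1) :: s.2)) (0, []) := by
    refine foldl_of_le (step := fun _ (s : ℕ × List (α × ℕ)) a => (s.1 + 1, (a, s.1) :: s.2)) hl
      (by fun_prop) (by fun_prop) (r * (2 * r + 2) + 3 * r + 2) fun c l₁ h => ?_
    rw [key]
    have h₁ := hsz l₁ 0
    have h₂ := esize_nat_le l₁.length
    have h₃ : l₁.length ≤ r.eval (esize c) := h.length_le.trans ((length_le_esize _).trans (hr c))
    have h₄ := (esize_le_of_sublist h.sublist).trans (hr c)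
    have h₅ := Nat.mul_le_mul h₃ (Nat.add_le_add_right (Nat.mul_le_mul_left 2 h₃) 2)
    simp only [zero_add, List.append_nil, esize_prod, esize_reverse, Polynomial.eval_add,
      Polynomial.eval_mul, Polynomial.eval_ofNat] at h₁ ⊢
    omega
  have h' : PolyFun fun c => ((l c).foldl (fun (s : ℕ × List (α × ℕ)) a =>
    (s.1 + 1, (a, s.1) :: s.2)) (0, [])).2.reverse := by fun_prop
  refine h'.congr_enc (fun c => c) (fun _ => rfl) fun c => ?_
  rw [key]
  simp

/-- The remainder of the length of a list modulo `k`. -/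
def lengthMod (k : ℕ) (l : List α) : ℕ := l.foldl (fun s _ => bif decide (s + 1 = k) then 0 else s + 1) 0

/-- Cyclic counting makes a division algorithm for binary numbers unnecessary. -/
theorem lengthMod_eq {α : Type} (k : ℕ) (l : List α) : lengthMod k l = l.length % k := by
  unfold lengthMod
  induction l using List.reverseRecOn with
  | nil => simp
  | append_singleton l a ih =>
    rw [List.foldl_append, ih, List.foldl_cons, List.foldl_nil, List.length_append,
      List.length_singleton, ← Nat.mod_add_mod]
    -- For `k = 0` the counter is never reset, in accordance with `m % 0 = m`.
    rcases Nat.eq_zero_or_pos k with rfl | hk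
    · simp
    · have := Nat.mod_lt l.length hk
      by_cases h : l.length % k + 1 = k
      · simp [h]
      · simp [h, Nat.mod_eq_of_lt (show l.length % k + 1 < k by omega)]

@[fun_prop]
theorem PolyFun.lengthMod {k : γ → ℕ} {l : γ → List α} (hk : PolyFun k) (hl : PolyFun l) :
    PolyFun fun c => TreePacking.lengthMod (k c) (l c) := by
  unfold TreePacking.lengthMod
  refine foldl (step := fun c s _ => bif decide (s + 1 = k c) then 0 else s + 1) hl
    (by fun_prop) (by fun_prop) ⟨2, fun c s a => ?_⟩
  have h₁ := esize_succ_le s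
  have h₂ : esize (0 : ℕ) ≤ esize s := one_le_esize s
  by_cases h : s + 1 = k c <;> simp [h] <;> omega

end TreePacking

namespace TreePacking

open Computability (Γ')
open Enc

variable {α β γ : Type} [Enc α] [Enc β] [Enc γ]

/-! ### Input and output -/

namespace Prog

/-- Move all symbols of one stack to another, replacing each symbol by a list of symbols. -/
def flush (k : Stk) (f : Γ' → Prog) : Prog := loop k (fun _ => false) f

theorem exec_flush_x (l : List Γ') (y z w : List Γ') :
    Exec (flush .x fun a => push .y a) (st l y z w) (2 * l.length + 1)
      (st [] (l.reverse ++ y) z w) := by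
  induction l generalizing y with
  | nil => exact .loop_empty rfl le_rfl
  | cons a l ih =>
    rw [List.reverse_cons, List.append_assoc]
    refine (exec_loop_x rfl (exec_push_y a) (ih (a :: y))).mono ?_
    simp; omega

/-- The constant 4 allows for the `comma` of a list cell and the at most three symbols that encode
an entry. -/
theorem exec_flush_y (f : Γ' → List Γ') (hf : ∀ a, (f a).length ≤ 4) (l : List Γ')
    (x z w : List Γ') :
    Exec (flush .y fun a => pushAll (f a)) (st x l z w) (6 * l.length + 1)
      (st (l.reverse.flatMap f ++ x) [] z w) := by
  induction l generalizing x with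
  | nil => exact .loop_empty rfl le_rfl
  | cons a l ih =>
    rw [List.reverse_cons, List.flatMap_append, List.append_assoc]
    have h := ih (f a ++ x)
    have e : [a].flatMap f = f a := by simp
    rw [e]
    refine (exec_loop_y rfl (exec_pushAll (f a) _ _ _ _) h).mono ?_
    have := hf a
    simp; omega

/-- Encode a string as a data tree. -/
def readInput : Prog :=
  seq (flush .x fun a => push .y a) (seq (push .x (.bit false))
    (flush .y fun a => pushAll (.comma :: (enc a).ser)))

theorem ser_list (l : List α) :
    (enc l).ser = (l.flatMap fun a => .comma :: (enc a).ser) ++ [.bit false] := by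
  induction l with
  | nil => rfl
  | cons a l ih =>
    rw [List.flatMap_cons, List.append_assoc, ← ih]
    simp [enc, Data.ser]

theorem exec_readInput (l : List Γ') :
    Exec readInput (st l [] [] []) (8 * l.length + 3) (st (enc l).ser [] [] []) := by
  have h := exec_flush_y (fun a => .comma :: (enc a).ser) (fun a => by
    cases a <;> simp [enc, Data.size]) l.reverse [.bit false] [] []
  rw [List.reverse_reverse, ← ser_list] at h
  have h' := exec_flush_x l [] [] []
  rw [List.append_nil] at h'
  exact .seq h' (.seq' (exec_push_x _) h) (by simp; omega)

/-- Decode one symbol. -/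
def writeSymbol : Prog := pop .x fun
  | some .comma => pop .x fun b => pop .x fun _ => push .y (if b = some .bra then .comma else .blank)
  | some a => push .y a
  | none => skip

theorem exec_writeSymbol (a : Γ') (x y z w : List Γ') :
    Exec writeSymbol (st ((enc a).ser ++ x) y z w) 4 (st x (a :: y) z w) := by
  cases a with
  | blank => exact exec_pop_x (exec_pop_x (exec_pop_x (exec_push_y _)))
  | bit b => exact (exec_pop_x (exec_push_y _)).mono (by omega)
  | bra => exact (exec_pop_x (exec_push_y _)).mono (by omega)
  | ket => exact (exec_pop_x (exec_push_y _)).mono (by omega)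
  | comma => exact exec_pop_x (exec_pop_x (exec_pop_x (exec_push_y _)))

/-- Decode a string. -/
def writeOutput : Prog :=
  seq (loop .x (fun a => a != .comma) fun _ => writeSymbol) (flush .y fun a => pushAll [a])

theorem exec_writeOutput (l : List Γ') :
    Exec writeOutput (st (enc l).ser [] [] []) (11 * l.length + 2) (st l [] [] []) := by
  have h : ∀ (l y : List Γ'), Exec (loop .x (fun a => a != .comma) fun _ => writeSymbol)
      (st (enc l).ser y [] []) (5 * l.length + 1) (st [] (l.reverse ++ y) [] []) := by
    intro l
    induction l with
    | nil => intro y; exact exec_exit_x rfl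
    | cons a l ih =>
      intro y
      rw [List.reverse_cons, List.append_assoc]
      exact (exec_loop_x rfl (exec_writeSymbol a _ _ _ _) (ih (a :: y))).mono (by simp; omega)
  have h₁ := h l []
  have h₂ := exec_flush_y (fun a => [a]) (by simp) l.reverse [] [] []
  simp only [List.reverse_reverse, List.append_nil] at h₁ h₂
  rw [show (l.flatMap fun a => [a]) = l by simp] at h₂
  exact .seq h₁ h₂ (by simp; omega)

end Prog

theorem esize_string (l : List Γ') : esize l ≤ 4 * l.length + 1 := by
  induction l with
  | nil => simp
  | cons a l ih =>
    have : esize a ≤ 3 := by cases a <;> simp [esize, enc, Data.size]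
    simp; omega

/-- If a function is computed by a program in polynomial time, then it is computable by a Turing
machine in polynomial time. -/
theorem PolyFun.computableInPolyTime {δ : Type} {ea : α → List Γ'} {eb : δ → List Γ'} {f : α → δ}
    (hf : PolyFun fun a => eb (f a)) (ha : ∀ a, enc a = enc (ea a)) :
    Nonempty (Turing.TM2ComputableInPolyTime ea eb f) := by
  obtain ⟨r, hr⟩ := hf.esize_le
  obtain ⟨p, q, hp⟩ := hf
  refine Prog.computableInPolyTime (.seq Prog.readInput (.seq p Prog.writeOutput))
    (8 * .X + 3 + q.comp (4 * .X + 1) + (11 * r.comp (4 * .X + 1) + 2)) fun a => ?_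
  have h := hp a [] [] [] []
  simp only [List.append_nil] at h
  rw [ha] at h
  refine .seq (Prog.exec_readInput _) (.seq' h (Prog.exec_writeOutput _)) ?_
  have h₁ : esize a ≤ 4 * (ea a).length + 1 := by
    have := esize_string (ea a)
    rwa [esize, ← ha] at this
  have h₂ := eval_mono q h₁
  have h₃ := (hr a).trans (eval_mono r h₁)
  have h₄ := length_le_esize (eb (f a))
  simp
  omega

/-! ### Reading an instance -/

/-- The bit of a symbol, as a list that is empty for the other symbols. -/
def symbolBits : Γ' → List Bool
  | .bit b => [b]
  | _ => []

namespace PolyFun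

open Prog

theorem symbolBits : PolyFun TreePacking.symbolBits := by
  -- Only `blank` and `comma` are encoded by trees with two leaves. For them the first pop takes the
  -- root, and both leaves have to be dropped.
  refine ⟨pop .x fun
    | some (.bit b) => pushAll (enc [b]).ser
    | some .comma => seq drop (seq drop (pushAll (enc ([] : List Bool)).ser))
    | _ => pushAll (enc ([] : List Bool)).ser, 40, fun a x y z w => ?_⟩
  rw [Polynomial.eval_ofNat]
  cases a with
  | bit b => exact (exec_pop_x (exec_pushAll _ _ _ _ _)).mono (by simp [enc, Data.size])
  | bra => exact (exec_pop_x (exec_pushAll _ _ _ _ _)).mono (by simp [enc, Data.size])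
  | ket => exact (exec_pop_x (exec_pushAll _ _ _ _ _)).mono (by simp [enc, Data.size])
  | blank =>
    exact (exec_pop_x (.seq' (exec_drop (.leaf .ket) _ _ _ _) (.seq' (exec_drop (.leaf .ket) _ _ _ _)
      (exec_pushAll _ _ _ _ _)))).mono (by simp [enc, Data.size])
  | comma =>
    exact (exec_pop_x (.seq' (exec_drop (.leaf .bra) _ _ _ _) (.seq' (exec_drop (.leaf .bra) _ _ _ _)
      (exec_pushAll _ _ _ _ _)))).mono (by simp [enc, Data.size])

@[fun_prop]
theorem symbolBits' {f : γ → Γ'} (hf : PolyFun f) : PolyFun fun c => TreePacking.symbolBits (f c) :=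
  symbolBits.comp hf

@[fun_prop]
theorem bit {f : γ → Bool} (hf : PolyFun f) : PolyFun fun c => Γ'.bit (f c) :=
  hf.congr_enc (fun c => c) (fun _ => rfl) fun _ => rfl

end PolyFun

/-- Split a string at the symbols that are not bits, where `s` holds the bits that were read since
the last such symbol and the fields read before, in reverse order. -/
def splitFields (s : List Bool × List (List Bool)) (l : List Γ') : List Bool × List (List Bool) :=
  l.foldl (fun s a => TreePacking.listCase (symbolBits a) ([], s.1.reverse :: s.2)
    fun b _ => (b :: s.1, s.2)) s

/-- The fields of a string, each of which is followed by a symbol that is not a bit. -/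
def fields (l : List Γ') : List (List Bool) := (splitFields ([], []) l).2.reverse

@[fun_prop]
theorem PolyFun.fields {l : γ → List Γ'} (hl : PolyFun l) :
    PolyFun fun c => TreePacking.fields (l c) := by
  have h : PolyFun fun c => TreePacking.splitFields ([], []) (l c) := by
    unfold TreePacking.splitFields
    refine foldl (step := fun _ (s : List Bool × List (List Bool)) a => TreePacking.listCase
      (TreePacking.symbolBits a) ([], s.1.reverse :: s.2) fun b _ => (b :: s.1, s.2)) hl
      (by fun_prop) (by fun_prop) ⟨2, fun c s a => ?_⟩
    cases a <;> simp [TreePacking.symbolBits, TreePacking.listCase, esize_reverse] <;> omega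
  unfold TreePacking.fields
  fun_prop

theorem splitFields_append (s : List Bool × List (List Bool)) (l l' : List Γ') :
    splitFields s (l ++ l') = splitFields (splitFields s l) l' := by
  simp [splitFields]

theorem splitFields_field (l : List Bool) (a : Γ') (ha : symbolBits a = []) (l' : List Γ')
    (s : List Bool) (o : List (List Bool)) :
    splitFields (s, o) (l.map Γ'.bit ++ a :: l') =
      splitFields ([], (s.reverse ++ l) :: o) l' := by
  induction l generalizing s with
  | nil => simp [splitFields, ha, listCase]
  | cons b l ih =>
    have := ih (b :: s)
    simp only [splitFields, List.map_cons, List.cons_append, List.foldl_cons, symbolBits,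
      listCase, List.reverse_cons, List.append_assoc, List.nil_append] at this ⊢
    exact this

/-- The data of an edge: its ends, whether its weight is negative, and the numerator and the
denominator of the absolute value of its weight. -/
abbrev EdgeData : Type := ℕ × ℕ × Bool × ℕ × ℕ

/-- The data of an edge. -/
def Edge.data (e : Edge) : EdgeData :=
  (e.fst, e.snd, decide (e.weight < 0), e.weight.num.natAbs, e.weight.den)

/-- The data of an edge in binary. -/
def Edge.bits (e : Edge) : List Bool × List Bool × Bool × List Bool × List Bool :=
  (Computability.encodeNat e.fst, Computability.encodeNat e.snd, decide (e.weight < 0),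
    Computability.encodeNat e.weight.num.natAbs, Computability.encodeNat e.weight.den)

/-- The fields of an edge. -/
def Edge.fields (e : Edge) : List (List Bool) :=
  [[], Computability.encodeNat e.fst, Computability.encodeNat e.snd,
    decide (e.weight < 0) :: Computability.encodeNat e.weight.num.natAbs,
    Computability.encodeNat e.weight.den]

theorem splitFields_edges (l : List Edge) (o : List (List Bool)) :
    splitFields ([], o) (l.flatMap encodeEdge) = ([], (l.flatMap Edge.fields).reverse ++ o) := by
  induction l generalizing o with
  | nil => rfl
  | cons e l ih =>
    rw [List.flatMap_cons, splitFields_append]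
    have h : splitFields ([], o) (encodeEdge e) = ([], e.fields.reverse ++ o) := by
      unfold encodeEdge encodeNat
      -- The `bra` of an edge ends an empty field. The sign bit is not followed by a separator and
      -- so shares a field with the numerator, which gives five fields per edge.
      rw [show ∀ l, Γ'.bra :: l = ([] : List Bool).map Γ'.bit ++ Γ'.bra :: l from fun _ => rfl,
        splitFields_field _ _ rfl, splitFields_field _ _ rfl, splitFields_field _ _ rfl]
      rw [← List.cons_append, ← List.map_cons, splitFields_field _ _ rfl, splitFields_field _ _ rfl]
      rfl
    rw [h, ih]
    simp

theorem fields_encodeInstance (I : Instance) : fields (encodeInstance I) =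
    Computability.encodeNat I.k :: List.replicate I.n true :: I.edges.flatMap Edge.fields := by
  unfold encodeInstance encodeNat
  rw [fields, splitFields_field _ _ rfl, ← List.map_replicate, splitFields_field _ _ rfl,
    splitFields_edges]
  simp

/-- Group the fields of the edges. -/
def groupFields (s : List (List Bool) × List (List Bool × List Bool × Bool × List Bool × List Bool))
    (l : List (List Bool)) :
    List (List Bool) × List (List Bool × List Bool × Bool × List Bool × List Bool) :=
  -- Once four fields are stored, they are, in reverse order, sign and numerator, second end, first
  -- end, and the empty field before `bra`; then `a` is the denominator.
  l.foldl (fun s a => bif s.1.tail.tail.tail.isEmpty then (a :: s.1, s.2) else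
    ([], (s.1.tail.tail.headD [], s.1.tail.headD [], (s.1.headD []).headD false,
      (s.1.headD []).tail, a) :: s.2)) s

theorem groupFields_edges (l : List Edge)
    (o : List (List Bool × List Bool × Bool × List Bool × List Bool)) :
    groupFields ([], o) (l.flatMap Edge.fields) = ([], (l.map Edge.bits).reverse ++ o) := by
  induction l generalizing o with
  | nil => rfl
  | cons e l ih =>
    have h : groupFields ([], o) (e.fields ++ l.flatMap Edge.fields) =
        groupFields ([], e.bits :: o) (l.flatMap Edge.fields) := rfl
    rw [List.flatMap_cons, h, ih]
    simp

theorem PolyFun.groupFields {l : γ → List (List Bool)} (hl : PolyFun l) :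
    PolyFun fun c => TreePacking.groupFields ([], []) (l c) := by
  unfold TreePacking.groupFields
  refine foldl (step := fun _ (s : List (List Bool) × List (List Bool × List Bool × Bool ×
    List Bool × List Bool)) a => bif s.1.tail.tail.tail.isEmpty then (a :: s.1, s.2) else
    ([], (s.1.tail.tail.headD [], s.1.tail.headD [], (s.1.headD []).headD false,
      (s.1.headD []).tail, a) :: s.2)) hl (by fun_prop) (by fun_prop) ⟨.X + 20, fun c s a => ?_⟩
  obtain ⟨s, o⟩ := s
  rcases s with _ | ⟨b, _ | ⟨c, _ | ⟨d, _ | ⟨e, s⟩⟩⟩⟩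
  · simp; omega
  · simp; omega
  · simp; omega
  · simp; omega
  · have := esize_tail_le b
    simp; omega

/-- The encoding of an instance is that of the string that describes it. -/
instance : Enc Instance := ⟨fun I => enc (encodeInstance I)⟩

/-- It turns `Edge.bits` into `Edge.data`: a number is encoded as its list of bits, so both have the
same encoding. -/
theorem enc_map_congr {α β γ : Type} [Enc β] [Enc γ] (l : List α) {f : α → β} {g : α → γ}
    (h : ∀ a, enc (f a) = enc (g a)) : enc (l.map f) = enc (l.map g) := by
  induction l with
  | nil => rfl
  | cons a l ih =>
    change Data.cons _ _ = Data.cons _ _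
    rw [h]
    congr 1

namespace PolyFun

theorem instanceFields : PolyFun fun I : Instance => TreePacking.fields (encodeInstance I) :=
  congr_enc (f := fun l : List Γ' => TreePacking.fields l) (by fun_prop) encodeInstance
    (fun _ => rfl) fun _ => rfl

theorem instance_k : PolyFun fun I : Instance => I.k := by
  refine of_encodeNat ((headD instanceFields (const [])).congr_enc (fun c => c) (fun _ => rfl)
    fun I => ?_)
  rw [fields_encodeInstance]
  rfl

theorem instance_n : PolyFun fun I : Instance => List.replicate I.n true := by
  refine ((headD (tail instanceFields) (const [])).congr_enc (fun c => c) (fun _ => rfl)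
    fun I => ?_)
  rw [fields_encodeInstance]
  rfl

theorem instance_edges : PolyFun fun I : Instance => I.edges.map Edge.data := by
  have h := (groupFields (tail (tail instanceFields))).snd'.reverse
  refine h.congr_enc (fun c => c) (fun _ => rfl) fun I => ?_
  rw [fields_encodeInstance, List.tail_cons, List.tail_cons, groupFields_edges]
  simp only [List.append_nil, List.reverse_reverse]
  exact enc_map_congr _ fun _ => rfl

end PolyFun

end TreePacking

namespace TreePacking

open Computability (Γ')
open Enc

variable {α β γ : Type} [Enc α] [Enc β] [Enc γ]

/-! ### The greedy algorithm -/

/-- The data of an edge, together with its name. -/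
abbrev NamedEdge : Type := EdgeData × ℕ

namespace NamedEdge

/-- The first end. -/
def fst (e : NamedEdge) : ℕ := e.1.1
/-- The second end. -/
def snd (e : NamedEdge) : ℕ := e.1.2.1
/-- Whether the weight is negative. -/
def neg (e : NamedEdge) : Bool := e.1.2.2.1
/-- The numerator of the absolute value of the weight. -/
def num (e : NamedEdge) : ℕ := e.1.2.2.2.1
/-- The denominator of the weight. -/
def den (e : NamedEdge) : ℕ := e.1.2.2.2.2
/-- The name. -/
def name (e : NamedEdge) : ℕ := e.2

/-- The comparison of the absolute values of the weights. -/
def le (e f : NamedEdge) : Bool := decide (e.num * f.den ≤ f.num * e.den)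

end NamedEdge

/-- Insert an edge in a list that is sorted by decreasing absolute values of the weights. -/
def insertEdge (e : NamedEdge) (l : List NamedEdge) : List NamedEdge :=
  (l.filter fun f => !f.le e) ++ e :: l.filter fun f => f.le e

/-- Sort a list of edges by decreasing absolute values of the weights. -/
def sortEdges (l : List NamedEdge) : List NamedEdge := l.foldr insertEdge []

/-- Replace the members of a partition that contain one of two vertices by their union. -/
def mergeBlocks (bs : List (List ℕ)) (u v : ℕ) : List (List ℕ) :=
  (bs.filter fun b => b.contains u || b.contains v).flatten ::
    bs.filter fun b => !(b.contains u || b.contains v)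

/-- The vertex sets of the components of the graph with vertices `vs` and edges `es`. -/
def blocks (vs : List ℕ) (es : List NamedEdge) : List (List ℕ) :=
  es.foldl (fun bs e => mergeBlocks bs e.fst e.snd) (vs.map fun v => [v])

/-- Every member of the partition `ps` meets a member of the partition `as` whose order is not
divisible by `k`. -/
def feasible (k : ℕ) (as ps : List (List ℕ)) : Bool :=
  ps.all fun p => as.any fun a => !decide (lengthMod k a = 0) && a.any fun v => p.contains v

/-- One step of the greedy algorithm, where `s` holds the edges chosen so far and the edges that
have not been discarded. -/
def greedyStep (k : ℕ) (vs : List ℕ) (s : List NamedEdge × List NamedEdge) (e : NamedEdge) :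
    List NamedEdge × List NamedEdge :=
  bif (bif e.neg then
      !feasible k (blocks vs s.1) (blocks vs (s.2.filter fun f => !decide (f.name = e.name)))
    else (!(blocks vs s.1).any fun b => b.contains e.fst && b.contains e.snd) &&
      feasible k (blocks vs (e :: s.1)) (blocks vs s.2))
  then (e :: s.1, s.2) else (s.1, s.2.filter fun f => !decide (f.name = e.name))

/-- The edges chosen by the greedy algorithm. -/
def greedy (k : ℕ) (vs : List ℕ) (es : List NamedEdge) : List NamedEdge :=
  ((sortEdges es).foldl (greedyStep k vs) ([], es)).1

/-- The trees with the given edges. -/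
def listTrees (vs : List ℕ) (es : List NamedEdge) : Output :=
  (blocks vs es).map fun b => (b, (es.filter fun e => b.contains e.fst).map NamedEdge.name)

/-- The vertices of an instance. -/
def Instance.vertexList (I : Instance) : List ℕ := (List.replicate I.n true).zipIdx.map Prod.snd

/-- The edges of an instance. -/
def Instance.edgeList (I : Instance) : List NamedEdge := (I.edges.map Edge.data).zipIdx

/-- The output of the algorithm. -/
def solve (I : Instance) : Output :=
  listTrees I.vertexList (greedy I.k I.vertexList I.edgeList)

/-- Splitting a list and joining the parts again costs only a constant. This yields the additive
growth that `foldl` and `foldr` require of merging blocks and inserting edges. -/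
theorem esize_filter_add (f : α → Bool) (l : List α) :
    esize (l.filter f) + esize (l.filter fun a => !f a) = esize l + 1 := by
  induction l with
  | nil => rfl
  | cons a l ih => cases h : f a <;> simp [h] <;> omega

theorem esize_flatten_le (l : List (List α)) : esize l.flatten ≤ esize l := by
  induction l with
  | nil => simp
  | cons a l ih => have := esize_append a l.flatten; simp; omega

/-! ### The greedy algorithm runs in polynomial time -/

namespace PolyFun

@[fun_prop]
theorem named_fst {f : γ → NamedEdge} (hf : PolyFun f) : PolyFun fun c => (f c).fst := by
  unfold NamedEdge.fst; fun_prop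
@[fun_prop]
theorem named_snd {f : γ → NamedEdge} (hf : PolyFun f) : PolyFun fun c => (f c).snd := by
  unfold NamedEdge.snd; fun_prop
@[fun_prop]
theorem named_neg {f : γ → NamedEdge} (hf : PolyFun f) : PolyFun fun c => (f c).neg := by
  unfold NamedEdge.neg; fun_prop
@[fun_prop]
theorem named_num {f : γ → NamedEdge} (hf : PolyFun f) : PolyFun fun c => (f c).num := by
  unfold NamedEdge.num; fun_prop
@[fun_prop]
theorem named_den {f : γ → NamedEdge} (hf : PolyFun f) : PolyFun fun c => (f c).den := by
  unfold NamedEdge.den; fun_prop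
@[fun_prop]
theorem named_name {f : γ → NamedEdge} (hf : PolyFun f) : PolyFun fun c => (f c).name := by
  unfold NamedEdge.name; fun_prop
@[fun_prop]
theorem named_le {f g : γ → NamedEdge} (hf : PolyFun f) (hg : PolyFun g) :
    PolyFun fun c => (f c).le (g c) := by
  unfold NamedEdge.le; fun_prop

@[fun_prop]
theorem insertEdge {e : γ → NamedEdge} {l : γ → List NamedEdge} (he : PolyFun e) (hl : PolyFun l) :
    PolyFun fun c => TreePacking.insertEdge (e c) (l c) := by
  unfold TreePacking.insertEdge; fun_prop

@[fun_prop]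
theorem sortEdges {l : γ → List NamedEdge} (hl : PolyFun l) :
    PolyFun fun c => TreePacking.sortEdges (l c) := by
  unfold TreePacking.sortEdges
  refine foldr (step := fun _ e s => TreePacking.insertEdge e s) hl (by fun_prop) (by fun_prop)
    ⟨.X + 2, fun c s a => ?_⟩
  have h₁ := esize_filter_add (fun f : NamedEdge => f.le a) s
  have h₂ := esize_append (s.filter fun f => !f.le a) (a :: s.filter fun f => f.le a)
  rw [esize_cons] at h₂
  unfold TreePacking.insertEdge
  rw [Polynomial.eval_add, Polynomial.eval_X, Polynomial.eval_ofNat, esize_prod (c, a)]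
  simp only
  omega

@[fun_prop]
theorem mergeBlocks {l : γ → List (List ℕ)} {u v : γ → ℕ} (hl : PolyFun l) (hu : PolyFun u)
    (hv : PolyFun v) : PolyFun fun c => TreePacking.mergeBlocks (l c) (u c) (v c) := by
  unfold TreePacking.mergeBlocks; fun_prop

@[fun_prop]
theorem blocks {vs : γ → List ℕ} {es : γ → List NamedEdge} (hv : PolyFun vs) (he : PolyFun es) :
    PolyFun fun c => TreePacking.blocks (vs c) (es c) := by
  unfold TreePacking.blocks
  refine foldl (step := fun _ bs (e : NamedEdge) => TreePacking.mergeBlocks bs e.fst e.snd) he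
    (by fun_prop) (by fun_prop) ⟨2, fun c s a => ?_⟩
  have h₁ := esize_filter_add (fun b : List ℕ => b.contains a.fst || b.contains a.snd) s
  have h₂ := esize_flatten_le (s.filter fun b : List ℕ => b.contains a.fst || b.contains a.snd)
  unfold TreePacking.mergeBlocks
  rw [esize_cons, Polynomial.eval_ofNat]
  omega

@[fun_prop]
theorem feasible {k : γ → ℕ} {as ps : γ → List (List ℕ)} (hk : PolyFun k) (ha : PolyFun as)
    (hp : PolyFun ps) : PolyFun fun c => TreePacking.feasible (k c) (as c) (ps c) := by
  unfold TreePacking.feasible; fun_prop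

@[fun_prop]
theorem greedyStep {k : γ → ℕ} {vs : γ → List ℕ} {s : γ → List NamedEdge × List NamedEdge}
    {e : γ → NamedEdge} (hk : PolyFun k) (hv : PolyFun vs) (hs : PolyFun s) (he : PolyFun e) :
    PolyFun fun c => TreePacking.greedyStep (k c) (vs c) (s c) (e c) := by
  unfold TreePacking.greedyStep; fun_prop

@[fun_prop]
theorem greedy {k : γ → ℕ} {vs : γ → List ℕ} {es : γ → List NamedEdge} (hk : PolyFun k)
    (hv : PolyFun vs) (he : PolyFun es) : PolyFun fun c => TreePacking.greedy (k c) (vs c) (es c) := by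
  have h : PolyFun fun c => (TreePacking.sortEdges (es c)).foldl
      (TreePacking.greedyStep (k c) (vs c)) ([], es c) := by
    refine foldl (step := fun c s e => TreePacking.greedyStep (k c) (vs c) s e) (by fun_prop)
      (by fun_prop) (by fun_prop) ⟨.X + 1, fun c s e => ?_⟩
    have h₁ := esize_le_of_sublist
      (List.filter_sublist (l := s.2) (p := fun f => !decide (f.name = e.name)))
    rw [Polynomial.eval_add, Polynomial.eval_X, Polynomial.eval_one, esize_prod (c, e),
      esize_prod s]
    simp only
    -- Both outcomes obey the bound, so the test itself plays no role.
    have h₂ : ∀ b : Bool, esize (bif b then (e :: s.1, s.2)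
        else (s.1, s.2.filter fun f => !decide (f.name = e.name))) ≤
        esize s.1 + esize s.2 + 1 + (esize c + esize e + 1 + 1) := by
      intro b
      cases b
      · rw [cond_false, esize_prod]
        simp only
        omega
      · rw [cond_true, esize_prod, esize_cons]
        simp only
        omega
    exact h₂ _
  unfold TreePacking.greedy
  fun_prop

@[fun_prop]
theorem listTrees {vs : γ → List ℕ} {es : γ → List NamedEdge} (hv : PolyFun vs) (he : PolyFun es) :
    PolyFun fun c => TreePacking.listTrees (vs c) (es c) := by
  unfold TreePacking.listTrees; fun_prop

theorem solve : PolyFun fun I : Instance => TreePacking.solve I := by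
  have hk := instance_k
  have hn := instance_n
  have he := instance_edges
  unfold TreePacking.solve Instance.vertexList Instance.edgeList
  fun_prop

@[fun_prop]
theorem encodeNatSymbols {f : γ → ℕ} (hf : PolyFun f) :
    PolyFun fun c => TreePacking.encodeNat (f c) := by
  unfold TreePacking.encodeNat; fun_prop

@[fun_prop]
theorem encodeList {l : γ → List ℕ} (hl : PolyFun l) :
    PolyFun fun c => TreePacking.encodeList (l c) := by
  unfold TreePacking.encodeList; fun_prop

@[fun_prop]
theorem encodeOutput {o : γ → Output} (ho : PolyFun o) :
    PolyFun fun c => TreePacking.encodeOutput (o c) := by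
  unfold TreePacking.encodeOutput; fun_prop

end PolyFun

theorem solve_computableInPolyTime :
    Nonempty (Turing.TM2ComputableInPolyTime encodeInstance encodeOutput solve) :=
  PolyFun.computableInPolyTime (PolyFun.encodeOutput PolyFun.solve) fun _ => rfl

end TreePacking

namespace TreePacking

/-! ### Components and acyclic sets of edges -/

section Components

variable {α β : Type*} (ends : β → α × α)

/-- Two vertices are connected by a set of edges. -/
def Conn (F : Finset β) : α → α → Prop :=
  Relation.EqvGen fun x y => ∃ e ∈ F, ends e = (x, y)

variable {ends} {F F' : Finset β} {x y z : α}

theorem Conn.refl (F : Finset β) (x : α) : Conn ends F x x := Relation.EqvGen.refl x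
theorem Conn.symm (h : Conn ends F x y) : Conn ends F y x := Relation.EqvGen.symm _ _ h
theorem Conn.trans (h : Conn ends F x y) (h' : Conn ends F y z) : Conn ends F x z :=
  Relation.EqvGen.trans _ _ _ h h'

theorem Conn.edge {e : β} (he : e ∈ F) : Conn ends F (ends e).1 (ends e).2 := .rel _ _ ⟨e, he, rfl⟩

/-- `Conn` is the least equivalence relation that relates the ends of each edge. -/
theorem Conn.of_edges {r : α → α → Prop} (hr : Equivalence r)
    (h : ∀ e ∈ F, r (ends e).1 (ends e).2) (hxy : Conn ends F x y) : r x y := by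
  induction hxy with
  | rel x y h' =>
    obtain ⟨e, he, h'⟩ := h'
    have := h e he
    rwa [h'] at this
  | refl x => exact hr.refl x
  | symm x y _ ih => exact hr.symm ih
  | trans x y z _ _ ih ih' => exact hr.trans ih ih'

theorem conn_equivalence (F : Finset β) : Equivalence (Conn ends F) := ⟨.refl F, .symm, .trans⟩

theorem Conn.mono (hF : F ⊆ F') (h : Conn ends F x y) : Conn ends F' x y :=
  h.of_edges (conn_equivalence F') fun _ he => .edge (hF he)

theorem Conn.iff_of_closed {X : α → Prop} (hX : ∀ e ∈ F, X (ends e).1 ↔ X (ends e).2)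
    (h : Conn ends F x y) : X x ↔ X y :=
  h.of_edges (r := fun x y => X x ↔ X y) ⟨fun _ => Iff.rfl, Iff.symm, Iff.trans⟩ hX

open Classical in
variable (ends) in
/-- The vertex set of the component of a vertex. -/
noncomputable def component (V : Finset α) (F : Finset β) (x : α) : Finset α :=
  V.filter (Conn ends F x)

variable {V : Finset α} {k : ℕ}

theorem mem_component : y ∈ component ends V F x ↔ y ∈ V ∧ Conn ends F x y := by
  simp [component]

theorem component_congr (h : Conn ends F x y) : component ends V F x = component ends V F y := by
  ext z
  simp only [mem_component]
  exact and_congr_right fun _ => ⟨h.symm.trans, h.trans⟩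

/-- If a set of vertices is a union of components the orders of which are divisible by `k`, then
its order is divisible by `k`. -/
theorem dvd_card_of_closed {X : Finset α} (hXV : X ⊆ V)
    (hX : ∀ x ∈ X, ∀ y ∈ V, Conn ends F x y → y ∈ X)
    (hk : ∀ x ∈ X, k ∣ (component ends V F x).card) : k ∣ X.card := by
  classical
  induction X using Finset.strongInduction with
  | H X ih =>
    rcases X.eq_empty_or_nonempty with rfl | ⟨x, hx⟩
    · simp
    have hsub : component ends V F x ⊆ X := fun y hy =>
      hX x hx y (mem_component.1 hy).1 (mem_component.1 hy).2
    have hxc : x ∈ component ends V F x := mem_component.2 ⟨hXV hx, .refl F x⟩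
    rw [← Finset.card_sdiff_add_card_eq_card hsub]
    refine dvd_add (ih _ (Finset.sdiff_ssubset hsub ⟨x, hxc⟩) (Finset.sdiff_subset.trans hXV) ?_
      fun y hy => hk y (Finset.mem_sdiff.1 hy).1) (hk x hx)
    intro y hy z hz hyz
    rw [Finset.mem_sdiff] at hy ⊢
    refine ⟨hX y hy.1 z hz hyz, fun h => hy.2 (mem_component.2 ⟨hXV hy.1, ?_⟩)⟩
    exact (mem_component.1 h).2.trans hyz.symm

variable (ends V k) in
/-- No component has an order divisible by `k`. -/
def Good (F : Finset β) : Prop := ∀ x ∈ V, ¬ k ∣ (component ends V F x).card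

variable (ends V k) in
/-- Each component of `P` contains a component of `A` the order of which is not divisible by `k`. -/
def Extendable (A P : Finset β) : Prop :=
  ∀ x ∈ V, ∃ y ∈ V, Conn ends P x y ∧ ¬ k ∣ (component ends V A y).card

/-- The component of `x` in `F` is a union of components of `A`. If `k` divided all their orders, it
would divide the order of the union. The converse is not needed: the feasible sets come from
exchanges in a given optimum. -/
theorem Good.extendable {A P : Finset β} (h : Good ends V k F) (hA : A ⊆ F) (hP : F ⊆ P) :
    Extendable ends V k A P := by
  classical
  intro x hx
  by_contra! hcon
  refine h x hx (dvd_card_of_closed (ends := ends) (F := A) (V := V) (Finset.filter_subset _ _) ?_ ?_)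
  · intro y hy z hz hyz
    exact mem_component.2 ⟨hz, (mem_component.1 hy).2.trans (hyz.mono hA)⟩
  · intro y hy
    exact hcon y (mem_component.1 hy).1 ((mem_component.1 hy).2.mono hP)

theorem conn_empty : Conn ends (∅ : Finset β) x y ↔ x = y := by
  constructor
  · exact Conn.of_edges (r := fun x y => x = y) ⟨fun _ => rfl, Eq.symm, Eq.trans⟩ (by simp)
  · rintro rfl
    exact .refl _ _

/-! ### Forests and exchanges of edges -/

variable [DecidableEq β]

/-- A path needs the new edge at most once, in one of two directions. Formally, the right side is
already an equivalence relation that relates the ends of all edges. -/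
theorem conn_insert {e : β} : Conn ends (insert e F) x y ↔ Conn ends F x y ∨
    (Conn ends F x (ends e).1 ∧ Conn ends F (ends e).2 y) ∨
    (Conn ends F x (ends e).2 ∧ Conn ends F (ends e).1 y) := by
  constructor
  · refine Conn.of_edges (r := fun x y => Conn ends F x y ∨
      (Conn ends F x (ends e).1 ∧ Conn ends F (ends e).2 y) ∨
      (Conn ends F x (ends e).2 ∧ Conn ends F (ends e).1 y)) ⟨fun x => .inl (.refl F x), ?_, ?_⟩ ?_
    · rintro x y (h | ⟨h, h'⟩ | ⟨h, h'⟩)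
      · exact .inl h.symm
      · exact .inr (.inr ⟨h'.symm, h.symm⟩)
      · exact .inr (.inl ⟨h'.symm, h.symm⟩)
    · rintro x y z (h | ⟨h, h'⟩ | ⟨h, h'⟩) (k | ⟨k, k'⟩ | ⟨k, k'⟩)
      · exact .inl (h.trans k)
      · exact .inr (.inl ⟨h.trans k, k'⟩)
      · exact .inr (.inr ⟨h.trans k, k'⟩)
      · exact .inr (.inl ⟨h, h'.trans k⟩)
      · exact .inr (.inl ⟨h, k'⟩)
      · exact .inl (h.trans k')
      · exact .inr (.inr ⟨h, h'.trans k⟩)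
      · exact .inl (h.trans k')
      · exact .inr (.inr ⟨h, k'⟩)
    · intro f hf
      rcases Finset.mem_insert.1 hf with rfl | hf
      · exact .inr (.inl ⟨.refl F _, .refl F _⟩)
      · exact .inl (.edge hf)
  · have he : Conn ends (insert e F) (ends e).1 (ends e).2 := .edge (Finset.mem_insert_self e F)
    have hm := fun {x y} => Conn.mono (ends := ends) (x := x) (y := y) (Finset.subset_insert e F)
    rintro (h | ⟨h, h'⟩ | ⟨h, h'⟩)
    · exact hm h
    · exact (hm h).trans (he.trans (hm h'))
    · exact (hm h).trans (he.symm.trans (hm h'))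

variable (ends) in
/-- A set of edges is acyclic if the ends of each edge are not connected by the other edges. -/
def Acyc (F : Finset β) : Prop := ∀ e ∈ F, ¬ Conn ends (F.erase e) (ends e).1 (ends e).2

theorem Acyc.mono (h : Acyc ends F') (hF : F ⊆ F') : Acyc ends F := fun e he h' =>
  h e (hF he) (h'.mono (Finset.erase_subset_erase e hF))

/-- If an edge `f` of `F` lay on a cycle through `e`, then the rest of this cycle would connect the
ends of `e` in `F`. -/
theorem Acyc.insert {e : β} (h : Acyc ends F) (he : ¬ Conn ends F (ends e).1 (ends e).2) :
    Acyc ends (insert e F) := by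
  have heF : e ∉ F := fun h => he (.edge h)
  intro f hf
  rcases Finset.mem_insert.1 hf with rfl | hfF
  · rwa [Finset.erase_insert heF]
  · have hef : e ≠ f := fun h => heF (h ▸ hfF)
    rw [Finset.erase_insert_of_ne hef, conn_insert]
    have hm := fun {x y} => Conn.mono (ends := ends) (x := x) (y := y) (Finset.erase_subset f F)
    have hfc : Conn ends F (ends f).1 (ends f).2 := .edge hfF
    rintro (h' | ⟨h₁, h₂⟩ | ⟨h₁, h₂⟩)
    · exact h f hfF h'
    · exact he ((hm h₁).symm.trans (hfc.trans (hm h₂).symm))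
    · exact he ((hm h₂).trans (hfc.symm.trans (hm h₁)))

/-- If a property holds for a set, but not for some subset, then it is lost when a single element is
removed from some intermediate set. -/
theorem exists_erase {P : Finset β → Prop} {A : Finset β} (hAF : A ⊆ F) (hF : P F) (hA : ¬ P A) :
    ∃ Q f, A ⊆ Q.erase f ∧ Q ⊆ F ∧ f ∈ Q ∧ P Q ∧ ¬ P (Q.erase f) := by
  induction F using Finset.strongInduction with
  | H F ih =>
    have hne : A ≠ F := fun h => hA (h ▸ hF)
    obtain ⟨f, hfF, hfA⟩ := Finset.exists_of_ssubset (hAF.ssubset_of_ne hne)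
    have hA' : A ⊆ F.erase f := Finset.subset_erase.2 ⟨hAF, hfA⟩
    by_cases h : P (F.erase f)
    · obtain ⟨Q, g, h₁, h₂, h₃⟩ := ih _ (Finset.erase_ssubset hfF) hA' h
      exact ⟨Q, g, h₁, h₂.trans (Finset.erase_subset f F), h₃⟩
    · exact ⟨F, f, hA', subset_rfl, hfF, hF, h⟩

/-- If adding `e` to a forest `F` creates a cycle, then some edge of this cycle is not in the
acyclic set `A + e`, and exchanging it for `e` does not change the components. -/
theorem Acyc.exists_exchange {A : Finset β} {e : β} (hF : Acyc ends F)
    (hc : Conn ends F (ends e).1 (ends e).2) (hAF : A ⊆ F)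
    (hA : ¬ Conn ends A (ends e).1 (ends e).2) :
    ∃ f ∈ F, f ∉ A ∧ Acyc ends (Insert.insert e (F.erase f)) ∧
      ∀ x y, Conn ends (Insert.insert e (F.erase f)) x y ↔ Conn ends F x y := by
  -- Edges outside `A` are removed until the ends of `e` become separated. The edge `f` removed at
  -- that moment lies between them on their path in `F`, as `key` expresses for its two directions.
  obtain ⟨Q, f, hAQ, hQF, hfQ, hQ, hQf⟩ :=
    exists_erase (P := fun Q => Conn ends Q (ends e).1 (ends e).2) hAF hc hA
  have hfF := hQF hfQ
  have hf := hF f hfF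
  have hm := fun {x y} => Conn.mono (ends := ends) (x := x) (y := y) (Finset.erase_subset_erase f hQF)
  have key : (Conn ends (F.erase f) (ends e).1 (ends f).1 ∧
        Conn ends (F.erase f) (ends f).2 (ends e).2) ∨
      (Conn ends (F.erase f) (ends e).1 (ends f).2 ∧
        Conn ends (F.erase f) (ends f).1 (ends e).2) := by
    rw [← Finset.insert_erase hfQ, conn_insert] at hQ
    rcases hQ with h | ⟨h, h'⟩ | ⟨h, h'⟩
    · exact absurd h hQf
    · exact .inl ⟨hm h, hm h'⟩
    · exact .inr ⟨hm h, hm h'⟩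
  refine ⟨f, hfF, fun h => (Finset.mem_erase.1 (hAQ h)).1 rfl,
    (hF.mono (Finset.erase_subset f F)).insert fun h => hf ?_, fun x y => ?_⟩
  · rcases key with ⟨k, k'⟩ | ⟨k, k'⟩
    · exact k.symm.trans (h.trans k'.symm)
    · exact (k.symm.trans (h.trans k'.symm)).symm
  · have hF' : Conn ends F x y ↔ Conn ends (Insert.insert f (F.erase f)) x y := by
      rw [Finset.insert_erase hfF]
    rw [hF', conn_insert, conn_insert]
    have t := fun {x y z} => Conn.trans (ends := ends) (F := F.erase f) (x := x) (y := y) (z := z)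
    rcases key with ⟨k, k'⟩ | ⟨k, k'⟩
    · constructor
      · rintro (h | ⟨h, h'⟩ | ⟨h, h'⟩)
        · exact .inl h
        · exact .inr (.inl ⟨t h k, t k' h'⟩)
        · exact .inr (.inr ⟨t h k'.symm, t k.symm h'⟩)
      · rintro (h | ⟨h, h'⟩ | ⟨h, h'⟩)
        · exact .inl h
        · exact .inr (.inl ⟨t h k.symm, t k'.symm h'⟩)
        · exact .inr (.inr ⟨t h k', t k h'⟩)
    · constructor
      · rintro (h | ⟨h, h'⟩ | ⟨h, h'⟩)
        · exact .inl h
        · exact .inr (.inr ⟨t h k, t k' h'⟩)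
        · exact .inr (.inl ⟨t h k'.symm, t k.symm h'⟩)
      · rintro (h | ⟨h, h'⟩ | ⟨h, h'⟩)
        · exact .inl h
        · exact .inr (.inr ⟨t h k', t k h'⟩)
        · exact .inr (.inl ⟨t h k.symm, t k'.symm h'⟩)

theorem component_insert_of_not {e : β} (h₁ : ¬ Conn ends F x (ends e).1)
    (h₂ : ¬ Conn ends F x (ends e).2) :
    component ends V (insert e F) x = component ends V F x := by
  ext z
  simp only [mem_component, conn_insert, h₁, h₂, false_and, or_false]

theorem card_component_insert {e : β} (he : ¬ Conn ends F (ends e).1 (ends e).2)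
    (h : Conn ends F x (ends e).1 ∨ Conn ends F x (ends e).2) :
    (component ends V (insert e F) x).card =
      (component ends V F (ends e).1).card + (component ends V F (ends e).2).card := by
  classical
  rw [← Finset.card_union_of_disjoint]
  · congr 1
    ext z
    simp only [mem_component, Finset.mem_union, conn_insert, ← and_or_left]
    refine and_congr_right fun _ => ?_
    rcases h with h | h
    · have h' : ¬ Conn ends F x (ends e).2 := fun h' => he (h.symm.trans h')
      simp only [h, h', true_and, false_and, or_false]
      exact or_congr ⟨h.symm.trans, h.trans⟩ Iff.rfl
    · have h' : ¬ Conn ends F x (ends e).1 := fun h' => he (h'.symm.trans h)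
      simp only [h, h', true_and, false_and, false_or]
      rw [or_comm]
      exact or_congr Iff.rfl ⟨h.symm.trans, h.trans⟩
  · rw [Finset.disjoint_left]
    intro z h₁ h₂
    exact he ((mem_component.1 h₁).2.trans (mem_component.1 h₂).2.symm)

/-- Splitting off an edge of a forest changes the order of a component by the same amount, modulo
`k`, as it does in a subset the components of which have orders divisible by `k`. -/
theorem dvd_card_component_erase_iff {Q : Finset β} {a b : α} {f : β} (hQF : Q ⊆ F)
    (hab : ¬ Conn ends F a b)
    (hf : ∀ x y, Conn ends (insert f Q) x y → Conn ends Q x y ∨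
      (Conn ends Q x a ∧ Conn ends Q b y) ∨ (Conn ends Q x b ∧ Conn ends Q a y))
    (hk : ∀ x ∈ V, Conn ends F a x → k ∣ (component ends V (insert f Q) x).card) :
    k ∣ (component ends V F a).card ↔ k ∣ (component ends V Q a).card := by
  classical
  have hsub : component ends V Q a ⊆ component ends V F a := fun y hy =>
    mem_component.2 ⟨(mem_component.1 hy).1, (mem_component.1 hy).2.mono hQF⟩
  rw [← Finset.card_sdiff_add_card_eq_card hsub]
  -- The part of the `F`-component of `a` outside its `Q`-component is a union of components of
  -- `insert f Q`: leaving it through `f` would start from the `Q`-component of `a`, or from that of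
  -- `b`, which `F` does not connect to `a`. So its order is divisible by `k`.
  refine Nat.dvd_add_right (dvd_card_of_closed (ends := ends) (F := insert f Q) (V := V)
    (Finset.sdiff_subset.trans (Finset.filter_subset _ _)) ?_ ?_)
  · intro x hx y hy hxy
    simp only [Finset.mem_sdiff, mem_component, not_and] at hx ⊢
    obtain ⟨⟨hxV, hax⟩, hx⟩ := hx
    rcases hf x y hxy with h | ⟨h, -⟩ | ⟨h, -⟩
    · exact ⟨⟨hy, hax.trans (h.mono hQF)⟩, fun _ h' => hx hxV (h'.trans h.symm)⟩
    · exact absurd h.symm (hx hxV)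
    · exact absurd (hax.trans (h.mono hQF)) hab
  · intro x hx
    simp only [Finset.mem_sdiff, mem_component] at hx
    exact hk x hx.1.1 hx.1.2

/-- A forest all but one of whose components are good can be made good by adding or removing a
single edge. -/
theorem exists_exchange {A P H : Finset β} {z : α} (hV : ∀ e ∈ P, (ends e).1 ∈ V ∧ (ends e).2 ∈ V)
    (hAP : Extendable ends V k A P) (hAH : A ⊆ H) (hHP : H ⊆ P) (hH : Acyc ends H) (hz : z ∈ V)
    (hkz : k ∣ (component ends V H z).card)
    (hbad : ∀ x ∈ V, k ∣ (component ends V H x).card → Conn ends H z x) :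
    ∃ f ∈ P, f ∉ A ∧ ((f ∉ H ∧ Acyc ends (insert f H) ∧ Good ends V k (insert f H)) ∨
      (f ∈ H ∧ Good ends V k (H.erase f))) := by
  -- If no edge of `P` leaves the bad component, it has to be split; otherwise it is joined to
  -- another one.
  by_cases hclosed : ∀ e ∈ P, Conn ends H z (ends e).1 ↔ Conn ends H z (ends e).2
  · obtain ⟨y, hyV, hzy, hy⟩ := hAP z hz
    have hzy' : Conn ends H z y := (hzy.iff_of_closed hclosed).1 (.refl H z)
    -- Edges outside `A` are removed from `H` as long as all pieces of the bad component have order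
    -- divisible by `k`. This must fail at some `f`, because the bad component contains a component
    -- of `A` of another order.
    obtain ⟨Q, f, hAQ, hQH, hfQ, hQ, hQf⟩ := exists_erase
      (P := fun Q => ∀ x ∈ V, Conn ends H z x → k ∣ (component ends V Q x).card) hAH
      (fun x _ hx => by rwa [← component_congr hx]) (fun h => hy (h y hyV hzy'))
    have hfH := hQH hfQ
    have hfP := hHP hfH
    have hef := Finset.erase_subset_erase f hQH
    refine ⟨f, hfP, fun h => (Finset.mem_erase.1 (hAQ h)).1 rfl, .inr ⟨hfH, ?_⟩⟩
    have hnH := hH f hfH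
    have hnQ : ¬ Conn ends (Q.erase f) (ends f).1 (ends f).2 := fun h => hnH (h.mono hef)
    push Not at hQf
    obtain ⟨x, hxV, hzx, hx⟩ := hQf
    have hQi := Finset.insert_erase hfQ
    have hHi := Finset.insert_erase hfH
    have hxf : Conn ends (Q.erase f) x (ends f).1 ∨ Conn ends (Q.erase f) x (ends f).2 := by
      by_contra! hcon
      have := hQ x hxV hzx
      rw [← hQi, component_insert_of_not hcon.1 hcon.2] at this
      exact hx this
    have hHf : Conn ends H (ends f).1 (ends f).2 := .edge hfH
    have hm := fun {x y} => Conn.mono (ends := ends) (x := x) (y := y) ((Q.erase_subset f).trans hQH)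
    have hz₁ : Conn ends H z (ends f).1 := by
      rcases hxf with h | h
      · exact hzx.trans (hm h)
      · exact hzx.trans ((hm h).trans hHf.symm)
    have hz₂ := hz₁.trans hHf
    have hmH := fun {x y} => Conn.mono (ends := ends) (x := x) (y := y) (H.erase_subset f)
    -- Each of the two parts into which `f` splits the bad component of `H` consists of one of the
    -- two pieces at `f` in `Q.erase f` and of pieces of order divisible by `k`.
    have k₁ : k ∣ (component ends V (H.erase f) (ends f).1).card ↔
        k ∣ (component ends V (Q.erase f) (ends f).1).card :=
      dvd_card_component_erase_iff (f := f) hef hnH (fun x y h => conn_insert.1 h)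
        fun x hx h => by rw [hQi]; exact hQ x hx (hz₁.trans (hmH h))
    have k₂ : k ∣ (component ends V (H.erase f) (ends f).2).card ↔
        k ∣ (component ends V (Q.erase f) (ends f).2).card :=
      dvd_card_component_erase_iff (f := f) (b := (ends f).1) hef (fun h => hnH h.symm)
        (fun x y h => by have := conn_insert.1 h; tauto)
        fun x hx h => by rw [hQi]; exact hQ x hx (hz₂.trans (hmH h))
    have hsum := hQ _ (hV f hfP).1 hz₁
    rw [← hQi, card_component_insert hnQ (.inl (.refl _ _))] at hsum
    -- The orders of the two pieces add up to a multiple of `k`, so if `k` divided one it would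
    -- divide both, contrary to the choice of `f`.
    have hn₁ : ¬ k ∣ (component ends V (Q.erase f) (ends f).1).card := by
      intro h
      have h' := (Nat.dvd_add_right h).1 hsum
      rcases hxf with hxf | hxf
      · exact hx (by rwa [component_congr hxf])
      · exact hx (by rwa [component_congr hxf])
    have hn₂ : ¬ k ∣ (component ends V (Q.erase f) (ends f).2).card := fun h =>
      hn₁ ((Nat.dvd_add_left h).1 hsum)
    intro y hy hky
    by_cases h₁ : Conn ends (H.erase f) y (ends f).1
    · exact hn₁ (k₁.1 (by rwa [← component_congr h₁]))
    by_cases h₂ : Conn ends (H.erase f) y (ends f).2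
    · exact hn₂ (k₂.1 (by rwa [← component_congr h₂]))
    -- A component of `H.erase f` that avoids both ends of `f` is a component of `H`, and the only
    -- bad one of these contains `f`.
    have h₃ := hbad y hy (by rwa [← hHi, component_insert_of_not h₁ h₂])
    have h₄ := h₃.symm.trans hz₁
    rw [← hHi, conn_insert] at h₄
    tauto
  -- An edge of `P` that leaves the bad component leads to a good one. The order of their union is
  -- congruent to that of the good one modulo `k`.
  · push Not at hclosed
    obtain ⟨f, hfP, hf⟩ := hclosed
    have hfc : ¬ Conn ends H (ends f).1 (ends f).2 := fun h => by
      rcases hf with ⟨h₁, h₂⟩ | ⟨h₁, h₂⟩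
      · exact h₂ (h₁.trans h)
      · exact h₁ (h₂.trans h.symm)
    have hfH : f ∉ H := fun h => hfc (.edge h)
    refine ⟨f, hfP, fun h => hfH (hAH h), .inl ⟨hfH, hH.insert hfc, fun x hx hkx => ?_⟩⟩
    by_cases hxf : Conn ends H x (ends f).1 ∨ Conn ends H x (ends f).2
    · rw [card_component_insert hfc hxf] at hkx
      rcases hf with ⟨h₁, h₂⟩ | ⟨h₁, h₂⟩
      · rw [← component_congr h₁] at hkx
        exact h₂ (hbad _ (hV f hfP).2 ((Nat.dvd_add_right hkz).1 hkx))
      · rw [← component_congr h₂] at hkx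
        exact h₁ (hbad _ (hV f hfP).1 ((Nat.dvd_add_left hkz).1 hkx))
    · push Not at hxf
      rw [component_insert_of_not hxf.1 hxf.2] at hkx
      have := hbad x hx hkx
      rcases hf with ⟨h₁, h₂⟩ | ⟨h₁, h₂⟩
      · exact hxf.1 (this.symm.trans h₁)
      · exact hxf.2 (this.symm.trans h₂)

/-! ### Correctness of the greedy algorithm -/

variable (ends V k) in
/-- Acyclic subsets of `E` without components of order divisible by `k`. -/
def Feasible (E F : Finset β) : Prop := F ⊆ E ∧ Acyc ends F ∧ Good ends V k F

variable (ends V k) in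
/-- There is an optimum between `A` and `P`. -/
def HasOptimum (w : β → ℚ) (E A P : Finset β) : Prop :=
  ∃ F, A ⊆ F ∧ F ⊆ P ∧ Feasible ends V k E F ∧
    ∀ F', Feasible ends V k E F' → ∑ e ∈ F', w e ≤ ∑ e ∈ F, w e

variable {w : β → ℚ} {E A P : Finset β} {e : β}

/-- An optimum can be replaced by a set of at least the same weight. -/
theorem HasOptimum.of_le {F F' A' P' : Finset β} (hA : A' ⊆ F') (hP : F' ⊆ P')
    (hF' : Feasible ends V k E F')
    (hF : ∀ F', Feasible ends V k E F' → ∑ e ∈ F', w e ≤ ∑ e ∈ F, w e)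
    (h : ∑ e ∈ F, w e ≤ ∑ e ∈ F', w e) : HasOptimum ends V k w E A' P' :=
  ⟨F', hA, hP, hF', fun F₁ h₁ => (hF F₁ h₁).trans h⟩

/-- Adding `e` to the optimum `F` gains `w e`, and one repair outside `A` costs at most as much. If
`e` closes a cycle, an edge of the cycle is exchanged for it without changing the components.
Otherwise only the new component containing `e` can be bad, and `exists_exchange`, applied to `A +
e` and `P`, repairs it. -/
theorem HasOptimum.insert (h : HasOptimum ends V k w E A P) (hPE : P ⊆ E)
    (hV : ∀ e ∈ P, (ends e).1 ∈ V ∧ (ends e).2 ∈ V) (heP : e ∈ P)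
    (hmax : ∀ f ∈ P, f ∉ A → |w f| ≤ |w e|) (hw : 0 ≤ w e)
    (hc : ¬ Conn ends A (ends e).1 (ends e).2)
    (hext : Extendable ends V k (Insert.insert e A) P) :
    HasOptimum ends V k w E (Insert.insert e A) P := by
  obtain ⟨F, hAF, hFP, hF, hopt⟩ := h
  have hmax' : ∀ f ∈ P, f ∉ A → w f ≤ w e ∧ -w f ≤ w e := fun f hf hf' => by
    have := hmax f hf hf'
    rw [abs_of_nonneg hw, abs_le] at this
    exact ⟨this.2, by linarith [this.1]⟩
  by_cases heF : e ∈ F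
  · exact ⟨F, Finset.insert_subset heF hAF, hFP, hF, hopt⟩
  have hAi := Finset.insert_subset_insert e hAF
  have hiP := Finset.insert_subset heP hFP
  by_cases hcF : Conn ends F (ends e).1 (ends e).2
  · obtain ⟨f, hfF, hfA, hacyc, hconn⟩ := hF.2.1.exists_exchange hcF hAF hc
    have hsub : Insert.insert e (F.erase f) ⊆ P :=
      Finset.insert_subset heP ((F.erase_subset f).trans hFP)
    refine .of_le (F' := Insert.insert e (F.erase f)) ?_ hsub ⟨hsub.trans hPE, hacyc, ?_⟩ hopt ?_
    · exact Finset.insert_subset_insert e (Finset.subset_erase.2 ⟨hAF, hfA⟩)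
    · intro x hx
      have : component ends V (Insert.insert e (F.erase f)) x = component ends V F x := by
        ext y
        rw [mem_component, mem_component, hconn]
      rw [this]
      exact hF.2.2 x hx
    · rw [Finset.sum_insert fun h => heF (Finset.mem_of_mem_erase h),
        ← Finset.add_sum_erase F w hfF]
      linarith [(hmax' f (hFP hfF) hfA).1]
  · have hacyc := hF.2.1.insert hcF
    have hsum : ∑ g ∈ Insert.insert e F, w g = w e + ∑ g ∈ F, w g := Finset.sum_insert heF
    by_cases hgood : Good ends V k (Insert.insert e F)
    · exact .of_le hAi hiP ⟨hiP.trans hPE, hacyc, hgood⟩ hopt (by rw [hsum]; linarith)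
    have hbad : ∀ x ∈ V, k ∣ (component ends V (Insert.insert e F) x).card →
        Conn ends (Insert.insert e F) (ends e).1 x := by
      intro x hx hkx
      by_contra hcon
      rw [conn_insert] at hcon
      have h₁ : ¬ Conn ends F x (ends e).1 := fun h => hcon (.inl h.symm)
      have h₂ : ¬ Conn ends F x (ends e).2 := fun h => hcon (.inr (.inl ⟨.refl _ _, h.symm⟩))
      rw [component_insert_of_not h₁ h₂] at hkx
      exact hF.2.2 x hx hkx
    have hkz : k ∣ (component ends V (Insert.insert e F) (ends e).1).card := by
      unfold Good at hgood
      push Not at hgood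
      obtain ⟨x, hx, hkx⟩ := hgood
      rwa [component_congr (hbad x hx hkx)]
    obtain ⟨f, hfP, hfA, hf⟩ := exists_exchange hV hext hAi hiP hacyc (hV e heP).1 hkz hbad
    have hfA' : f ∉ A := fun h => hfA (Finset.mem_insert_of_mem h)
    have hfw := hmax' f hfP hfA'
    rcases hf with ⟨hfF, hacyc', hgood'⟩ | ⟨hfF, hgood'⟩
    · have hsub := Finset.insert_subset hfP hiP
      refine .of_le (hAi.trans (Finset.subset_insert _ _)) hsub
        ⟨hsub.trans hPE, hacyc', hgood'⟩ hopt ?_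
      rw [Finset.sum_insert hfF, hsum]
      linarith
    · have hsub := (Finset.erase_subset f _).trans hiP
      refine .of_le (Finset.subset_erase.2 ⟨hAi, hfA⟩) hsub
        ⟨hsub.trans hPE, hacyc.mono (Finset.erase_subset f _), hgood'⟩ hopt ?_
      have := Finset.add_sum_erase _ w hfF
      linarith

/-- A feasible set between `A` and `P` that contained `e` would contradict acyclicity or
`Good.extendable`. Hence the optimum itself avoids `e`. -/
theorem HasOptimum.erase_of_not (h : HasOptimum ends V k w E A P) (heA : e ∉ A)
    (hext : Conn ends A (ends e).1 (ends e).2 ∨ ¬ Extendable ends V k (Insert.insert e A) P) :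
    HasOptimum ends V k w E A (P.erase e) := by
  obtain ⟨F, hAF, hFP, hF, hopt⟩ := h
  refine ⟨F, hAF, Finset.subset_erase.2 ⟨hFP, fun heF => ?_⟩, hF, hopt⟩
  rcases hext with hc | hext
  · exact hF.2.1 e heF (hc.mono (Finset.subset_erase.2 ⟨hAF, heA⟩))
  · exact hext (hF.2.2.extendable (Finset.insert_subset heF hAF) hFP)

theorem HasOptimum.insert_of_not (h : HasOptimum ends V k w E A P)
    (hext : ¬ Extendable ends V k A (P.erase e)) :
    HasOptimum ends V k w E (Insert.insert e A) P := by
  obtain ⟨F, hAF, hFP, hF, hopt⟩ := h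
  refine ⟨F, Finset.insert_subset ?_ hAF, hFP, hF, hopt⟩
  by_contra heF
  exact hext (hF.2.2.extendable hAF (Finset.subset_erase.2 ⟨hFP, heF⟩))

/-- The counterpart of `HasOptimum.insert`. Removing `e` from `F` splits a good component into two
parts, of which at most one is bad, as `k` does not divide the sum of their orders. If one is,
`exists_exchange` is applied to `A` and `P - e`. -/
theorem HasOptimum.erase (h : HasOptimum ends V k w E A P) (hPE : P ⊆ E)
    (hV : ∀ e ∈ P, (ends e).1 ∈ V ∧ (ends e).2 ∈ V) (heP : e ∈ P) (heA : e ∉ A)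
    (hmax : ∀ f ∈ P, f ∉ A → |w f| ≤ |w e|) (hw : w e ≤ 0)
    (hext : Extendable ends V k A (P.erase e)) :
    HasOptimum ends V k w E A (P.erase e) := by
  obtain ⟨F, hAF, hFP, hF, hopt⟩ := h
  have hmax' : ∀ f ∈ P, f ∉ A → w f ≤ -w e ∧ -w f ≤ -w e := fun f hf hf' => by
    have := hmax f hf hf'
    rw [abs_of_nonpos hw, abs_le] at this
    exact ⟨this.2, by linarith [this.1]⟩
  by_cases heF : e ∉ F
  · exact ⟨F, hAF, Finset.subset_erase.2 ⟨hFP, heF⟩, hF, hopt⟩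
  push Not at heF
  have hAe : A ⊆ F.erase e := Finset.subset_erase.2 ⟨hAF, heA⟩
  have hFe := Finset.erase_subset_erase e hFP
  have hacyc := hF.2.1.mono (F.erase_subset e)
  have hsum := Finset.add_sum_erase F w heF
  have hPE' := (P.erase_subset e).trans hPE
  by_cases hgood : Good ends V k (F.erase e)
  · exact .of_le hAe hFe ⟨hFe.trans hPE', hacyc, hgood⟩ hopt (by linarith)
  unfold Good at hgood
  push Not at hgood
  obtain ⟨z, hz, hkz⟩ := hgood
  have hce := hF.2.1 e heF
  have hnear : ∀ x ∈ V, k ∣ (component ends V (F.erase e) x).card →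
      Conn ends (F.erase e) x (ends e).1 ∨ Conn ends (F.erase e) x (ends e).2 := by
    intro x hx hkx
    by_contra! hcon
    rw [← component_insert_of_not hcon.1 hcon.2, Finset.insert_erase heF] at hkx
    exact hF.2.2 x hx hkx
  have hnot : k ∣ (component ends V (F.erase e) (ends e).1).card →
      ¬ k ∣ (component ends V (F.erase e) (ends e).2).card := by
    intro h₁ h₂
    have h := dvd_add h₁ h₂
    rw [← card_component_insert hce (.inl (.refl _ _)), Finset.insert_erase heF] at h
    exact hF.2.2 _ (hV e heP).1 h
  have hbad : ∀ x ∈ V, k ∣ (component ends V (F.erase e) x).card → Conn ends (F.erase e) z x := by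
    intro x hx hkx
    rcases hnear x hx hkx with hx' | hx' <;> rcases hnear z hz hkz with hz' | hz'
    · exact hz'.trans hx'.symm
    · rw [component_congr hx'] at hkx
      rw [component_congr hz'] at hkz
      exact absurd hkz (hnot hkx)
    · rw [component_congr hx'] at hkx
      rw [component_congr hz'] at hkz
      exact absurd hkx (hnot hkz)
    · exact hz'.trans hx'.symm
  obtain ⟨f, hfP, hfA, hf⟩ := exists_exchange (fun f hf => hV f (Finset.mem_of_mem_erase hf)) hext
    hAe hFe hacyc hz hkz hbad
  have hfw := hmax' f (Finset.mem_of_mem_erase hfP) hfA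
  rcases hf with ⟨hfF, hacyc', hgood'⟩ | ⟨hfF, hgood'⟩
  · have hsub := Finset.insert_subset hfP hFe
    refine .of_le (hAe.trans (Finset.subset_insert _ _)) hsub
      ⟨hsub.trans hPE', hacyc', hgood'⟩ hopt ?_
    rw [Finset.sum_insert hfF]
    linarith
  · have hsub := (Finset.erase_subset f _).trans hFe
    refine .of_le (Finset.subset_erase.2 ⟨hAe, hfA⟩) hsub
      ⟨hsub.trans hPE', hacyc.mono (Finset.erase_subset f _), hgood'⟩ hopt ?_
    have := Finset.add_sum_erase _ w hfF
    linarith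

/-- The empty set is feasible, as its components are single vertices; so a maximum over the finitely
many feasible sets exists. -/
theorem hasOptimum_empty (hk : ¬ k ∣ 1) : HasOptimum ends V k w E ∅ E := by
  classical
  have hempty : Feasible ends V k E ∅ := by
    refine ⟨Finset.empty_subset E, fun e he => absurd he (Finset.notMem_empty e), fun x hx => ?_⟩
    have : component ends V (∅ : Finset β) x = {x} := by
      ext y
      rw [mem_component, Finset.mem_singleton, conn_empty, eq_comm (a := x)]
      exact ⟨fun h => h.2, fun h => ⟨h ▸ hx, h⟩⟩
    rwa [this, Finset.card_singleton]
  obtain ⟨F, hF, hmax⟩ := Finset.exists_max_image (E.powerset.filter (Feasible ends V k E))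
    (fun F => ∑ e ∈ F, w e) ⟨∅, by simpa using hempty⟩
  simp only [Finset.mem_filter, Finset.mem_powerset] at hF hmax
  exact ⟨F, Finset.empty_subset F, hF.1, hF.2, fun F' h => hmax F' ⟨h.1, h⟩⟩

end Components

end TreePacking

namespace TreePacking

/-! ### Partitions into components as lists -/

/-- The list `bs` consists of the vertex sets of the components. -/
structure IsPartition (ends : ℕ → ℕ × ℕ) (vs : List ℕ) (F : Finset ℕ) (bs : List (List ℕ)) :
    Prop where
  perm : bs.flatten.Perm vs
  mem_iff : ∀ b ∈ bs, ∀ x ∈ b, ∀ y, y ∈ b ↔ y ∈ vs ∧ Conn ends F x y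
  ne_nil : ∀ b ∈ bs, b ≠ []

/-- The names of a list of edges. -/
def names (es : List NamedEdge) : Finset ℕ := (es.map NamedEdge.name).toFinset

theorem mem_names {es : List NamedEdge} {i : ℕ} : i ∈ names es ↔ ∃ e ∈ es, e.name = i := by
  simp [names]

@[simp] theorem names_nil : names [] = ∅ := rfl

theorem names_cons (e : NamedEdge) (es : List NamedEdge) :
    names (e :: es) = insert e.name (names es) := by
  simp [names]

theorem names_filter (e : NamedEdge) (es : List NamedEdge) :
    names (es.filter fun f => !decide (f.name = e.name)) = (names es).erase e.name := by
  ext i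
  simp only [mem_names, List.mem_filter, Finset.mem_erase, Bool.not_eq_true', decide_eq_false_iff_not]
  constructor
  · rintro ⟨f, ⟨hf, hn⟩, rfl⟩
    exact ⟨hn, f, hf, rfl⟩
  · rintro ⟨hn, f, hf, rfl⟩
    exact ⟨f, ⟨hf, hn⟩, rfl⟩

/-- The data of a named edge agree with its ends, which are vertices. -/
def Matches (ends : ℕ → ℕ × ℕ) (vs : List ℕ) (e : NamedEdge) : Prop :=
  ends e.name = (e.fst, e.snd) ∧ e.fst ∈ vs ∧ e.snd ∈ vs

variable {ends : ℕ → ℕ × ℕ} {vs : List ℕ} {F : Finset ℕ} {bs : List (List ℕ)} {k : ℕ}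

namespace IsPartition

theorem exists_mem (h : IsPartition ends vs F bs) {x : ℕ} (hx : x ∈ vs) : ∃ b ∈ bs, x ∈ b :=
  List.mem_flatten.1 (h.perm.mem_iff.2 hx)

theorem mem_of_mem (h : IsPartition ends vs F bs) {b : List ℕ} (hb : b ∈ bs) {x : ℕ} (hx : x ∈ b) :
    x ∈ vs :=
  h.perm.mem_iff.1 (List.mem_flatten.2 ⟨b, hb, hx⟩)

theorem length_eq (h : IsPartition ends vs F bs) (hvs : vs.Nodup) {b : List ℕ} (hb : b ∈ bs)
    {x : ℕ} (hx : x ∈ b) : b.length = (component ends vs.toFinset F x).card := by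
  have hn : b.Nodup := (List.nodup_flatten.1 (h.perm.nodup_iff.2 hvs)).1 b hb
  rw [← List.toFinset_card_of_nodup hn]
  congr 1
  ext y
  rw [List.mem_toFinset, mem_component, List.mem_toFinset]
  exact h.mem_iff b hb x hx y

theorem singletons : IsPartition ends vs ∅ (vs.map fun v => [v]) where
  perm := by
    have : (vs.map fun v => [v]).flatten = vs := by
      induction vs with
      | nil => rfl
      | cons a l ih => simpa using ih
    rw [this]
  mem_iff := by
    intro b hb x hx y
    obtain ⟨v, hv, rfl⟩ := List.mem_map.1 hb
    obtain rfl := List.mem_singleton.1 hx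
    rw [conn_empty, List.mem_singleton]
    exact ⟨fun h => ⟨h ▸ hv, h.symm⟩, fun h => h.2.symm⟩
  ne_nil := by
    intro b hb
    obtain ⟨v, hv, rfl⟩ := List.mem_map.1 hb
    simp

theorem merge (h : IsPartition ends vs F bs) {e : NamedEdge} (he : Matches ends vs e) :
    IsPartition ends vs (insert e.name F) (mergeBlocks bs e.fst e.snd) := by
  obtain ⟨hends, hu, hv⟩ := he
  have hmem : ∀ x, x ∈ (bs.filter fun b => b.contains e.fst || b.contains e.snd).flatten ↔
      x ∈ vs ∧ (Conn ends F x e.fst ∨ Conn ends F x e.snd) := by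
    intro x
    simp only [List.mem_flatten, List.mem_filter, Bool.or_eq_true, List.contains_iff_mem]
    constructor
    · rintro ⟨b, ⟨hb, hb'⟩, hx⟩
      exact ⟨h.mem_of_mem hb hx, hb'.imp (fun h' => ((h.mem_iff b hb x hx _).1 h').2)
        fun h' => ((h.mem_iff b hb x hx _).1 h').2⟩
    · rintro ⟨hx, hx'⟩
      obtain ⟨b, hb, hxb⟩ := h.exists_mem hx
      exact ⟨b, ⟨hb, hx'.imp (fun h' => (h.mem_iff b hb x hxb _).2 ⟨hu, h'⟩)
        fun h' => (h.mem_iff b hb x hxb _).2 ⟨hv, h'⟩⟩, hxb⟩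
  refine ⟨?_, ?_, ?_⟩
  · have := List.filter_append_perm (fun b : List ℕ => b.contains e.fst || b.contains e.snd) bs
    have := this.flatten
    rw [List.flatten_append] at this
    exact this.trans h.perm
  · intro b hb x hx y
    rw [conn_insert, hends]
    rcases List.mem_cons.1 hb with rfl | hb
    · rw [hmem] at hx ⊢
      obtain ⟨hxV, hx⟩ := hx
      refine and_congr_right fun hy => ?_
      constructor
      · rintro (h₁ | h₁) <;> rcases hx with h₂ | h₂
        · exact .inl (h₂.trans h₁.symm)
        · exact .inr (.inr ⟨h₂, h₁.symm⟩)
        · exact .inr (.inl ⟨h₂, h₁.symm⟩)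
        · exact .inl (h₂.trans h₁.symm)
      · rintro (h₁ | h₁ | h₁)
        · exact hx.imp h₁.symm.trans h₁.symm.trans
        · exact .inr h₁.2.symm
        · exact .inl h₁.2.symm
    · simp only [List.mem_filter, Bool.not_eq_true', Bool.or_eq_false_iff] at hb
      obtain ⟨hb, hbu, hbv⟩ := hb
      have h₁ : ¬ Conn ends F x e.fst := fun h' => by
        have := (h.mem_iff b hb x hx _).2 ⟨hu, h'⟩
        simp [this] at hbu
      have h₂ : ¬ Conn ends F x e.snd := fun h' => by
        have := (h.mem_iff b hb x hx _).2 ⟨hv, h'⟩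
        simp [this] at hbv
      simp only [h₁, h₂, false_and, or_false]
      exact h.mem_iff b hb x hx y
  · intro b hb
    rcases List.mem_cons.1 hb with rfl | hb
    · exact List.ne_nil_of_mem ((hmem e.fst).2 ⟨hu, .inl (.refl _ _)⟩)
    · exact h.ne_nil b (List.mem_of_mem_filter hb)

theorem blocks {es : List NamedEdge} (hes : ∀ e ∈ es, Matches ends vs e) :
    IsPartition ends vs (names es) (TreePacking.blocks vs es) := by
  have key : ∀ (es : List NamedEdge) (F : Finset ℕ) (bs : List (List ℕ)),
      (∀ e ∈ es, Matches ends vs e) → IsPartition ends vs F bs →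
      IsPartition ends vs (F ∪ names es)
        (es.foldl (fun bs e => mergeBlocks bs e.fst e.snd) bs) := by
    intro es
    induction es with
    | nil => intro F bs _ h; simpa using h
    | cons e es ih =>
      intro F bs hes h
      have := ih (insert e.name F) _ (fun e he => hes e (List.mem_cons_of_mem _ he))
        (h.merge (hes e List.mem_cons_self))
      rwa [Finset.insert_union, ← Finset.union_insert, ← names_cons] at this
  have := key es ∅ _ hes singletons
  rwa [Finset.empty_union] at this

theorem any_contains (h : IsPartition ends vs F bs) {u v : ℕ} (hu : u ∈ vs) (hv : v ∈ vs) :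
    (bs.any fun b => b.contains u && b.contains v) = true ↔ Conn ends F u v := by
  simp only [List.any_eq_true, Bool.and_eq_true, List.contains_iff_mem]
  constructor
  · rintro ⟨b, hb, hub, hvb⟩
    exact ((h.mem_iff b hb u hub v).1 hvb).2
  · intro huv
    obtain ⟨b, hb, hub⟩ := h.exists_mem hu
    exact ⟨b, hb, hub, (h.mem_iff b hb u hub v).2 ⟨hv, huv⟩⟩

theorem feasible_iff {as ps : List (List ℕ)} {A P : Finset ℕ} (hvs : vs.Nodup)
    (ha : IsPartition ends vs A as) (hp : IsPartition ends vs P ps) :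
    feasible k as ps = true ↔ Extendable ends vs.toFinset k A P := by
  have hlen : ∀ a ∈ as, ∀ x ∈ a, (¬ lengthMod k a = 0) ↔
      ¬ k ∣ (component ends vs.toFinset A x).card := by
    intro a haas x hx
    rw [lengthMod_eq, ← ha.length_eq hvs haas hx, Nat.dvd_iff_mod_eq_zero]
  simp only [feasible, List.all_eq_true, List.any_eq_true, Bool.and_eq_true, Bool.not_eq_true',
    decide_eq_false_iff_not, List.contains_iff_mem]
  constructor
  · intro h x hx
    obtain ⟨p, hpp, hxp⟩ := hp.exists_mem (List.mem_toFinset.1 hx)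
    obtain ⟨a, haas, hka, y, hya, hyp⟩ := h p hpp
    have := (hp.mem_iff p hpp x hxp y).1 hyp
    exact ⟨y, List.mem_toFinset.2 this.1, this.2, (hlen a haas y hya).1 hka⟩
  · intro h p hpp
    obtain ⟨x, hx⟩ := List.exists_mem_of_ne_nil p (hp.ne_nil p hpp)
    obtain ⟨y, hyV, hxy, hy⟩ := h x (List.mem_toFinset.2 (hp.mem_of_mem hpp hx))
    rw [List.mem_toFinset] at hyV
    obtain ⟨a, haas, hya⟩ := ha.exists_mem hyV
    exact ⟨a, haas, (hlen a haas y hya).2 hy, y, hya, (hp.mem_iff p hpp x hx y).2 ⟨hyV, hxy⟩⟩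

end IsPartition

/-! ### Correctness of the algorithm on lists -/

theorem insertEdge_perm (e : NamedEdge) (l : List NamedEdge) : (insertEdge e l).Perm (e :: l) := by
  have h := List.filter_append_perm (fun f : NamedEdge => !f.le e) l
  simp only [Bool.not_not] at h
  exact List.perm_middle.trans (h.cons e)

theorem sortEdges_perm (l : List NamedEdge) : (sortEdges l).Perm l := by
  induction l with
  | nil => rfl
  | cons e l ih => exact (insertEdge_perm e _).trans (ih.cons e)

theorem sortEdges_pairwise {w : ℕ → ℚ} (l : List NamedEdge)
    (hw : ∀ e ∈ l, ∀ f ∈ l, e.le f = true ↔ |w e.name| ≤ |w f.name|) :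
    (sortEdges l).Pairwise fun e f => |w f.name| ≤ |w e.name| := by
  induction l with
  | nil => exact .nil
  | cons e l ih =>
    have ih := ih fun e he f hf => hw e (List.mem_cons_of_mem _ he) f (List.mem_cons_of_mem _ hf)
    have hmem : ∀ f ∈ sortEdges l, f.le e = true ↔ |w f.name| ≤ |w e.name| := fun f hf =>
      hw f (List.mem_cons_of_mem _ ((sortEdges_perm l).subset hf)) e List.mem_cons_self
    change (insertEdge e (sortEdges l)).Pairwise _
    have h₁ : ∀ f ∈ (sortEdges l).filter fun f => !f.le e, |w e.name| ≤ |w f.name| := by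
      intro f hf
      rw [List.mem_filter] at hf
      have := (hmem f hf.1).not.1 (by simpa using hf.2)
      exact (not_le.1 this).le
    have h₂ : ∀ f ∈ (sortEdges l).filter fun f => f.le e, |w f.name| ≤ |w e.name| := by
      intro f hf
      rw [List.mem_filter] at hf
      exact (hmem f hf.1).1 hf.2
    rw [insertEdge, List.pairwise_append]
    refine ⟨ih.filter _, List.pairwise_cons.2 ⟨h₂, ih.filter _⟩, fun f hf g hg => ?_⟩
    rcases List.mem_cons.1 hg with rfl | hg
    · exact h₁ f hf
    · exact (h₂ g hg).trans (h₁ f hf)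

/-- The induction keeps an optimum between the chosen edges and those not discarded, and the edges
still to be treated are exactly the difference of these sets, largest absolute weight first. The
sign of the weight and the outcome of the test select one of the four lemmas on `HasOptimum`. In the
end both sets coincide with the optimum. -/
theorem greedy_spec {w : ℕ → ℚ} {E : Finset ℕ} (hvs : vs.Nodup) (hk : ¬ k ∣ 1)
    (es : List NamedEdge) (hE : names es = E) (hes : ∀ e ∈ es, Matches ends vs e)
    (hnd : (es.map NamedEdge.name).Nodup)
    (hw : ∀ e ∈ es, ∀ f ∈ es, e.le f = true ↔ |w e.name| ≤ |w f.name|)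
    (hneg : ∀ e ∈ es, e.neg = true ↔ w e.name < 0) :
    (∀ e ∈ greedy k vs es, e ∈ es) ∧ Feasible ends vs.toFinset k E (names (greedy k vs es)) ∧
      ∀ F, Feasible ends vs.toFinset k E F → ∑ i ∈ F, w i ≤ ∑ i ∈ names (greedy k vs es), w i := by
  have key : ∀ (R : List NamedEdge) (s : List NamedEdge × List NamedEdge),
      (∀ e ∈ R, e ∈ es) → (R.map NamedEdge.name).Nodup →
      (R.Pairwise fun e f => |w f.name| ≤ |w e.name|) →
      (∀ e ∈ s.1, e ∈ es) → (∀ e ∈ s.2, e ∈ es) →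
      (∀ i, i ∈ names R ↔ i ∈ names s.2 ∧ i ∉ names s.1) →
      HasOptimum ends vs.toFinset k w E (names s.1) (names s.2) →
      (∀ e ∈ (R.foldl (greedyStep k vs) s).1, e ∈ es) ∧
      HasOptimum ends vs.toFinset k w E (names (R.foldl (greedyStep k vs) s).1)
        (names (R.foldl (greedyStep k vs) s).1) := by
    intro R
    induction R with
    | nil =>
      intro s _ _ _ h₁ _ h₂ h
      refine ⟨h₁, ?_⟩
      obtain ⟨F, hAF, hFP, hF⟩ := h
      have : names s.2 ⊆ names s.1 := by
        intro i hi
        by_contra h'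
        simpa using (h₂ i).2 ⟨hi, h'⟩
      exact ⟨F, hAF, hFP.trans this, hF⟩
    | cons e R ih =>
      intro s hR hRn hsort hA hP hrem hopt
      obtain ⟨A, P⟩ := s
      simp only at hA hP hrem hopt
      rw [List.map_cons, List.nodup_cons] at hRn
      rw [List.pairwise_cons] at hsort
      have heR : e.name ∉ names R := by simpa [names] using hRn.1
      obtain ⟨heP, heA⟩ := (hrem e.name).1 (by rw [names_cons]; exact Finset.mem_insert_self _ _)
      have hee : e ∈ es := hR e List.mem_cons_self
      obtain ⟨hends, hu, hv⟩ := hes e hee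
      have hPE : names P ⊆ E := by
        intro i hi
        obtain ⟨f, hf, rfl⟩ := mem_names.1 hi
        exact hE ▸ mem_names.2 ⟨f, hP f hf, rfl⟩
      have hV : ∀ i ∈ names P, (ends i).1 ∈ vs.toFinset ∧ (ends i).2 ∈ vs.toFinset := by
        intro i hi
        obtain ⟨f, hf, rfl⟩ := mem_names.1 hi
        obtain ⟨h₁, h₂, h₃⟩ := hes f (hP f hf)
        rw [h₁, List.mem_toFinset, List.mem_toFinset]
        exact ⟨h₂, h₃⟩
      have hmax : ∀ i ∈ names P, i ∉ names A → |w i| ≤ |w e.name| := by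
        intro i hi hi'
        obtain ⟨f, hf, rfl⟩ := mem_names.1 ((hrem i).2 ⟨hi, hi'⟩)
        rcases List.mem_cons.1 hf with rfl | hf
        · exact le_rfl
        · exact hsort.1 f hf
      have pA := IsPartition.blocks (vs := vs) (es := A) fun f hf => hes f (hA f hf)
      have pP := IsPartition.blocks (vs := vs) (es := P) fun f hf => hes f (hP f hf)
      have hA' : ∀ f ∈ e :: A, f ∈ es := List.forall_mem_cons.2 ⟨hee, hA⟩
      have hP' : ∀ f ∈ P.filter fun f => !decide (f.name = e.name), f ∈ es := fun f hf =>
        hP f (List.mem_of_mem_filter hf)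
      have pA' := IsPartition.blocks (vs := vs) (es := e :: A) fun f hf => hes f (hA' f hf)
      have pP' := IsPartition.blocks (vs := vs) (es := P.filter fun f => !decide (f.name = e.name))
        fun f hf => hes f (hP' f hf)
      rw [names_cons] at pA'
      rw [names_filter] at pP'
      have hR' : ∀ f ∈ R, f ∈ es := fun f hf => hR f (List.mem_cons_of_mem _ hf)
      have take : HasOptimum ends vs.toFinset k w E (insert e.name (names A)) (names P) →
          (∀ f ∈ (R.foldl (greedyStep k vs) (e :: A, P)).1, f ∈ es) ∧
          HasOptimum ends vs.toFinset k w E (names (R.foldl (greedyStep k vs) (e :: A, P)).1)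
            (names (R.foldl (greedyStep k vs) (e :: A, P)).1) := by
        intro h
        refine ih (e :: A, P) hR' hRn.2 hsort.2 hA' hP (fun i => ?_) (by rwa [names_cons])
        have := hrem i
        rw [names_cons, Finset.mem_insert] at this
        rw [names_cons, Finset.mem_insert]
        by_cases hi : i = e.name
        · subst hi; simp [heR]
        · simpa [hi] using this
      have leave : HasOptimum ends vs.toFinset k w E (names A) ((names P).erase e.name) →
          (∀ f ∈ (R.foldl (greedyStep k vs)
            (A, P.filter fun f => !decide (f.name = e.name))).1, f ∈ es) ∧
          HasOptimum ends vs.toFinset k w E (names (R.foldl (greedyStep k vs)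
            (A, P.filter fun f => !decide (f.name = e.name))).1)
            (names (R.foldl (greedyStep k vs) (A, P.filter fun f => !decide (f.name = e.name))).1) := by
        intro h
        refine ih (A, P.filter fun f => !decide (f.name = e.name)) hR' hRn.2 hsort.2 hA hP'
          (fun i => ?_) (by rwa [names_filter])
        have := hrem i
        rw [names_cons, Finset.mem_insert] at this
        rw [names_filter, Finset.mem_erase]
        by_cases hi : i = e.name
        · subst hi; simp [heR]
        · simpa [hi] using this
      rw [List.foldl_cons, greedyStep]
      simp only
      have hcond : ∀ b : Bool, (b = true → HasOptimum ends vs.toFinset k w E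
          (insert e.name (names A)) (names P)) → (b = false → HasOptimum ends vs.toFinset k w E
          (names A) ((names P).erase e.name)) →
          (∀ f ∈ (R.foldl (greedyStep k vs) (bif b then (e :: A, P) else
            (A, P.filter fun f => !decide (f.name = e.name)))).1, f ∈ es) ∧
          HasOptimum ends vs.toFinset k w E (names (R.foldl (greedyStep k vs) (bif b then (e :: A, P)
            else (A, P.filter fun f => !decide (f.name = e.name)))).1)
            (names (R.foldl (greedyStep k vs) (bif b then (e :: A, P) else
              (A, P.filter fun f => !decide (f.name = e.name)))).1) := by
        intro b h₁ h₂
        cases b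
        · exact leave (h₂ rfl)
        · exact take (h₁ rfl)
      apply hcond
      · intro h
        cases hen : e.neg with
        | true =>
          rw [hen, cond_true, Bool.not_eq_true', ← Bool.not_eq_true,
            IsPartition.feasible_iff hvs pA pP'] at h
          exact hopt.insert_of_not h
        | false =>
          rw [hen, cond_false, Bool.and_eq_true, Bool.not_eq_true', ← Bool.not_eq_true,
            pA.any_contains hu hv, IsPartition.feasible_iff hvs pA' pP] at h
          refine hopt.insert hPE hV heP hmax ?_ (by rw [hends]; exact h.1) h.2
          have := (hneg e hee).not.1 (by simp [hen])
          exact not_lt.1 this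
      · intro h
        rw [← Bool.not_eq_true] at h
        cases hen : e.neg with
        | true =>
          rw [hen, cond_true, Bool.not_eq_true', Bool.not_eq_false,
            IsPartition.feasible_iff hvs pA pP'] at h
          exact hopt.erase hPE hV heP heA hmax ((hneg e hee).1 hen).le h
        | false =>
          rw [hen, cond_false, Bool.and_eq_true, Bool.not_eq_true', ← Bool.not_eq_true,
            pA.any_contains hu hv, IsPartition.feasible_iff hvs pA' pP] at h
          refine hopt.erase_of_not heA ?_
          rw [hends]
          tauto
  have hperm := sortEdges_perm es
  obtain ⟨h₁, F, h₂, h₃, h₄, h₅⟩ := key (sortEdges es) ([], es) (fun e he => hperm.subset he)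
    ((hperm.map _).nodup_iff.2 hnd) (sortEdges_pairwise es hw) (by simp) (fun e he => he)
    (fun i => by
      rw [names_nil, mem_names, mem_names]
      simp only [hperm.mem_iff]
      simp) (by rw [names_nil, hE]; exact hasOptimum_empty hk)
  obtain rfl := h₃.antisymm h₂
  exact ⟨h₁, h₄, h₅⟩

end TreePacking

namespace TreePacking

/-! ### Packings of trees as sets of edges -/

/-- The ends of an edge of an instance. -/
def Instance.ends (I : Instance) (i : ℕ) : ℕ × ℕ :=
  (I.edges[i]?.map fun e => (e.fst, e.snd)).getD (0, 0)

theorem Instance.isLink_iff (I : Instance) {i x y : ℕ} : I.graph.IsLink i x y ↔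
    i < I.edges.length ∧ ((x, y) = I.ends i ∨ (y, x) = I.ends i) := by
  change (∃ e, I.edges[i]? = some e ∧ ((x = e.fst ∧ y = e.snd) ∨ (x = e.snd ∧ y = e.fst))) ↔ _
  constructor
  · rintro ⟨e, he, h⟩
    refine ⟨(List.getElem?_eq_some_iff.1 he).1, ?_⟩
    simp only [Instance.ends, he, Option.map_some, Option.getD_some, Prod.mk.injEq]
    tauto
  · rintro ⟨hi, h⟩
    refine ⟨I.edges[i], List.getElem?_eq_getElem hi, ?_⟩
    simp only [Instance.ends, List.getElem?_eq_getElem hi, Option.map_some, Option.getD_some,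
      Prod.mk.injEq] at h
    tauto

theorem Instance.conn_of_isLink (I : Instance) {F : Finset ℕ} {i x y : ℕ} (hi : i ∈ F)
    (h : I.graph.IsLink i x y) : Conn I.ends F x y := by
  have hc : Conn I.ends F (I.ends i).1 (I.ends i).2 := .edge hi
  rcases (I.isLink_iff.1 h).2 with e | e
  · rw [← e] at hc; exact hc
  · rw [← e] at hc; exact hc.symm

theorem Instance.mem_edgeSet (I : Instance) {i : ℕ} :
    i ∈ I.graph.edgeSet ↔ i < I.edges.length := by
  rw [Graph.edge_mem_iff_exists_isLink]
  simp only [I.isLink_iff]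
  exact ⟨fun ⟨_, _, h, _⟩ => h, fun h => ⟨_, _, h, .inl rfl⟩⟩

theorem Instance.isLink_ends {I : Instance} {t : Graph ℕ ℕ} (ht : t ≤ I.graph) {i : ℕ}
    (hi : i ∈ t.edgeSet) : t.IsLink i (I.ends i).1 (I.ends i).2 := by
  obtain ⟨x, y, h⟩ := Graph.exists_isLink_of_mem_edgeSet hi
  rcases (I.isLink_iff.1 (h.mono ht)).2 with e | e
  · rw [← e]; exact h
  · rw [← e]; exact h.symm

/-- If the ends of an edge are connected by the other edges, then there is a cycle. -/
theorem hasCycle_of_reachable {α β : Type*} {G : Graph α β} {i : β} {x y : α}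
    (h : G.IsLink i x y)
    (hxy : (SimpleGraph.fromRel fun a b => ∃ j ≠ i, G.IsLink j a b).Reachable y x) :
    HasCycle G := by
  classical
  -- A path has distinct vertices; the edge `i` from its end `x` back to its start `y` closes the
  -- cycle. Loops and parallel edges are the cases of lengths 0 and 1.
  obtain ⟨p, hp⟩ := hxy.exists_isPath
  have hadj : ∀ j < p.length, ∃ e ≠ i, G.IsLink e (p.getVert j) (p.getVert (j + 1)) := by
    intro j hj
    rcases ((SimpleGraph.fromRel_adj _ _ _).1 (p.adj_getVert_succ hj)).2 with h | ⟨e, he, h⟩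
    · exact h
    · exact ⟨e, he, h.symm⟩
  choose f hfi hf using hadj
  have hinj : ∀ a b, a ≤ p.length → b ≤ p.length → p.getVert a = p.getVert b → a = b :=
    fun a b ha hb hab => hp.getVert_injOn ha hb hab
  refine ⟨p.length + 1, inferInstance, fun j => p.getVert j,
    fun j => if hj : j.1 < p.length then f j hj else i, ?_, ?_, ?_⟩
  · intro a b hab
    exact Fin.ext (hinj a b (Nat.lt_succ_iff.1 a.2) (Nat.lt_succ_iff.1 b.2) hab)
  · intro a b hab
    simp only at hab
    split_ifs at hab with ha hb hb
    · have h₁ := hf a ha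
      have h₂ := hf b hb
      rw [hab] at h₁
      -- Equal edges have equal ends, hence occur at the same position or in opposite directions;
      -- the latter would give `a = b + 1` and `b = a + 1`.
      rcases h₁.eq_and_eq_or_eq_and_eq h₂ with ⟨e, -⟩ | ⟨e, e'⟩
      · exact Fin.ext (hinj a b ha.le hb.le e)
      · have := hinj a (b + 1) ha.le hb e
        have := hinj (a + 1) b ha hb.le e'
        omega
    · exact absurd hab (hfi _ _)
    · exact absurd hab.symm (hfi _ _)
    · exact Fin.ext (by have := a.2; have := b.2; omega)
  · intro j
    by_cases hj : j.1 < p.length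
    · have : ((j + 1 : Fin (p.length + 1)) : ℕ) = j + 1 := by
        rw [Fin.val_add_one_of_lt (by rw [Fin.lt_def]; simpa using hj)]
      simp only [hj, dif_pos, this]
      exact hf j hj
    · obtain rfl : j = Fin.last _ := Fin.ext (by have := j.2; simp; omega)
      simpa using h

/-! ### From packings to feasible sets of edges -/

section Packing

variable {I : Instance} {T : List (Graph ℕ ℕ)}

open Classical in
/-- The edges of the members of a family of subgraphs. -/
noncomputable def Instance.edgesOf (I : Instance) (T : List (Graph ℕ ℕ)) : Finset ℕ :=
  (Finset.range I.edges.length).filter fun i => ∃ t ∈ T, i ∈ t.edgeSet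

theorem Instance.mem_edgesOf (hT : ∀ t ∈ T, t ≤ I.graph) {i : ℕ} :
    i ∈ I.edgesOf T ↔ ∃ t ∈ T, i ∈ t.edgeSet := by
  simp only [edgesOf, Finset.mem_filter, Finset.mem_range, and_iff_right_iff_imp]
  rintro ⟨t, ht, hi⟩
  exact I.mem_edgeSet.1 (Graph.IsSubgraph.edgeSet_mono (hT t ht) hi)

/-- Vertex-disjoint subgraphs have no common edge, so no weight is counted twice. -/
theorem Instance.totalWeight_eq (hT : ∀ t ∈ T, t ≤ I.graph)
    (hd : T.Pairwise fun s t => Disjoint s.vertexSet t.vertexSet) :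
    I.totalWeight T = ∑ i ∈ I.edgesOf T, I.weight i := by
  classical
  induction T with
  | nil => simp [totalWeight, edgesOf]
  | cons t T ih =>
    rw [List.pairwise_cons] at hd
    have hT' : ∀ s ∈ T, s ≤ I.graph := fun s hs => hT s (List.mem_cons_of_mem _ hs)
    have e : I.edgesOf (t :: T) = I.edgesOf [t] ∪ I.edgesOf T := by
      ext i
      simp only [edgesOf, Finset.mem_union, Finset.mem_filter, List.mem_cons, List.not_mem_nil,
        or_false, exists_eq_or_imp, exists_eq_left]
      simp only [and_or_left]
    have ht : ∀ s ∈ [t], s ≤ I.graph := by simpa using hT t List.mem_cons_self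
    have h₁ : Disjoint (I.edgesOf [t]) (I.edgesOf T) := by
      rw [Finset.disjoint_left]
      intro i hi hi'
      obtain ⟨s, hs, his⟩ := (mem_edgesOf hT').1 hi'
      have hit : i ∈ t.edgeSet := by simpa using (mem_edgesOf ht).1 hi
      exact Set.disjoint_left.1 (hd.1 s hs) (isLink_ends (hT t List.mem_cons_self) hit).left_mem
        (isLink_ends (hT' s hs) his).left_mem
    have h₂ : t.edgeSet = (I.edgesOf [t] : Set ℕ) := by
      ext i
      rw [Finset.mem_coe, mem_edgesOf ht]
      simp
    rw [e, Finset.sum_union h₁, ← ih hT' hd.2, totalWeight, List.map_cons, List.sum_cons, h₂,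
      finsum_mem_coe_finset]
    rfl

/-- A tree of a packing is a union of components, restricted to its edges. -/
theorem Instance.IsPacking.mem_vertexSet_iff (hT : I.IsPacking T) {t : Graph ℕ ℕ} (ht : t ∈ T)
    {i : ℕ} (hi : i ∈ I.edgesOf T) :
    ((I.ends i).1 ∈ t.vertexSet ↔ i ∈ t.edgeSet) ∧ ((I.ends i).2 ∈ t.vertexSet ↔ i ∈ t.edgeSet) := by
  obtain ⟨s, hs, his⟩ := (mem_edgesOf fun t ht => (hT.1 t ht).1).1 hi
  have hls := isLink_ends (hT.1 s hs).1 his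
  by_cases hst : s = t
  · subst hst
    simp [his, hls.left_mem, hls.right_mem]
  · have : Std.Symm fun s t : Graph ℕ ℕ => Disjoint s.vertexSet t.vertexSet := ⟨fun _ _ h => h.symm⟩
    have hd : Disjoint s.vertexSet t.vertexSet := hT.2.forall hs ht hst
    have h₁ : (I.ends i).1 ∉ t.vertexSet := Set.disjoint_left.1 hd hls.left_mem
    have h₂ : (I.ends i).2 ∉ t.vertexSet := Set.disjoint_left.1 hd hls.right_mem
    have h₃ : i ∉ t.edgeSet := fun h => h₁ (isLink_ends (hT.1 t ht).1 h).left_mem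
    simp [h₁, h₂, h₃]

/-- No edge of the packing leaves the vertex set of `t`, and within it the connectedness of `t`
applies. -/
theorem Instance.IsPacking.conn_iff (hT : I.IsPacking T) {t : Graph ℕ ℕ} (ht : t ∈ T) {x y : ℕ}
    (hx : x ∈ t.vertexSet) : Conn I.ends (I.edgesOf T) x y ↔ y ∈ t.vertexSet := by
  constructor
  · intro h
    exact (h.iff_of_closed (X := fun v => v ∈ t.vertexSet) fun i hi =>
      (hT.mem_vertexSet_iff ht hi).1.trans (hT.mem_vertexSet_iff ht hi).2.symm).1 hx
  · intro hy
    have h := (hT.1 t ht).2.1.1.2 x hx y hy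
    induction h with
    | refl => exact .refl _ _
    | tail h h' ih =>
      obtain ⟨i, hi⟩ := h'
      have hiF : i ∈ I.edgesOf T := (mem_edgesOf fun t ht => (hT.1 t ht).1).2 ⟨t, ht, hi.edge_mem⟩
      exact (ih hi.left_mem).trans (I.conn_of_isLink hiF (hi.mono (hT.1 t ht).1))

/-- The edge set of a packing is feasible. -/
theorem Instance.IsPacking.feasible (hT : I.IsPacking T) :
    Feasible I.ends (List.range I.n).toFinset I.k (Finset.range I.edges.length) (I.edgesOf T) := by
  classical
  have hsub : ∀ t ∈ T, t ≤ I.graph := fun t ht => (hT.1 t ht).1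
  refine ⟨Finset.filter_subset _ _, ?_, ?_⟩
  · intro i hi hc
    obtain ⟨t, ht, hit⟩ := (mem_edgesOf hsub).1 hi
    have hl := isLink_ends (hsub t ht) hit
    refine (hT.1 t ht).2.1.2 (hasCycle_of_reachable hl ?_)
    -- A connection by other edges of the packing that starts in `t` stays in `t`. The relation
    -- records this together with reachability inside `t`.
    refine SimpleGraph.Reachable.symm ((hc.of_edges (r := fun a b =>
      (a ∈ t.vertexSet ↔ b ∈ t.vertexSet) ∧ (a ∈ t.vertexSet →
        (SimpleGraph.fromRel fun a b => ∃ j ≠ i, t.IsLink j a b).Reachable a b)) ?_ ?_).2 hl.left_mem)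
    · exact ⟨fun a => ⟨Iff.rfl, fun _ => .refl a⟩,
        fun h => ⟨h.1.symm, fun ha => (h.2 (h.1.2 ha)).symm⟩,
        fun h h' => ⟨h.1.trans h'.1, fun ha => (h.2 ha).trans (h'.2 (h.1.1 ha))⟩⟩
    · intro j hj
      rw [Finset.mem_erase] at hj
      obtain ⟨h₁, h₂⟩ := hT.mem_vertexSet_iff ht hj.2
      refine ⟨h₁.trans h₂.symm, fun h => ?_⟩
      have hlj := isLink_ends (hsub t ht) (h₁.1 h)
      -- Loops are treated separately, as `SimpleGraph.fromRel` has none.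
      by_cases he : (I.ends j).1 = (I.ends j).2
      · rw [he]
      · exact SimpleGraph.Adj.reachable ((SimpleGraph.fromRel_adj _ _ _).2
          ⟨he, .inl ⟨j, hj.1, hlj⟩⟩)
  · intro x hx
    by_cases hxt : ∃ t ∈ T, x ∈ t.vertexSet
    · obtain ⟨t, ht, hxt⟩ := hxt
      have e : t.vertexSet = (component I.ends (List.range I.n).toFinset (I.edgesOf T) x : Set ℕ) := by
        ext y
        rw [Finset.mem_coe, mem_component, hT.conn_iff ht hxt]
        refine ⟨fun h => ⟨?_, h⟩, fun h => h.2⟩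
        have h' : y < I.n := (hsub t ht).1 h
        simpa using h'
      have := (hT.1 t ht).2.2
      rwa [e, Set.ncard_coe_finset, Nat.modEq_zero_iff_dvd] at this
    -- A vertex outside all trees is a component of order 1, which is not divisible by `k`.
    · push Not at hxt
      have e : component I.ends (List.range I.n).toFinset (I.edgesOf T) x = {x} := by
        ext y
        rw [mem_component, Finset.mem_singleton]
        constructor
        · rintro ⟨-, h⟩
          refine (h.iff_of_closed (X := fun v => v = x) fun i hi => ?_).1 rfl
          obtain ⟨t, ht, hit⟩ := (mem_edgesOf hsub).1 hi
          have hl := isLink_ends (hsub t ht) hit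
          exact iff_of_false (fun h => hxt t ht (h ▸ hl.left_mem))
            fun h => hxt t ht (h ▸ hl.right_mem)
        · rintro rfl
          exact ⟨hx, .refl _ _⟩
      rw [e, Finset.card_singleton, Nat.dvd_one]
      have := I.two_le_k
      omega

end Packing

end TreePacking

namespace TreePacking

/-! ### The packing formed by the components of a feasible set of edges -/

/-- The graph with vertices `b` whose edges are the members of `A` between these vertices. -/
def Instance.subgraph (I : Instance) (A : Finset ℕ) (b : List ℕ) : Graph ℕ ℕ where
  vertexSet := {x | x ∈ b}
  IsLink i x y := I.graph.IsLink i x y ∧ i ∈ A ∧ x ∈ b ∧ y ∈ b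
  isLink_symm := fun _ _ => ⟨fun _ _ h => ⟨h.1.symm, h.2.1, h.2.2.2, h.2.2.1⟩⟩
  eq_or_eq_of_isLink_of_isLink := fun _ _ _ _ _ h h' => h.1.left_eq_or_eq h'.1
  left_mem_of_isLink := fun _ _ _ h => h.2.2.1

section Subgraph

variable {I : Instance} {A : Finset ℕ} {bs : List (List ℕ)} {b : List ℕ}

theorem Instance.subgraph_le (hb : ∀ x ∈ b, x < I.n) : I.subgraph A b ≤ I.graph :=
  ⟨hb, fun _ _ _ h => h.1⟩

theorem Instance.ends_mem {i : ℕ} (hi : i < I.edges.length) :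
    (I.ends i).1 ∈ List.range I.n ∧ (I.ends i).2 ∈ List.range I.n := by
  have := I.ends_lt _ (List.getElem_mem hi)
  simpa [Instance.ends, List.getElem?_eq_getElem hi] using this

theorem Instance.ends_mem_iff (hA : A ⊆ Finset.range I.edges.length)
    (hp : IsPartition I.ends (List.range I.n) A bs) (hb : b ∈ bs) {i : ℕ} (hi : i ∈ A) :
    (I.ends i).1 ∈ b ↔ (I.ends i).2 ∈ b := by
  obtain ⟨h₁, h₂⟩ := I.ends_mem (Finset.mem_range.1 (hA hi))
  have hc : Conn I.ends A (I.ends i).1 (I.ends i).2 := .edge hi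
  exact ⟨fun h => (hp.mem_iff b hb _ h _).2 ⟨h₂, hc⟩,
    fun h => (hp.mem_iff b hb _ h _).2 ⟨h₁, hc.symm⟩⟩

theorem Instance.mem_edgeSet_subgraph (hA : A ⊆ Finset.range I.edges.length)
    (hp : IsPartition I.ends (List.range I.n) A bs) (hb : b ∈ bs) {i : ℕ} :
    i ∈ (I.subgraph A b).edgeSet ↔ i ∈ A ∧ (I.ends i).1 ∈ b := by
  rw [Graph.edge_mem_iff_exists_isLink]
  constructor
  · rintro ⟨x, y, h, hi, hx, hy⟩
    refine ⟨hi, ?_⟩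
    rcases (I.isLink_iff.1 h).2 with e | e
    · rwa [← e]
    · rwa [← e]
  · rintro ⟨hi, h⟩
    exact ⟨_, _, I.isLink_iff.2 ⟨Finset.mem_range.1 (hA hi), .inl rfl⟩, hi, h,
      (I.ends_mem_iff hA hp hb hi).1 h⟩

theorem Instance.isConnected_subgraph (hA : A ⊆ Finset.range I.edges.length)
    (hp : IsPartition I.ends (List.range I.n) A bs) (hb : b ∈ bs) :
    IsConnected (I.subgraph A b) := by
  refine ⟨List.exists_mem_of_ne_nil b (hp.ne_nil b hb), fun x hx y hy => ?_⟩
  have hs : ∀ {x y}, Relation.ReflTransGen (I.subgraph A b).Adj x y →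
      Relation.ReflTransGen (I.subgraph A b).Adj y x := by
    intro x y h
    induction h with
    | refl => exact .refl
    | tail _ h ih => exact .head h.symm ih
  refine (((hp.mem_iff b hb x hx y).1 hy).2.of_edges (r := fun x y => (x ∈ b ↔ y ∈ b) ∧
    (x ∈ b → Relation.ReflTransGen (I.subgraph A b).Adj x y)) ?_ fun i hi => ?_).2 hx
  · exact ⟨fun x => ⟨Iff.rfl, fun _ => .refl⟩,
      fun h => ⟨h.1.symm, fun hy => hs (h.2 (h.1.2 hy))⟩,
      fun h h' => ⟨h.1.trans h'.1, fun hx => (h.2 hx).trans (h'.2 (h.1.1 hx))⟩⟩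
  · have := I.ends_mem_iff hA hp hb hi
    exact ⟨this, fun h => .single
      ⟨i, I.isLink_iff.2 ⟨Finset.mem_range.1 (hA hi), .inl rfl⟩, hi, h, this.1 h⟩⟩

/-- The edges of a cycle other than `e 0` connect `v 1` with `v 0`, the ends of `e 0`. With
`Fin.ofNat`, the index `ℓ` leads back to `0`, which also covers loops. -/
theorem Instance.not_hasCycle_subgraph (h : Acyc I.ends A) : ¬ HasCycle (I.subgraph A b) := by
  rintro ⟨ℓ, hℓ, v, e, -, he, hl⟩
  have hpos := Nat.pos_of_neZero ℓ
  have key : ∀ j, 1 ≤ j → j ≤ ℓ → Conn I.ends (A.erase (e 0)) (v (0 + 1)) (v (Fin.ofNat ℓ j)) := by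
    intro j hj
    induction j, hj using Nat.le_induction with
    | base =>
      intro _
      rw [zero_add]
      exact .refl _ _
    | succ j hj ih =>
      intro hjℓ
      have hne : e (Fin.ofNat ℓ j) ≠ e 0 := by
        intro h'
        have := congrArg Fin.val (he h')
        simp only [Fin.val_ofNat, Fin.val_zero, Nat.mod_eq_of_lt hjℓ] at this
        omega
      have hs : Fin.ofNat ℓ j + 1 = Fin.ofNat ℓ (j + 1) := by
        ext
        simp [Fin.val_add]
      refine (ih (by omega)).trans ?_
      rw [← hs]
      exact I.conn_of_isLink (Finset.mem_erase.2 ⟨hne, (hl _).2.1⟩) (hl _).1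
  have h₀ := key ℓ hpos le_rfl
  have : Fin.ofNat ℓ ℓ = 0 := by ext; simp
  rw [this] at h₀
  have hc := h (e 0) (hl 0).2.1
  rcases (I.isLink_iff.1 (hl 0).1).2 with h' | h'
  · rw [← h'] at hc
    exact hc h₀.symm
  · rw [← h'] at hc
    exact hc h₀

theorem Instance.isPacking_subgraph
    (hF : Feasible I.ends (List.range I.n).toFinset I.k (Finset.range I.edges.length) A)
    (hp : IsPartition I.ends (List.range I.n) A bs) : I.IsPacking (bs.map (I.subgraph A)) := by
  constructor
  · intro t ht
    obtain ⟨b, hb, rfl⟩ := List.mem_map.1 ht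
    have hlt : ∀ x ∈ b, x < I.n := fun x hx => List.mem_range.1 (hp.mem_of_mem hb hx)
    refine ⟨subgraph_le hlt, ⟨I.isConnected_subgraph hF.1 hp hb, I.not_hasCycle_subgraph hF.2.1⟩, ?_⟩
    obtain ⟨x, hx⟩ := List.exists_mem_of_ne_nil b (hp.ne_nil b hb)
    have e : (I.subgraph A b).vertexSet =
        (component I.ends (List.range I.n).toFinset A x : Set ℕ) := by
      ext y
      rw [Finset.mem_coe, mem_component, List.mem_toFinset]
      exact hp.mem_iff b hb x hx y
    rw [e, Set.ncard_coe_finset, Nat.modEq_zero_iff_dvd]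
    exact hF.2.2 x (List.mem_toFinset.2 (hp.mem_of_mem hb hx))
  · have hnd : bs.flatten.Nodup := hp.perm.nodup_iff.2 List.nodup_range
    rw [List.pairwise_map]
    refine (List.nodup_flatten.1 hnd).2.imp fun {b c} h => ?_
    exact Set.disjoint_left.2 fun x hx hx' => h hx hx'

theorem Instance.edgesOf_subgraph (hA : A ⊆ Finset.range I.edges.length)
    (hp : IsPartition I.ends (List.range I.n) A bs) : I.edgesOf (bs.map (I.subgraph A)) = A := by
  ext i
  simp only [edgesOf, Finset.mem_filter]
  constructor
  · rintro ⟨-, t, ht, hi⟩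
    obtain ⟨b, hb, rfl⟩ := List.mem_map.1 ht
    exact ((I.mem_edgeSet_subgraph hA hp hb).1 hi).1
  · intro hi
    obtain ⟨b, hb, hx⟩ := hp.exists_mem (I.ends_mem (Finset.mem_range.1 (hA hi))).1
    exact ⟨hA hi, _, List.mem_map_of_mem hb, (I.mem_edgeSet_subgraph hA hp hb).2 ⟨hi, hx⟩⟩

end Subgraph

/-! ### Correctness of the algorithm -/

section Instance

variable (I : Instance)

theorem Instance.vertexList_eq : I.vertexList = List.range I.n := by
  simp [vertexList, List.zipIdx_map_snd, List.range_eq_range']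

theorem Instance.mem_edgeList {e : NamedEdge} :
    e ∈ I.edgeList ↔ ∃ e₀, I.edges[e.name]? = some e₀ ∧ e₀.data = e.1 := by
  obtain ⟨d, i⟩ := e
  rw [edgeList, List.mk_mem_zipIdx_iff_getElem?, List.getElem?_map, Option.map_eq_some_iff]
  rfl

theorem Instance.matches_edgeList {e : NamedEdge} (he : e ∈ I.edgeList) :
    Matches I.ends (List.range I.n) e := by
  obtain ⟨e₀, h, h'⟩ := I.mem_edgeList.1 he
  have hlt := I.ends_lt e₀ (List.mem_of_getElem? h)
  obtain ⟨d, i⟩ := e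
  obtain rfl : e₀.data = d := h'
  have h : I.edges[i]? = some e₀ := h
  refine ⟨?_, List.mem_range.2 hlt.1, List.mem_range.2 hlt.2⟩
  simp only [ends, NamedEdge.name, h]
  rfl

theorem Instance.map_name_edgeList : I.edgeList.map NamedEdge.name = List.range I.edges.length := by
  change I.edgeList.map Prod.snd = _
  simp [edgeList, List.zipIdx_map_snd, List.range_eq_range']

theorem Instance.names_edgeList : names I.edgeList = Finset.range I.edges.length := by
  ext i
  rw [Finset.mem_range, ← List.mem_range, ← I.map_name_edgeList, mem_names, List.mem_map]

theorem Instance.neg_iff {e : NamedEdge} (he : e ∈ I.edgeList) :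
    e.neg = true ↔ I.weight e.name < 0 := by
  obtain ⟨e₀, h, h'⟩ := I.mem_edgeList.1 he
  simp only [weight, h, NamedEdge.neg, ← h', Option.map_some, Option.getD_some, Edge.data,
    decide_eq_true_eq]

theorem Instance.abs_weight {e : NamedEdge} (he : e ∈ I.edgeList) :
    |I.weight e.name| = (e.num : ℚ) / e.den ∧ 0 < e.den := by
  obtain ⟨e₀, h, h'⟩ := I.mem_edgeList.1 he
  simp only [weight, h, NamedEdge.num, NamedEdge.den, ← h', Option.map_some, Option.getD_some,
    Edge.data]
  refine ⟨?_, e₀.weight.den_pos⟩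
  rw [Nat.cast_natAbs, Int.cast_abs, ← Nat.abs_cast e₀.weight.den, ← abs_div, Rat.num_div_den]

theorem Instance.le_iff {e f : NamedEdge} (he : e ∈ I.edgeList) (hf : f ∈ I.edgeList) :
    e.le f = true ↔ |I.weight e.name| ≤ |I.weight f.name| := by
  obtain ⟨h₁, h₂⟩ := I.abs_weight he
  obtain ⟨h₃, h₄⟩ := I.abs_weight hf
  rw [h₁, h₃, div_le_div_iff₀ (by exact_mod_cast h₂) (by exact_mod_cast h₄), NamedEdge.le,
    decide_eq_true_eq]
  exact_mod_cast Iff.rfl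

/-- Any packing has the weight of its edge set, which is feasible, and the trees in the output form
a packing whose edge set is the greedy set. So the optimality of the latter among feasible sets
carries over to packings. -/
theorem solve_isSolution : I.IsSolution (solve I) := by
  obtain ⟨hmem, hF, hopt⟩ := greedy_spec (ends := I.ends) (k := I.k) (w := I.weight)
    (List.nodup_range (n := I.n)) (by rw [Nat.dvd_one]; have := I.two_le_k; omega) I.edgeList
    I.names_edgeList (fun e he => I.matches_edgeList he)
    (by rw [I.map_name_edgeList]; exact List.nodup_range) (fun e he f hf => I.le_iff he hf)
    (fun e he => I.neg_iff he)
  rw [solve, I.vertexList_eq]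
  set es := greedy I.k (List.range I.n) I.edgeList with hes
  have hp := IsPartition.blocks (ends := I.ends) (vs := List.range I.n) (es := es) fun e he =>
    I.matches_edgeList (hmem e he)
  have hpack := Instance.isPacking_subgraph hF hp
  refine ⟨_, ⟨hpack, fun T hT => ?_⟩, ?_⟩
  · rw [Instance.totalWeight_eq (fun t ht => (hT.1 t ht).1) hT.2,
      Instance.totalWeight_eq (fun t ht => (hpack.1 t ht).1) hpack.2,
      Instance.edgesOf_subgraph hF.1 hp]
    exact hopt _ hT.feasible
  · rw [listTrees, List.forall₂_map_left_iff, List.forall₂_map_right_iff, List.forall₂_same]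
    intro b hb
    refine ⟨rfl, ?_⟩
    ext i
    rw [Instance.mem_edgeSet_subgraph hF.1 hp hb]
    simp only [Set.mem_ofPred_eq, List.mem_map, List.mem_filter, List.contains_iff_mem, mem_names]
    constructor
    · rintro ⟨⟨e, he, rfl⟩, h⟩
      rw [(I.matches_edgeList (hmem e he)).1] at h
      exact ⟨e, ⟨he, h⟩, rfl⟩
    · rintro ⟨e, ⟨he, h⟩, rfl⟩
      rw [(I.matches_edgeList (hmem e he)).1]
      exact ⟨⟨e, he, rfl⟩, h⟩

end Instance

end TreePacking

theorem mainTheorem9 :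
    TreePacking.SolvableInPolyTime TreePacking.encodeInstance TreePacking.encodeOutput
      TreePacking.Instance.IsSolution :=
  ⟨TreePacking.solve, TreePacking.solve_isSolution, TreePacking.solve_computableInPolyTime⟩
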